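/- Let $b^2\in\mathbb C$, $b_*^2=b^2-\tfrac12$, $q=e^{\pi i b^2}$, $q_*=e^{\pi i b_*^2}=-iq$, $q_*^x=e^{\pi i b_*^2x}$ for $x\in\mathbb C$, $[x]_{q_*}=\frac{q_*^x-q_*^{-x}}{q_*-q_*^{-1}}$, and assume that $q$ is not a root of unity. Let $\mathfrak b_+$ be the upper Borel subalgebra of $U_q(C^{(2)}(2))$: it has odd generators $\mathcal E_0,\mathcal E_1$ and even, commuting, invertible generators $\mathcal K_0,\mathcal K_1$, with relations $\mathcal K_i\mathcal E_j=q^{a_{ij}}\mathcal E_j\mathcal K_i$ ($a_{00}=a_{11}=2$, $a_{01}=a_{10}=-2$) and, for $i\ne j$, $\mathcal E_i^3\mathcal E_j+\{3\}_q\mathcal E_i^2\mathcal E_j\mathcal E_i-\{3\}_q\mathcal E_i\mathcal E_j\mathcal E_i^2-\mathcal E_j\mathcal E_i^3=0$, where $\{3\}_q=\frac{q^3+q^{-3}}{q+q^{-1}}$; the coproduct is $\Delta(\mathcal E_i)=\mathcal E_i\otimes\mathcal K_i+1\otimes\mathcal E_i$, $\Delta(\mathcal K_i)=\mathcal K_i\otimes\mathcal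 K_i$, with the super sign rule for tensor products. Consider the category $\mathcal O$ of $\mathbb Z/2$-graded representations of $\mathfrak b_+$ (with even morphisms) that are sums of finite-dimensional joint eigenspaces of $\mathcal K_0,\mathcal K_1$ whose weights $(\kappa_0,\kappa_1)$ lie in finitely many sets $\{(\omega_0q^{2n},\omega_1q^{-2n}):n\ge0\}$, and its Grothendieck ring: generated by the classes $[M]$, with $[M]=[M']+[M'']$ for short exact sequences, $[M\otimes N]=[M][N]$, and $1$ the class of the trivial even representation. For a sequence $M_m$ with $\bigoplus_mM_m\in\mathcal O$ write $\sum_m[M_m]:=[\bigoplus_mM_m]$. For $\lambda\in\mathbb C^\times$ and a sign $\varepsilon=\pm1$ (written also as $\pm$) consider the following objects of $\mathcal O$. * $\mathcal W_s^{\varepsilon}(\lambda)$, $s\in\mathbb C$: basis $|k\rangle$, $k\ge0$, of parity $\varepsilon(-1)^k$ (where $+1$ is even and $-1$ is odd), $\mathcal E_0|k\rangle=\lambda|k+1\rangle$, $\mathcal E_1|k\rangle=\lambda[k]_{q_*}[s-k+1]_{q_*}|k-1\rangle$, $\mathcal K_1|k\rangle=\varepsilon q^{-2k}q_*^{s}|k\rangle$,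 $\mathcal K_0=\mathcal K_1^{-1}$. * $W_s^{\varepsilon}(\lambda)$, $s=2l\in\mathbb Z_{\ge0}$: basis $e_m$, $m=l,l-1,\dots,-l$, of parity $\varepsilon(-1)^{l-m}$, $\mathcal E_1e_m=\lambda[l-m]_{q_*}e_{m+1}$, $\mathcal E_0e_m=\lambda[l+m]_{q_*}e_{m-1}$, $\mathcal K_1e_m=\varepsilon(-1)^{l-m}q_*^{2m}e_m$, $\mathcal K_0=\mathcal K_1^{-1}$. Write $W_s=W_s^+$. * $U_r^{\varepsilon}$, $r\in\mathbb C$: one-dimensional of parity $\varepsilon$, $\mathcal E_i=0$, $\mathcal K_1=\varepsilon q_*^{r}$, $\mathcal K_0=\varepsilon q_*^{-r}$. Write $U_r=U_r^+$ and $\sigma=[U_0^-]$. * $\rho_\pm(\lambda)$: with $\alpha_\pm,\mathcal H$ the generators of the $q$-oscillator algebra, $q\alpha_+\alpha_-+q^{-1}\alpha_-\alpha_+=-\frac1{q+q^{-1}}$, $[\mathcal H,\alpha_\pm]=\pm2\alpha_\pm$, the module $\rho_\pm(\lambda)$ is the Fock module with basis $\alpha_\mp^k|0\rangle_\pm$,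 $k\ge0$, $\alpha_\pm|0\rangle_\pm=0$, $\mathcal H|0\rangle_\pm=0$, with $\alpha_\pm$ odd and $|0\rangle_\pm$ even, and $\mathcal E_1=\lambda\alpha_\pm$, $\mathcal E_0=\lambda\alpha_\mp$, $\mathcal K_1=q^{\pm\mathcal H}$, $\mathcal K_0=q^{\mp\mathcal H}$. Put $f_s=\sum_{m\ge0}\sigma^m[U_{-s-2m}]=\sum_{m\ge0}[U_{-s-2m}^{(-1)^m}]$ for $s\in\mathbb C$. Then the following hold in the Grothendieck ring. 1. $\sigma^2=1$, $\sigma[\mathcal W_s^{\pm}(\lambda)]=[\mathcal W_s^{\mp}(\lambda)]$ for $s\in\mathbb C$, and $\sigma[U_r^{\pm}]=[U_r^{\mp}]$ for $r\in\mathbb C$. 2. $1-\sigma[U_{-2}]$ and all $f_s$, $s\in\mathbb C$, are invertible, and $f_s=[U_{-s}]\,(1-\sigma[U_{-2}])^{-1}$. 3. For every $s\in\mathbb C$, $\bigoplus_{m\ge0}U_{-s-2m}\otimes\mathcal W_s^{(-1)^m}(\lambda)$ belongs to $\mathcal O$ and $$[\rho_+(q_*^{\frac s2+\frac12}\lambda)\otimes\rho_-(q_*^{-\frac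 s2-\frac12}\lambda)]=\sum_{m\ge0}[U_{-s-2m}\otimes\mathcal W_s^{(-1)^m}(\lambda)],$$ $$[\rho_+(q_*^{\frac s2+\frac12}\lambda)]\,[\rho_-(q_*^{-\frac s2-\frac12}\lambda)]=[\mathcal W_s^+(\lambda)]\,f_s.$$ 4. For every integer $s\ge0$: $[\mathcal W_s^{\pm}(\lambda)]=[W_s^{\pm}(\lambda)]+[\mathcal W_{-s-2}^{\pm(-1)^{s+1}}(\lambda)]$; in particular $[\mathcal W_s^{+}(\lambda)]=[W_s(\lambda)]+\sigma^{s+1}[\mathcal W_{-s-2}^{+}(\lambda)]$; and $$[W_s(\lambda)]=f_s^{-1}[\rho_+(q_*^{\frac s2+\frac12}\lambda)][\rho_-(q_*^{-\frac s2-\frac12}\lambda)]-f_{-s-2}^{-1}\sigma^{s+1}[\rho_+(q_*^{-\frac s2-\frac12}\lambda)][\rho_-(q_*^{\frac s2+\frac12}\lambda)].$$ 5. ($q$-Wronskian identity) $$1=[W_0(\lambda)]=f_0^{-1}[\rho_+(q_*^{\frac12}\lambda)][\rho_-(q_*^{-\frac12}\lambda)]-f_{-2}^{-1}\sigma[\rho_+(q_*^{-\frac12}\lambda)][\rho_-(q_*^{\frac12}\lambda)].$$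 6. (Baxter relations) $$[W_1(\lambda)][\rho_\pm(\lambda)]=[U_1][\rho_\pm(q_*^{\pm1}\lambda)]+\sigma[U_{-1}][\rho_\pm(q_*^{\mp1}\lambda)].$$ -/

import Mathlib

open scoped TensorProduct DirectSum

namespace BorelC22

noncomputable section

/-- The deformation parameter, given through a logarithm `b²`, so that `q = exp (π i b²)`;
`q` is required not to be a root of unity. -/
structure QParam where
  bsq : ℂ
  generic : ∀ n : ℕ, 0 < n → Complex.exp (Real.pi * Complex.I * bsq) ^ n ≠ 1

namespace QParam

/-- `q = exp (π i b²)`. -/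
def q (p : QParam) : ℂ := Complex.exp (Real.pi * Complex.I * p.bsq)

/-- The complex power `q_* ^ x = exp (π i b_*² x)`, where `b_*² = b² - 1/2`. -/
def qsPow (p : QParam) (x : ℂ) : ℂ := Complex.exp (Real.pi * Complex.I * (p.bsq - 1 / 2) * x)

/-- `q_*`. -/
def qs (p : QParam) : ℂ := p.qsPow 1

/-- The quantum number `[x]_{q_*}`. -/
def qsNum (p : QParam) (x : ℂ) : ℂ := (p.qsPow x - p.qsPow (-x)) / (p.qs - p.qs⁻¹)

/-- The number `{3}_q`. -/
def three (p : QParam) : ℂ := (p.q ^ 3 + p.q⁻¹ ^ 3) / (p.q + p.q⁻¹)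

theorem q_ne_zero (p : QParam) : p.q ≠ 0 := Complex.exp_ne_zero _

theorem qsPow_ne_zero (p : QParam) (x : ℂ) : p.qsPow x ≠ 0 := Complex.exp_ne_zero _

theorem qsPow_add (p : QParam) (x y : ℂ) : p.qsPow (x + y) = p.qsPow x * p.qsPow y := by
  simp only [qsPow, mul_add, Complex.exp_add]

theorem qsPow_zero (p : QParam) : p.qsPow 0 = 1 := by simp [qsPow]

theorem qsPow_neg (p : QParam) (x : ℂ) : p.qsPow (-x) = (p.qsPow x)⁻¹ := by
  simp only [qsPow, mul_neg, Complex.exp_neg]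

theorem qsPow_natCast (p : QParam) (n : ℕ) : p.qsPow n = p.qs ^ n := by
  simp only [qs, qsPow, ← Complex.exp_nat_mul]
  ring_nf

theorem qs_eq (p : QParam) : p.qs = -Complex.I * p.q := by
  have h : Complex.exp (-(Real.pi / 2 * Complex.I)) = -Complex.I := by
    rw [Complex.exp_neg, Complex.exp_pi_div_two_mul_I, Complex.inv_I]
  rw [qs, qsPow, q, ← h, ← Complex.exp_add]
  ring_nf

theorem q_eq (p : QParam) : p.q = Complex.I * p.qs := by
  rw [qs_eq, ← mul_assoc, mul_neg, Complex.I_mul_I]; ring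

theorem qs_ne_zero (p : QParam) : p.qs ≠ 0 := p.qsPow_ne_zero 1

theorem q_sq (p : QParam) : p.q ^ 2 = -p.qs ^ 2 := by
  rw [q_eq, mul_pow, Complex.I_sq]; ring

theorem generic' (p : QParam) (n : ℕ) (hn : 0 < n) : p.q ^ n ≠ 1 := p.generic n hn

theorem qs_sq_sub_one_ne (p : QParam) : p.qs ^ 2 - 1 ≠ 0 := by
  intro h
  apply p.generic' 4 (by norm_num)
  have h1 : p.qs ^ 2 = 1 := by linear_combination h
  have : p.q ^ 4 = (p.q ^ 2) ^ 2 := by ring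
  rw [this, q_sq, h1]; norm_num

theorem q_sq_add_one_ne (p : QParam) : p.q ^ 2 + 1 ≠ 0 := by
  rw [q_sq]
  intro h
  exact p.qs_sq_sub_one_ne (by linear_combination -h)

theorem q_add_inv_ne (p : QParam) : p.q + p.q⁻¹ ≠ 0 := by
  have h := p.q_sq_add_one_ne
  have h0 := p.q_ne_zero
  intro h1
  apply h
  field_simp at h1
  linear_combination h1

theorem qs_sub_inv_ne (p : QParam) : p.qs - p.qs⁻¹ ≠ 0 := by
  have h := p.qs_sq_sub_one_ne
  have h0 := p.qs_ne_zero
  intro h1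
  apply h
  field_simp at h1
  linear_combination h1

theorem three_eq (p : QParam) : p.three = p.q ^ 2 - 1 + (p.q ^ 2)⁻¹ := by
  rw [three, div_eq_iff p.q_add_inv_ne]
  have h0 := p.q_ne_zero
  field_simp
  ring

theorem q_pow_injective (p : QParam) {m n : ℕ} (h : p.q ^ (2 * m) = p.q ^ (2 * n)) : m = n := by
  have key : ∀ m n : ℕ, m ≤ n → p.q ^ (2 * m) = p.q ^ (2 * n) → m = n := by
    intro m n hmn h
    obtain ⟨d, rfl⟩ := Nat.exists_eq_add_of_le hmn
    rcases Nat.eq_zero_or_pos d with rfl | hd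
    · rfl
    · exfalso
      apply p.generic' (2 * d) (by omega)
      rw [mul_add, pow_add] at h
      have h0 : p.q ^ (2 * m) ≠ 0 := pow_ne_zero _ p.q_ne_zero
      exact mul_left_cancel₀ h0 (by rw [mul_one]; exact h.symm)
  rcases le_total m n with h1 | h1
  · exact key m n h1 h
  · exact (key n m h1 h.symm).symm

end QParam

/-- The (symmetric) Cartan matrix, with rows and columns indexed by `0, 1`. -/
def cartan (i j : Fin 2) : ℤ := if i = j then 2 else -2

/-- A representation of the upper Borel subalgebra `𝔟₊` of `U_q(C^{(2)}(2))`: a `ℤ/2`-graded complex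
vector space, the grading being recorded by the parity involution (`+1` on even, `-1` on odd
vectors), with odd operators `E 0`, `E 1` and invertible even operators `K 0`, `K 1` satisfying the
defining relations of `𝔟₊`. -/
structure Rep (p : QParam) where
  V : Type
  [addCommGroup : AddCommGroup V]
  [module : Module ℂ V]
  parity : Module.End ℂ V
  E : Fin 2 → Module.End ℂ V
  K : Fin 2 → Module.End ℂ V
  Kinv : Fin 2 → Module.End ℂ V
  parity_sq : parity * parity = 1
  parity_E : ∀ i, parity * E i = -(E i * parity)
  parity_K : ∀ i, parity * K i = K i * parity
  K_Kinv : ∀ i, K i * Kinv i = 1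
  Kinv_K : ∀ i, Kinv i * K i = 1
  K_comm : ∀ i j, K i * K j = K j * K i
  K_E : ∀ i j, K i * E j = p.q ^ cartan i j • (E j * K i)
  serre : ∀ i j, i ≠ j →
    E i ^ 3 * E j + p.three • (E i ^ 2 * E j * E i) - p.three • (E i * E j * E i ^ 2)
      - E j * E i ^ 3 = 0

attribute [instance] Rep.addCommGroup Rep.module

namespace Rep

variable {p : QParam}

/-- A morphism of representations: an even linear map commuting with the action of `𝔟₊`. -/
structure Hom (M N : Rep p) where
  toLin : M.V →ₗ[ℂ] N.V
  map_parity : ∀ v, toLin (M.parity v) = N.parity (toLin v)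
  map_E : ∀ i v, toLin (M.E i v) = N.E i (toLin v)
  map_K : ∀ i v, toLin (M.K i v) = N.K i (toLin v)

/-- The space of vectors of weight `ω`, on which `K i` acts as the scalar `ω i`. -/
def weightSpace (M : Rep p) (ω : Fin 2 → ℂ) : Submodule ℂ M.V :=
  ⨅ i, (M.K i).eigenspace (ω i)

theorem mem_weightSpace {M : Rep p} {ω : Fin 2 → ℂ} {v : M.V} :
    v ∈ M.weightSpace ω ↔ ∀ i, M.K i v = ω i • v := by
  simp [weightSpace, Submodule.mem_iInf]

/-- The weights `ω₀ - n α₁`, `n ≥ 0`, in multiplicative notation. -/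
def cone (p : QParam) (ω₀ : Fin 2 → ℂ) : Set (Fin 2 → ℂ) :=
  {ω | ∃ n : ℕ, ω 0 = ω₀ 0 * p.q ^ (2 * n) ∧ ω 1 = ω₀ 1 * (p.q ^ (2 * n))⁻¹}

/-- Category `𝒪`: the representation is the sum of its weight spaces, these are finite-dimensional,
and the weights lie in a finite union of cones. -/
structure InO (M : Rep p) : Prop where
  iSup_weightSpace : ⨆ ω, M.weightSpace ω = ⊤
  finite_weightSpace : ∀ ω, FiniteDimensional ℂ (M.weightSpace ω)
  weights_in_cones : ∃ S : Finset (Fin 2 → ℂ), ∀ ω, M.weightSpace ω ≠ ⊥ → ∃ ω₀ ∈ S, ω ∈ cone p ω₀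

theorem iSupIndep_weightSpace (M : Rep p) : iSupIndep M.weightSpace := by
  have h := Module.End.independent_iInf_maxGenEigenspace_of_forall_mapsTo M.K
    (fun i j φ => Module.End.mapsTo_maxGenEigenspace_of_comm (M.K_comm j i) φ)
  refine h.mono fun ω => iInf_mono fun i => ?_
  exact (Module.End.genEigenspace (M.K i) (ω i)).monotone le_top

/-- A representation spanned by weight vectors of which only finitely many have a given weight. -/
theorem inO_of_span (M : Rep p) {ι : Type*} (b : ι → M.V) (wt : ι → Fin 2 → ℂ)
    (hb : ∀ k i, M.K i (b k) = wt k i • b k) (hspan : Submodule.span ℂ (Set.range b) = ⊤)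
    (hfin : ∀ ω, {k | wt k = ω}.Finite) (S : Finset (Fin 2 → ℂ))
    (hS : ∀ k, ∃ ω₀ ∈ S, wt k ∈ cone p ω₀) : InO M := by
  set T : (Fin 2 → ℂ) → Submodule ℂ M.V := fun ω => Submodule.span ℂ (b '' {k | wt k = ω}) with hT
  have hle : ∀ ω, T ω ≤ M.weightSpace ω := by
    intro ω
    rw [hT, Submodule.span_le]
    rintro _ ⟨k, rfl, rfl⟩
    exact mem_weightSpace.2 (hb k)
  have htop : ⨆ ω, T ω = ⊤ := by
    rw [eq_top_iff, ← hspan, Submodule.span_le]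
    rintro _ ⟨k, rfl⟩
    exact Submodule.mem_iSup_of_mem (wt k) (Submodule.subset_span ⟨k, rfl, rfl⟩)
  have heq : ∀ ω, M.weightSpace ω = T ω := by
    intro ω
    refine le_antisymm ?_ (hle ω)
    have hdis : Disjoint (M.weightSpace ω) (⨆ (ω') (_ : ω' ≠ ω), T ω') :=
      (M.iSupIndep_weightSpace ω).mono_right (iSup₂_mono fun ω' _ => hle ω')
    have hsup : T ω ⊔ (⨆ (ω') (_ : ω' ≠ ω), T ω') = ⊤ := by
      rw [eq_top_iff, ← htop]
      refine iSup_le fun ω' => ?_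
      by_cases h : ω' = ω
      · subst h; exact le_sup_left
      · exact le_sup_of_le_right (le_iSup₂_of_le ω' h le_rfl)
    intro v hv
    have hv' : v ∈ T ω ⊔ (⨆ (ω') (_ : ω' ≠ ω), T ω') := by rw [hsup]; trivial
    obtain ⟨y, hy, z, hz, rfl⟩ := Submodule.mem_sup.1 hv'
    have hz' : z ∈ M.weightSpace ω := by
      have := Submodule.sub_mem _ hv (hle ω hy)
      simpa using this
    have : z = 0 := by
      have := Submodule.mem_inf.2 ⟨hz', hz⟩
      rwa [disjoint_iff.1 hdis, Submodule.mem_bot] at this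
    simpa [this] using hy
  refine ⟨?_, ?_, S, ?_⟩
  · simp_rw [heq]; exact htop
  · intro ω
    rw [heq]
    exact FiniteDimensional.span_of_finite ℂ ((hfin ω).image b)
  · intro ω hω
    rw [heq] at hω
    have : {k | wt k = ω}.Nonempty := by
      by_contra h
      rw [Set.not_nonempty_iff_eq_empty] at h
      apply hω
      simp [hT, h]
    obtain ⟨k, rfl⟩ := this
    exact hS k

theorem InO.exists_span {M : Rep p} (h : InO M) :
    ∃ (ι : Type) (b : ι → M.V) (wt : ι → Fin 2 → ℂ),
      (∀ k i, M.K i (b k) = wt k i • b k) ∧ Submodule.span ℂ (Set.range b) = ⊤ ∧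
      (∀ ω, {k | wt k = ω}.Finite) ∧ (∀ k i, wt k i ≠ 0) ∧
      ∃ S : Finset (Fin 2 → ℂ), ∀ k, ∃ ω₀ ∈ S, wt k ∈ cone p ω₀ := by
  have hf := h.finite_weightSpace
  obtain ⟨S, hS⟩ := h.weights_in_cones
  let B := fun ω => Module.finBasis ℂ (M.weightSpace ω)
  have hB : ∀ k : (Σ ω, Fin (Module.finrank ℂ (M.weightSpace ω))),
      ((B k.1 k.2 : M.weightSpace k.1) : M.V) ≠ 0 := by
    intro k hk
    exact (B k.1).ne_zero k.2 (Subtype.ext hk)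
  have hK : ∀ (k : (Σ ω, Fin (Module.finrank ℂ (M.weightSpace ω)))) (i : Fin 2),
      M.K i (B k.1 k.2 : M.weightSpace k.1) = k.1 i • ((B k.1 k.2 : M.weightSpace k.1) : M.V) :=
    fun k => mem_weightSpace.1 (B k.1 k.2).2
  refine ⟨Σ ω, Fin (Module.finrank ℂ (M.weightSpace ω)), fun k => (B k.1 k.2 : M.weightSpace k.1),
    fun k => k.1, hK, ?_, ?_, ?_, S, ?_⟩
  · rw [eq_top_iff, ← h.iSup_weightSpace]
    refine iSup_le fun ω => ?_
    have h1 : M.weightSpace ω = (⊤ : Submodule ℂ (M.weightSpace ω)).map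
        (M.weightSpace ω).subtype := by simp
    rw [h1, ← (B ω).span_eq, Submodule.map_span, Submodule.span_le]
    rintro _ ⟨_, ⟨k, rfl⟩, rfl⟩
    exact Submodule.subset_span ⟨⟨ω, k⟩, rfl⟩
  · intro ω
    refine (Set.finite_range (fun j : Fin (Module.finrank ℂ (M.weightSpace ω)) =>
      (⟨ω, j⟩ : Σ ω, Fin (Module.finrank ℂ (M.weightSpace ω))))).subset ?_
    rintro ⟨ω', j⟩ rfl
    exact ⟨j, rfl⟩
  · intro k i h0
    change k.1 i = 0 at h0
    apply hB k
    have h1 := congrArg (M.Kinv i) (hK k i)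
    rw [h0, zero_smul, map_zero, ← Module.End.mul_apply, M.Kinv_K, Module.End.one_apply] at h1
    exact h1
  · intro k
    apply hS
    intro hbot
    apply hB k
    have h2 : ∀ v ∈ M.weightSpace k.1, v = 0 := by
      intro v hv
      rw [show M.weightSpace k.1 = ⊥ from hbot] at hv
      simpa using hv
    exact h2 _ (B k.1 k.2 : M.weightSpace k.1).2

theorem serre_add {A : Type*} [Ring A] [Algebra ℂ A] (t c : ℂ) (ht : t ≠ 0)
    (hc : c = t - 1 + t⁻¹) (x y x' y' : A)
    (hxy : x * y = (-t) • (y * x)) (hx'y : x' * y = (-t⁻¹) • (y * x'))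
    (hxy' : x * y' = (-t⁻¹) • (y' * x))
    (hx : x ^ 3 * x' + c • (x ^ 2 * x' * x) - c • (x * x' * x ^ 2) - x' * x ^ 3 = 0)
    (hy : y ^ 3 * y' + c • (y ^ 2 * y' * y) - c • (y * y' * y ^ 2) - y' * y ^ 3 = 0) :
    (x + y) ^ 3 * (x' + y') + c • ((x + y) ^ 2 * (x' + y') * (x + y))
      - c • ((x + y) * (x' + y') * (x + y) ^ 2) - (x' + y') * (x + y) ^ 3 = 0 := by
  have a1 : ∀ z, x * (y * z) = (-t) • (y * (x * z)) := fun z => by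
    rw [← mul_assoc, hxy, smul_mul_assoc, mul_assoc]
  have a2 : ∀ z, x' * (y * z) = (-t⁻¹) • (y * (x' * z)) := fun z => by
    rw [← mul_assoc, hx'y, smul_mul_assoc, mul_assoc]
  have a3 : ∀ z, x * (y' * z) = (-t⁻¹) • (y' * (x * z)) := fun z => by
    rw [← mul_assoc, hxy', smul_mul_assoc, mul_assoc]
  rw [← add_zero (0 : A)]
  nth_rewrite 1 [← hx]
  rw [← hy]
  simp only [pow_succ, pow_zero, one_mul, mul_add, add_mul, mul_assoc, hxy, hx'y, hxy', a1, a2, a3,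
    smul_mul_assoc, mul_smul_comm, smul_smul, smul_add]
  subst hc
  match_scalars <;> field_simp <;> ring

/-- The tensor product of two representations, on which `𝔟₊` acts through the coproduct
`Δ(E i) = E i ⊗ K i + 1 ⊗ E i`, `Δ(K i) = K i ⊗ K i`, with the sign rule
`(1 ⊗ E i) (v ⊗ w) = (-1)^{|v|} v ⊗ E i w`. -/
def tensor (M N : Rep p) : Rep p where
  V := M.V ⊗[ℂ] N.V
  parity := TensorProduct.map M.parity N.parity
  E i := TensorProduct.map (M.E i) (N.K i) + TensorProduct.map M.parity (N.E i)
  K i := TensorProduct.map (M.K i) (N.K i)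
  Kinv i := TensorProduct.map (M.Kinv i) (N.Kinv i)
  parity_sq := by
    rw [← TensorProduct.map_mul, M.parity_sq, N.parity_sq, TensorProduct.map_one]
  parity_E i := by
    rw [mul_add, add_mul, ← TensorProduct.map_mul, ← TensorProduct.map_mul,
      ← TensorProduct.map_mul, ← TensorProduct.map_mul, M.parity_E, N.parity_E, N.parity_K]
    rw [← neg_one_smul ℂ (M.E i * M.parity), ← neg_one_smul ℂ (N.E i * N.parity),
      TensorProduct.map_smul_left, TensorProduct.map_smul_right]
    module
  parity_K i := by
    rw [← TensorProduct.map_mul, ← TensorProduct.map_mul, M.parity_K, N.parity_K]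
  K_Kinv i := by rw [← TensorProduct.map_mul, M.K_Kinv, N.K_Kinv, TensorProduct.map_one]
  Kinv_K i := by rw [← TensorProduct.map_mul, M.Kinv_K, N.Kinv_K, TensorProduct.map_one]
  K_comm i j := by
    rw [← TensorProduct.map_mul, ← TensorProduct.map_mul, M.K_comm, N.K_comm]
  K_E i j := by
    rw [mul_add, add_mul, ← TensorProduct.map_mul, ← TensorProduct.map_mul,
      ← TensorProduct.map_mul, ← TensorProduct.map_mul, M.K_E, N.K_E, N.K_comm i j, M.parity_K]
    simp only [TensorProduct.map_smul_left, TensorProduct.map_smul_right, smul_add]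
  serre i j hij := by
    have hq2 : p.q ^ 2 ≠ 0 := pow_ne_zero _ p.q_ne_zero
    have hii : cartan i i = 2 := by simp [cartan]
    have hij1 : cartan i j = -2 := by simp [cartan, hij]
    have hji1 : cartan j i = -2 := by simp [cartan, hij.symm]
    have z2 : p.q ^ (2 : ℤ) = p.q ^ 2 := by norm_cast
    have z2' : p.q ^ (-2 : ℤ) = (p.q ^ 2)⁻¹ := by rw [zpow_neg, z2]
    have comm : ∀ k l : Fin 2, TensorProduct.map (M.E k) (N.K k) * TensorProduct.map M.parity (N.E l)
        = (-(p.q ^ cartan k l)) •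
          (TensorProduct.map M.parity (N.E l) * TensorProduct.map (M.E k) (N.K k)) := by
      intro k l
      rw [← TensorProduct.map_mul, ← TensorProduct.map_mul, N.K_E, M.parity_E,
        TensorProduct.map_smul_right, ← neg_one_smul ℂ (M.E k * M.parity),
        TensorProduct.map_smul_left, smul_smul]
      congr 1; ring
    refine serre_add (p.q ^ 2) p.three hq2 p.three_eq _ _ _ _ ?_ ?_ ?_ ?_ ?_
    · rw [comm, hii, z2]
    · rw [comm, hji1, z2']
    · rw [comm, hij1, z2']
    · have hK : N.K j * N.K i = N.K i * N.K j := N.K_comm j i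
      have h := M.serre i j hij
      have e1 : N.K i ^ 2 * N.K j * N.K i = N.K i ^ 3 * N.K j := by
        rw [mul_assoc, hK, ← mul_assoc, ← pow_succ]
      have e2 : N.K i * N.K j * N.K i ^ 2 = N.K i ^ 3 * N.K j := by
        rw [← hK, mul_assoc, ← pow_succ']
        exact ((Commute.pow_left (show N.K i * N.K j = N.K j * N.K i from N.K_comm i j) 3)).symm
      have e3 : N.K j * N.K i ^ 3 = N.K i ^ 3 * N.K j :=
        ((Commute.pow_left (show N.K i * N.K j = N.K j * N.K i from N.K_comm i j) 3)).symm
      simp only [TensorProduct.map_pow, ← TensorProduct.map_mul, e1, e2, e3,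
        ← TensorProduct.map_smul_left, ← TensorProduct.map_add_left]
      rw [sub_eq_add_neg, sub_eq_add_neg, ← neg_one_smul ℂ, ← neg_one_smul ℂ (TensorProduct.map _ _),
        ← TensorProduct.map_smul_left, ← TensorProduct.map_smul_left, ← TensorProduct.map_add_left,
        ← TensorProduct.map_add_left, neg_one_smul, neg_one_smul, ← sub_eq_add_neg,
        ← sub_eq_add_neg, h, TensorProduct.map_zero_left]
    · have h := N.serre i j hij
      have e0 : M.parity ^ 3 * M.parity = 1 := by
        rw [pow_succ, pow_two, M.parity_sq, one_mul, M.parity_sq]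
      have e1 : M.parity ^ 2 * M.parity * M.parity = 1 := by
        rw [pow_two, M.parity_sq, one_mul, M.parity_sq]
      have e2 : M.parity * M.parity * M.parity ^ 2 = 1 := by
        rw [pow_two, M.parity_sq, one_mul]
      have e3 : M.parity * M.parity ^ 3 = 1 := by
        rw [← pow_succ', pow_succ]; exact e0
      simp only [TensorProduct.map_pow, ← TensorProduct.map_mul, e0, e1, e2, e3,
        ← TensorProduct.map_smul_right, ← TensorProduct.map_add_right]
      rw [sub_eq_add_neg, sub_eq_add_neg, ← neg_one_smul ℂ, ← neg_one_smul ℂ (TensorProduct.map _ _),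
        ← TensorProduct.map_smul_right, ← TensorProduct.map_smul_right,
        ← TensorProduct.map_add_right, ← TensorProduct.map_add_right, neg_one_smul, neg_one_smul,
        ← sub_eq_add_neg, ← sub_eq_add_neg, h, TensorProduct.map_zero_right]

theorem InO.tensor {M N : Rep p} (hM : InO M) (hN : InO N) : InO (M.tensor N) := by
  classical
  obtain ⟨ι, b, wt, hb, hspan, hfin, hne, S, hS⟩ := hM.exists_span
  obtain ⟨ι', b', wt', hb', hspan', hfin', hne', S', hS'⟩ := hN.exists_span
  refine inO_of_span _ (fun k : ι × ι' => b k.1 ⊗ₜ[ℂ] b' k.2) (fun k i => wt k.1 i * wt' k.2 i)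
    ?_ ?_ ?_ ((S ×ˢ S').image fun x i => x.1 i * x.2 i) ?_
  · rintro ⟨k, l⟩ i
    change TensorProduct.map (M.K i) (N.K i) (b k ⊗ₜ b' l) =
      (wt k i * wt' l i) • (b k ⊗ₜ[ℂ] b' l)
    rw [TensorProduct.map_tmul, hb, hb', TensorProduct.smul_tmul_smul]
  · change Submodule.span ℂ (Set.range fun k : ι × ι' => b k.1 ⊗ₜ[ℂ] b' k.2) =
      (⊤ : Submodule ℂ (M.V ⊗[ℂ] N.V))
    rw [eq_top_iff, ← TensorProduct.span_tmul_eq_top ℂ M.V N.V, Submodule.span_le]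
    rintro _ ⟨v, w, rfl⟩
    have hv : v ∈ Submodule.span ℂ (Set.range b) := by rw [hspan]; trivial
    have hw : w ∈ Submodule.span ℂ (Set.range b') := by rw [hspan']; trivial
    have : v ⊗ₜ[ℂ] w ∈ Submodule.map₂ (TensorProduct.mk ℂ M.V N.V)
        (Submodule.span ℂ (Set.range b)) (Submodule.span ℂ (Set.range b')) :=
      Submodule.apply_mem_map₂ _ hv hw
    rw [Submodule.map₂_span_span] at this
    refine Submodule.span_mono ?_ this
    rintro _ ⟨_, ⟨k, rfl⟩, _, ⟨l, rfl⟩, rfl⟩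
    exact ⟨(k, l), rfl⟩
  · intro ω
    let g : (Fin 2 → ℂ) × ℕ → (Fin 2 → ℂ) := fun x =>
      ![x.1 0 * p.q ^ (2 * x.2), x.1 1 * (p.q ^ (2 * x.2))⁻¹]
    have hg : ∀ ω₀ ω' n, ω' 0 = ω₀ 0 * p.q ^ (2 * n) → ω' 1 = ω₀ 1 * (p.q ^ (2 * n))⁻¹ →
        ω' = g (ω₀, n) := by
      intro ω₀ ω' n h0 h1
      funext i
      fin_cases i
      · exact h0
      · exact h1
    have hN : ∃ B : ℕ, ∀ ω₀ ∈ S, ∀ ω₁ ∈ S', ∀ n m : ℕ, ω 0 ≠ 0 →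
        ω 0 = ω₀ 0 * p.q ^ (2 * n) * (ω₁ 0 * p.q ^ (2 * m)) → n + m ≤ B := by
      have h1 : ∀ x : (Fin 2 → ℂ) × (Fin 2 → ℂ), ∃ B : ℕ, ∀ n m : ℕ, ω 0 ≠ 0 →
          ω 0 = x.1 0 * p.q ^ (2 * n) * (x.2 0 * p.q ^ (2 * m)) → n + m ≤ B := by
        intro x
        by_cases hx : ∃ n m : ℕ, ω 0 ≠ 0 ∧
            ω 0 = x.1 0 * p.q ^ (2 * n) * (x.2 0 * p.q ^ (2 * m))
        · obtain ⟨n, m, hω, h⟩ := hx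
          refine ⟨n + m, fun n' m' _ h' => le_of_eq ?_⟩
          apply p.q_pow_injective
          have hx0 : x.1 0 * x.2 0 ≠ 0 := by
            intro h0
            apply hω
            rw [h]
            linear_combination (p.q ^ (2 * n) * p.q ^ (2 * m)) * h0
          apply mul_left_cancel₀ hx0
          rw [mul_add, mul_add, pow_add, pow_add]
          linear_combination h - h'
        · push Not at hx
          exact ⟨0, fun n m h0 h => absurd h (hx n m h0)⟩
      choose B hB using h1
      refine ⟨(S ×ˢ S').sup B, fun ω₀ h₀ ω₁ h₁ n m hω h => ?_⟩
      exact (hB (ω₀, ω₁) n m hω h).trans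
        (Finset.le_sup (f := B) (Finset.mem_product.2 ⟨h₀, h₁⟩))
    obtain ⟨B, hB⟩ := hN
    let F : Finset (Fin 2 → ℂ) := (S ×ˢ Finset.range (B + 1)).image g
    let F' : Finset (Fin 2 → ℂ) := (S' ×ˢ Finset.range (B + 1)).image g
    have hfF : {k | wt k ∈ F}.Finite := by
      have : {k | wt k ∈ F} = ⋃ ω' ∈ F, {k | wt k = ω'} := by ext; simp
      rw [this]
      exact F.finite_toSet.biUnion fun ω' _ => hfin ω'
    have hfF' : {k | wt' k ∈ F'}.Finite := by
      have : {k | wt' k ∈ F'} = ⋃ ω' ∈ F', {k | wt' k = ω'} := by ext; simp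
      rw [this]
      exact F'.finite_toSet.biUnion fun ω' _ => hfin' ω'
    refine (hfF.prod hfF').subset ?_
    rintro ⟨k, l⟩ hkl
    obtain ⟨ω₀, h₀, n, hn0, hn1⟩ := hS k
    obtain ⟨ω₁, h₁, m, hm0, hm1⟩ := hS' l
    have hω0 : wt k 0 * wt' l 0 = ω 0 := congrFun hkl 0
    have hnm := hB ω₀ h₀ ω₁ h₁ n m (by rw [← hω0]; exact mul_ne_zero (hne k 0) (hne' l 0))
      (by rw [← hω0, hn0, hm0])
    refine ⟨Finset.mem_image.2 ⟨(ω₀, n), Finset.mem_product.2 ⟨h₀, Finset.mem_range.2 ?_⟩,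
      (hg _ _ _ hn0 hn1).symm⟩, Finset.mem_image.2 ⟨(ω₁, m), Finset.mem_product.2
      ⟨h₁, Finset.mem_range.2 ?_⟩, (hg _ _ _ hm0 hm1).symm⟩⟩
    · show n < B + 1
      omega
    · show m < B + 1
      omega
  · rintro ⟨k, l⟩
    obtain ⟨ω₀, h₀, n, hn0, hn1⟩ := hS k
    obtain ⟨ω₁, h₁, m, hm0, hm1⟩ := hS' l
    refine ⟨fun i => ω₀ i * ω₁ i, Finset.mem_image.2 ⟨(ω₀, ω₁),
      Finset.mem_product.2 ⟨h₀, h₁⟩, rfl⟩, n + m, ?_, ?_⟩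
    · change wt k 0 * wt' l 0 = _
      rw [hn0, hm0, mul_add, pow_add]; ring
    · change wt k 1 * wt' l 1 = _
      rw [hn1, hm1, mul_add, pow_add, mul_inv]; ring

/-- The one-dimensional representation on which `E 0`, `E 1` act as `0` and `K i` acts as the scalar
`x i`, even if `ε = 1` and odd if `ε = -1`. -/
def oneDim (p : QParam) (x : Fin 2 → ℂ) (hx : ∀ i, x i ≠ 0) (ε : ℤˣ) : Rep p where
  V := ℂ
  parity := ((ε : ℤ) : ℂ) • 1
  E _ := 0
  K i := x i • 1
  Kinv i := (x i)⁻¹ • 1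
  parity_sq := by
    have : ((ε : ℤ) : ℂ) * ((ε : ℤ) : ℂ) = 1 := by
      rw [← Int.cast_mul, ← Units.val_mul, Int.units_mul_self]; simp
    simp [smul_smul, this]
  parity_E i := by simp
  parity_K i := by simp [smul_smul, mul_comm]
  K_Kinv i := by simp [smul_smul, hx]
  Kinv_K i := by simp [smul_smul, hx]
  K_comm i j := by simp [smul_smul, mul_comm]
  K_E i j := by simp
  serre i j _ := by simp

/-- The direct sum of a sequence of representations. -/
def directSum (M : ℕ → Rep p) : Rep p where
  V := ⨁ m, (M m).V
  parity := DirectSum.lmap fun m => (M m).parity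
  E i := DirectSum.lmap fun m => (M m).E i
  K i := DirectSum.lmap fun m => (M m).K i
  Kinv i := DirectSum.lmap fun m => (M m).Kinv i
  parity_sq := by
    refine LinearMap.ext fun v => DFinsupp.ext fun m => ?_
    exact LinearMap.congr_fun (M m).parity_sq (v m)
  parity_E i := by
    refine LinearMap.ext fun v => DFinsupp.ext fun m => ?_
    exact LinearMap.congr_fun ((M m).parity_E i) (v m)
  parity_K i := by
    refine LinearMap.ext fun v => DFinsupp.ext fun m => ?_
    exact LinearMap.congr_fun ((M m).parity_K i) (v m)
  K_Kinv i := by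
    refine LinearMap.ext fun v => DFinsupp.ext fun m => ?_
    exact LinearMap.congr_fun ((M m).K_Kinv i) (v m)
  Kinv_K i := by
    refine LinearMap.ext fun v => DFinsupp.ext fun m => ?_
    exact LinearMap.congr_fun ((M m).Kinv_K i) (v m)
  K_comm i j := by
    refine LinearMap.ext fun v => DFinsupp.ext fun m => ?_
    exact LinearMap.congr_fun ((M m).K_comm i j) (v m)
  K_E i j := by
    refine LinearMap.ext fun v => DFinsupp.ext fun m => ?_
    exact LinearMap.congr_fun ((M m).K_E i j) (v m)
  serre i j hij := by
    refine LinearMap.ext fun v => DFinsupp.ext fun m => ?_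
    exact LinearMap.congr_fun ((M m).serre i j hij) (v m)

end Rep

/-- The basis vector `|k⟩`. -/
def ket {ι : Type} (k : ι) : ι →₀ ℂ := Finsupp.single k 1

/-- On vectors indexed by `0, 1, 2, …`: the operator `|k⟩ ↦ |k + 1⟩`. -/
def up : Module.End ℂ (ℕ →₀ ℂ) := Finsupp.linearCombination ℂ fun k => ket (k + 1)

/-- The operator `|k⟩ ↦ c k |k - 1⟩`; it is used with `c 0 = 0`, so that `|0⟩ ↦ 0`. -/
def down (c : ℕ → ℂ) : Module.End ℂ (ℕ →₀ ℂ) :=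
  Finsupp.linearCombination ℂ fun k => c k • ket (k - 1)

/-- The operator `|k⟩ ↦ d k |k⟩`. -/
def diag {ι : Type} (d : ι → ℂ) : Module.End ℂ (ι →₀ ℂ) :=
  Finsupp.linearCombination ℂ fun k => d k • ket k

theorem linearCombination_ket {ι M : Type} [AddCommGroup M] [Module ℂ M] (f : ι → M) (k : ι) :
    Finsupp.linearCombination ℂ f (ket k) = f k := by
  simp [ket]

theorem up_ket (k : ℕ) : up (ket k) = ket (k + 1) := linearCombination_ket _ _

theorem down_ket (c : ℕ → ℂ) (k : ℕ) : down c (ket (k + 1)) = c (k + 1) • ket k :=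
  linearCombination_ket _ _

theorem down_ket_zero (c : ℕ → ℂ) (hc : c 0 = 0) : down c (ket 0) = 0 := by
  rw [down, linearCombination_ket, hc, zero_smul]

theorem diag_ket {ι : Type} (d : ι → ℂ) (k : ι) : diag d (ket k) = d k • ket k :=
  linearCombination_ket _ _

theorem end_ext {ι : Type} {A B : Module.End ℂ (ι →₀ ℂ)}
    (h : ∀ k, A (ket k) = B (ket k)) : A = B :=
  Finsupp.lhom_ext' fun k => LinearMap.ext_ring (h k)

theorem span_ket {ι : Type} : Submodule.span ℂ (Set.range (ket : ι → ι →₀ ℂ)) = ⊤ := by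
  have := (Finsupp.basisSingleOne (R := ℂ) (ι := ι)).span_eq
  convert this using 3
  ext k : 1
  simp [ket]

theorem diag_mul {ι : Type} (d d' : ι → ℂ) : diag d * diag d' = diag (fun k => d k * d' k) := by
  refine end_ext fun k => ?_
  rw [Module.End.mul_apply, diag_ket, map_smul, diag_ket, diag_ket, smul_smul, mul_comm]

theorem diag_one {ι : Type} : diag (fun _ : ι => 1) = 1 :=
  end_ext fun k => by rw [diag_ket, one_smul, Module.End.one_apply]

theorem units_sq (ε : ℤˣ) : ((ε : ℤ) : ℂ) * ((ε : ℤ) : ℂ) = 1 := by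
  rw [← Int.cast_mul, ← Units.val_mul, Int.units_mul_self]; simp

theorem units_ne (ε : ℤˣ) : ((ε : ℤ) : ℂ) ≠ 0 := by
  intro h
  have := units_sq ε
  rw [h] at this
  simp at this

theorem neg_one_pow_sq (k : ℕ) : (-1 : ℂ) ^ k * (-1) ^ k = 1 := by
  rw [← mul_pow]; simp

/-- The relation on the coefficients that the Serre relations amount to below. -/
def SerreCoeff (p : QParam) (c : ℕ → ℂ) : Prop :=
  ∀ k, c k + p.three * c (k + 1) - p.three * c (k + 2) - c (k + 3) = 0

/-- The representation with basis `|k⟩`, `k ≥ 0`, given by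
`E₀ |k⟩ = u |k + 1⟩`, `E₁ |k⟩ = u c_k |k - 1⟩`, `K₁ |k⟩ = x q ^ (-2k) |k⟩`, `K₀ = K₁⁻¹`,
where `|k⟩` has parity `ε (-1) ^ k`. -/
def ladder (p : QParam) (x : ℂ) (hx : x ≠ 0) (ε : ℤˣ) (u : ℂ) (c : ℕ → ℂ) (hc0 : c 0 = 0)
    (hc : SerreCoeff p c) : Rep p where
  V := ℕ →₀ ℂ
  parity := diag fun k => ((ε : ℤ) : ℂ) * (-1) ^ k
  E := ![u • up, u • down c]
  K := ![diag fun k => x⁻¹ * p.q ^ (2 * k), diag fun k => x * (p.q ^ (2 * k))⁻¹]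
  Kinv := ![diag fun k => x * (p.q ^ (2 * k))⁻¹, diag fun k => x⁻¹ * p.q ^ (2 * k)]
  parity_sq := by
    rw [diag_mul, ← diag_one]
    congr 1; funext k
    linear_combination ((-1 : ℂ) ^ k * (-1) ^ k) * units_sq ε + neg_one_pow_sq k
  parity_E i := by
    refine end_ext fun k => ?_
    fin_cases i
    · simp only [Fin.zero_eta, Matrix.cons_val_zero, Module.End.mul_apply, LinearMap.neg_apply,
        LinearMap.smul_apply, map_smul, up_ket, diag_ket, smul_smul, pow_succ]
      match_scalars
      ring
    · cases k with
      | zero =>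
        simp only [Fin.mk_one, Matrix.cons_val_one, Matrix.cons_val_zero, Module.End.mul_apply,
          LinearMap.neg_apply, LinearMap.smul_apply, map_smul, down_ket_zero c hc0, diag_ket,
          map_zero, smul_zero, neg_zero]
      | succ k =>
        simp only [Fin.mk_one, Matrix.cons_val_one, Matrix.cons_val_zero, Module.End.mul_apply,
          LinearMap.neg_apply, LinearMap.smul_apply, map_smul, down_ket, diag_ket, smul_smul,
          pow_succ]
        match_scalars
        ring
  parity_K i := by
    fin_cases i <;> simp [diag_mul, mul_comm]
  K_Kinv i := by
    have hq := p.q_ne_zero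
    fin_cases i <;> simp only [Fin.zero_eta, Fin.mk_one, Matrix.cons_val_zero, Matrix.cons_val_one,
      diag_mul, ← diag_one] <;> congr 1 <;> funext k <;> field_simp
  Kinv_K i := by
    have hq := p.q_ne_zero
    fin_cases i <;> simp only [Fin.zero_eta, Fin.mk_one, Matrix.cons_val_zero, Matrix.cons_val_one,
      diag_mul, ← diag_one] <;> congr 1 <;> funext k <;> field_simp
  K_comm i j := by
    fin_cases i <;> fin_cases j <;> simp [diag_mul, mul_comm]
  K_E i j := by
    have hq := p.q_ne_zero
    have z2 : p.q ^ (2 : ℤ) = p.q ^ 2 := by norm_cast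
    have z2' : p.q ^ (-2 : ℤ) = (p.q ^ 2)⁻¹ := by rw [zpow_neg, z2]
    have c00 : p.q ^ cartan 0 0 = p.q ^ 2 := by rw [← z2]; rfl
    have c11 : p.q ^ cartan 1 1 = p.q ^ 2 := by rw [← z2]; rfl
    have c01 : p.q ^ cartan 0 1 = (p.q ^ 2)⁻¹ := by rw [← z2']; rfl
    have c10 : p.q ^ cartan 1 0 = (p.q ^ 2)⁻¹ := by rw [← z2']; rfl
    refine end_ext fun k => ?_
    fin_cases j
    · fin_cases i <;>
      · simp only [Fin.zero_eta, Fin.mk_one, Matrix.cons_val_one, Matrix.cons_val_zero,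
          Module.End.mul_apply, LinearMap.smul_apply, map_smul, up_ket, diag_ket, smul_smul,
          c00, c10]
        match_scalars
        field_simp
        try ring
    · cases k with
      | zero =>
        fin_cases i <;>
        simp only [Fin.zero_eta, Fin.mk_one, Matrix.cons_val_one, Matrix.cons_val_zero,
          Module.End.mul_apply, LinearMap.smul_apply, map_smul, down_ket_zero c hc0, diag_ket,
          map_zero, smul_zero]
      | succ k =>
        fin_cases i <;>
        · simp only [Fin.zero_eta, Fin.mk_one, Matrix.cons_val_one, Matrix.cons_val_zero,
            Module.End.mul_apply, LinearMap.smul_apply, map_smul, down_ket, diag_ket, smul_smul,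
            c01, c11]
          match_scalars
          field_simp
          try ring
  serre i j hij := by
    refine end_ext fun k => ?_
    fin_cases i <;> fin_cases j <;> first | exact absurd rfl hij | skip
    · cases k with
      | zero =>
        have h := hc 0
        simp only [hc0, zero_add] at h
        simp only [Fin.zero_eta, Fin.mk_one, Matrix.cons_val_one, Matrix.cons_val_zero,
          Module.End.mul_apply, LinearMap.smul_apply, LinearMap.add_apply, LinearMap.sub_apply,
          LinearMap.zero_apply, map_smul, map_zero, smul_zero, pow_succ, pow_zero, one_mul,
          up_ket, down_ket, down_ket_zero c hc0, smul_smul, zero_add]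
        match_scalars
        linear_combination (u ^ 4) * h
      | succ k =>
        have h := hc (k + 1)
        simp only [Fin.zero_eta, Fin.mk_one, Matrix.cons_val_one, Matrix.cons_val_zero,
          Module.End.mul_apply, LinearMap.smul_apply, LinearMap.add_apply, LinearMap.sub_apply,
          LinearMap.zero_apply, map_smul, pow_succ, pow_zero, one_mul,
          up_ket, down_ket, smul_smul]
        match_scalars
        linear_combination (u ^ 4) * h
    · rcases k with _ | _ | _ | k
      · simp only [Fin.zero_eta, Fin.mk_one, Matrix.cons_val_one, Matrix.cons_val_zero,
          Module.End.mul_apply, LinearMap.smul_apply, LinearMap.add_apply, LinearMap.sub_apply,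
          LinearMap.zero_apply, map_smul, map_zero, smul_zero, pow_succ, pow_zero, one_mul,
          up_ket, down_ket, down_ket_zero c hc0, smul_smul, zero_add, sub_zero, add_zero]
      · simp only [Fin.zero_eta, Fin.mk_one, Matrix.cons_val_one, Matrix.cons_val_zero,
          Module.End.mul_apply, LinearMap.smul_apply, LinearMap.add_apply, LinearMap.sub_apply,
          LinearMap.zero_apply, map_smul, map_zero, smul_zero, pow_succ, pow_zero, one_mul,
          up_ket, down_ket, down_ket_zero c hc0, smul_smul, zero_add, sub_zero, add_zero]
      · have h := hc 0
        simp only [hc0, zero_add] at h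
        simp only [Fin.zero_eta, Fin.mk_one, Matrix.cons_val_one, Matrix.cons_val_zero,
          Module.End.mul_apply, LinearMap.smul_apply, LinearMap.add_apply, LinearMap.sub_apply,
          LinearMap.zero_apply, map_smul, map_zero, smul_zero, pow_succ, pow_zero, one_mul,
          up_ket, down_ket, down_ket_zero c hc0, smul_smul, zero_add, sub_zero]
        match_scalars
        linear_combination (-u ^ 4 * c 1 * c 2) * h
      · have h := hc (k + 1)
        simp only [Fin.zero_eta, Fin.mk_one, Matrix.cons_val_one, Matrix.cons_val_zero,
          Module.End.mul_apply, LinearMap.smul_apply, LinearMap.add_apply, LinearMap.sub_apply,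
          LinearMap.zero_apply, map_smul, pow_succ, pow_zero, one_mul,
          up_ket, down_ket, smul_smul]
        match_scalars
        linear_combination (-u ^ 4 * c (k + 2) * c (k + 3)) * h

theorem ladder_inO (p : QParam) (x : ℂ) (hx : x ≠ 0) (ε : ℤˣ) (u : ℂ) (c : ℕ → ℂ) (hc0 : c 0 = 0)
    (hc : SerreCoeff p c) : (ladder p x hx ε u c hc0 hc).InO := by
  classical
  refine Rep.inO_of_span _ (fun k : ℕ => (ket k : ℕ →₀ ℂ))
    (fun k => ![x⁻¹ * p.q ^ (2 * k), x * (p.q ^ (2 * k))⁻¹]) ?_ span_ket ?_ {![x⁻¹, x]} ?_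
  · intro k i
    fin_cases i
    · exact diag_ket _ k
    · exact diag_ket _ k
  · intro ω
    refine Set.Subsingleton.finite ?_
    rintro k rfl l hl
    have h0 := congrFun hl 0
    exact (p.q_pow_injective (mul_left_cancel₀ (inv_ne_zero hx) h0)).symm
  · intro k
    exact ⟨_, Finset.mem_singleton_self _, k, rfl, rfl⟩

/-- The coefficient `[k]_{q_*} [s - k + 1]_{q_*}`. -/
def vermaCoeff (p : QParam) (s : ℂ) (k : ℕ) : ℂ := p.qsNum k * p.qsNum (s - k + 1)

theorem qsNum_zero (p : QParam) : p.qsNum 0 = 0 := by simp [QParam.qsNum]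

theorem vermaCoeff_zero (p : QParam) (s : ℂ) : vermaCoeff p s 0 = 0 := by
  simp [vermaCoeff, qsNum_zero]

theorem vermaCoeff_serre (p : QParam) (s : ℂ) : SerreCoeff p (vermaCoeff p s) := by
  intro k
  have hQ := p.qs_ne_zero
  have hS := p.qsPow_ne_zero s
  have hd := p.qs_sub_inv_ne
  have key : ∀ j : ℕ, vermaCoeff p s j = (p.qs ^ j - (p.qs ^ j)⁻¹) *
      (p.qsPow s * (p.qs ^ j)⁻¹ * p.qs - (p.qsPow s)⁻¹ * p.qs ^ j * p.qs⁻¹) /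
      (p.qs - p.qs⁻¹) ^ 2 := by
    intro j
    have e1 : p.qsPow (s - j + 1) = p.qsPow s * (p.qs ^ j)⁻¹ * p.qs := by
      rw [sub_eq_add_neg, p.qsPow_add, p.qsPow_add, p.qsPow_neg, p.qsPow_natCast]; rfl
    rw [vermaCoeff, QParam.qsNum, QParam.qsNum, p.qsPow_neg, p.qsPow_neg, e1, p.qsPow_natCast,
      mul_inv, mul_inv, inv_inv]
    field_simp
  rw [key, key, key, key, p.three_eq, p.q_sq]
  have hk : p.qs ^ k ≠ 0 := pow_ne_zero _ hQ
  rw [pow_add, pow_add, pow_add]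
  have hd2 : (p.qs - p.qs⁻¹) ^ 2 ≠ 0 := pow_ne_zero _ hd
  rw [← mul_div_assoc, ← mul_div_assoc, ← add_div, ← sub_div, ← sub_div,
    div_eq_zero_iff]
  left
  field_simp
  ring

/-- The Verma type evaluation module `𝒲_s^ε(λ)` of `𝔟₊`, with basis `|k⟩`, `k ≥ 0`:
`E₀ |k⟩ = λ |k + 1⟩`, `E₁ |k⟩ = λ [k]_{q_*} [s - k + 1]_{q_*} |k - 1⟩`,
`K₁ |k⟩ = ε q ^ (-2k) q_* ^ s |k⟩`, `K₀ = K₁⁻¹`, and `|k⟩` has parity `ε (-1) ^ k`. -/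
def verma (p : QParam) (s : ℂ) (ε : ℤˣ) (lam : ℂ) : Rep p :=
  ladder p (((ε : ℤ) : ℂ) * p.qsPow s) (mul_ne_zero (units_ne ε) (p.qsPow_ne_zero s)) ε lam
    (vermaCoeff p s) (vermaCoeff_zero p s) (vermaCoeff_serre p s)

/-- The coefficients of the annihilation operator `α₊` on the Fock module with `α₊ |0⟩ = 0`. -/
def fockPlusCoeff (p : QParam) (k : ℕ) : ℂ :=
  ((-1) ^ k * (p.q ^ (2 * k))⁻¹ - 1) / (p.q + p.q⁻¹) ^ 2

/-- The coefficients of the annihilation operator `α₋` on the Fock module with `α₋ |0⟩ = 0`. -/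
def fockMinusCoeff (p : QParam) (k : ℕ) : ℂ :=
  ((-1) ^ k * p.q ^ (2 * k) - 1) / (p.q + p.q⁻¹) ^ 2

theorem fockPlusCoeff_zero (p : QParam) : fockPlusCoeff p 0 = 0 := by simp [fockPlusCoeff]

theorem fockMinusCoeff_zero (p : QParam) : fockMinusCoeff p 0 = 0 := by simp [fockMinusCoeff]

theorem fockPlusCoeff_serre (p : QParam) : SerreCoeff p (fockPlusCoeff p) := by
  intro k
  have hq := p.q_ne_zero
  simp only [fockPlusCoeff, p.three_eq, mul_add, pow_add]
  rw [← mul_div_assoc, ← mul_div_assoc, ← add_div, ← sub_div, ← sub_div, div_eq_zero_iff]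
  left
  field_simp
  ring

theorem fockMinusCoeff_serre (p : QParam) : SerreCoeff p (fockMinusCoeff p) := by
  intro k
  have hq := p.q_ne_zero
  simp only [fockMinusCoeff, p.three_eq, mul_add, pow_add]
  rw [← mul_div_assoc, ← mul_div_assoc, ← add_div, ← sub_div, ← sub_div, div_eq_zero_iff]
  left
  field_simp
  ring

/-- The relations of the `q`-oscillator algebra with generators `α₊`, `α₋`, `H`:
`q α₊ α₋ + q⁻¹ α₋ α₊ = -1 / (q + q⁻¹)` and `[H, α_±] = ± 2 α_±`. -/
def IsOscillator (p : QParam) (aPlus aMinus H : Module.End ℂ (ℕ →₀ ℂ)) : Prop :=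
  p.q • (aPlus * aMinus) + p.q⁻¹ • (aMinus * aPlus) = (-1 / (p.q + p.q⁻¹)) • 1 ∧
    H * aPlus - aPlus * H = (2 : ℂ) • aPlus ∧ H * aMinus - aMinus * H = (-2 : ℂ) • aMinus

/-- The Fock module `span {α₋ ^ k |0⟩}` with `α₊ |0⟩ = 0` and `H |0⟩ = 0`:
here `|k⟩ = α₋ ^ k |0⟩`. -/
theorem isOscillator_plus (p : QParam) :
    IsOscillator p (down (fockPlusCoeff p)) up (diag fun k => -2 * (k : ℂ)) := by
  have hq := p.q_ne_zero
  have hq1 := p.q_add_inv_ne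
  have hq2 : p.q ^ 2 + 1 ≠ 0 := p.q_sq_add_one_ne
  refine ⟨end_ext fun k => ?_, end_ext fun k => ?_, end_ext fun k => ?_⟩
  · rcases k with _ | k <;>
    · simp only [LinearMap.add_apply, LinearMap.smul_apply, Module.End.mul_apply, up_ket, down_ket,
        down_ket_zero _ (fockPlusCoeff_zero p), map_smul, map_zero, smul_zero, smul_smul,
        Module.End.one_apply]
      match_scalars
      simp only [fockPlusCoeff, pow_succ, mul_add]
      field_simp
      ring
  · rcases k with _ | k
    · simp [diag_ket, down_ket_zero _ (fockPlusCoeff_zero p)]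
    · simp only [LinearMap.sub_apply, LinearMap.smul_apply, Module.End.mul_apply, down_ket,
        diag_ket, map_smul, smul_smul]
      match_scalars
      push_cast
      ring
  · simp only [LinearMap.sub_apply, LinearMap.smul_apply, Module.End.mul_apply, up_ket,
      diag_ket, map_smul]
    match_scalars
    push_cast
    ring

/-- The Fock module `span {α₊ ^ k |0⟩}` with `α₋ |0⟩ = 0` and `H |0⟩ = 0`:
here `|k⟩ = α₊ ^ k |0⟩`. -/
theorem isOscillator_minus (p : QParam) :
    IsOscillator p up (down (fockMinusCoeff p)) (diag fun k => 2 * (k : ℂ)) := by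
  have hq := p.q_ne_zero
  have hq1 := p.q_add_inv_ne
  have hq2 : p.q ^ 2 + 1 ≠ 0 := p.q_sq_add_one_ne
  refine ⟨end_ext fun k => ?_, end_ext fun k => ?_, end_ext fun k => ?_⟩
  · rcases k with _ | k <;>
    · simp only [LinearMap.add_apply, LinearMap.smul_apply, Module.End.mul_apply, up_ket, down_ket,
        down_ket_zero _ (fockMinusCoeff_zero p), map_smul, map_zero, smul_zero, smul_smul,
        Module.End.one_apply]
      match_scalars
      simp only [fockMinusCoeff, pow_succ, mul_add]
      field_simp
      ring
  · simp only [LinearMap.sub_apply, LinearMap.smul_apply, Module.End.mul_apply, up_ket,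
      diag_ket, map_smul]
    match_scalars
    push_cast
    ring
  · rcases k with _ | k
    · simp [diag_ket, down_ket_zero _ (fockMinusCoeff_zero p)]
    · simp only [LinearMap.sub_apply, LinearMap.smul_apply, Module.End.mul_apply, down_ket,
        diag_ket, map_smul, smul_smul]
      match_scalars
      push_cast
      ring

/-- The prefundamental (`q`-oscillator) representation `ρ₊(λ)`, on the Fock module with basis
`|k⟩ = α₋ ^ k |0⟩`, `α₊ |0⟩ = 0`, the vacuum being even:
`E₁ = λ α₊`, `E₀ = λ α₋`, `K₁ = q ^ H`, `K₀ = q ^ (-H)`. -/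
def rhoPlus (p : QParam) (lam : ℂ) : Rep p :=
  ladder p 1 one_ne_zero 1 lam (fockPlusCoeff p) (fockPlusCoeff_zero p) (fockPlusCoeff_serre p)

/-- The prefundamental (`q`-oscillator) representation `ρ₋(λ)`, on the Fock module with basis
`|k⟩ = α₊ ^ k |0⟩`, `α₋ |0⟩ = 0`, the vacuum being even:
`E₁ = λ α₋`, `E₀ = λ α₊`, `K₁ = q ^ (-H)`, `K₀ = q ^ H`. -/
def rhoMinus (p : QParam) (lam : ℂ) : Rep p :=
  ladder p 1 one_ne_zero 1 lam (fockMinusCoeff p) (fockMinusCoeff_zero p) (fockMinusCoeff_serre p)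

theorem rhoPlus_E (p : QParam) (lam : ℂ) :
    (rhoPlus p lam).E = ![lam • up, lam • down (fockPlusCoeff p)] := rfl

theorem rhoMinus_E (p : QParam) (lam : ℂ) :
    (rhoMinus p lam).E = ![lam • up, lam • down (fockMinusCoeff p)] := rfl

/-- The vector `e_{l-k}`, `2l = s`, of the `(s + 1)`-dimensional module (`0` if `k > s`). -/
def finKet (s k : ℕ) : Fin (s + 1) →₀ ℂ := if h : k < s + 1 then ket ⟨k, h⟩ else 0

/-- `e_m ↦ λ [l + m]_{q_*} e_{m-1}`, where `m = l - k`. -/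
def finDown (p : QParam) (s : ℕ) (lam : ℂ) : Module.End ℂ (Fin (s + 1) →₀ ℂ) :=
  Finsupp.linearCombination ℂ fun k => (lam * p.qsNum ((s : ℂ) - (k : ℕ))) • finKet s (k + 1)

/-- `e_m ↦ λ [l - m]_{q_*} e_{m+1}`, where `m = l - k`; note that `[0]_{q_*} = 0`. -/
def finUp (p : QParam) (s : ℕ) (lam : ℂ) : Module.End ℂ (Fin (s + 1) →₀ ℂ) :=
  Finsupp.linearCombination ℂ fun k => (lam * p.qsNum (k : ℕ)) • finKet s (k - 1)

theorem ket_eq_finKet (s : ℕ) (k : Fin (s + 1)) : ket k = finKet s k := by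
  rw [finKet, dif_pos k.2]

theorem finKet_eq_zero {s k : ℕ} (h : s < k) : finKet s k = 0 := by
  rw [finKet, dif_neg (by omega)]

theorem exists_finDown (p : QParam) (s : ℕ) (lam : ℂ) : ∃ a b : ℕ → ℂ,
    (∀ k, finDown p s lam (finKet s k) = (lam * a k) • finKet s (k + 1)) ∧
    finUp p s lam (finKet s 0) = 0 ∧
    (∀ k, k + 1 < s + 1 →
      finUp p s lam (finKet s (k + 1)) = (lam * b (k + 1)) • finKet s k) ∧
    (∀ k, finUp p s lam (finDown p s lam (finKet s k)) =
      (lam ^ 2 * vermaCoeff p s (k + 1)) • finKet s k) ∧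
    ∀ k, b (k + 1) * a k = vermaCoeff p s (k + 1) := by
  have h1 : ∀ k, finDown p s lam (finKet s k) =
      (lam * p.qsNum ((s : ℂ) - (k : ℕ))) • finKet s (k + 1) := by
    intro k
    by_cases h : k < s + 1
    · have e : finKet s k = ket (⟨k, h⟩ : Fin (s + 1)) := by rw [finKet, dif_pos h]
      rw [e, finDown, linearCombination_ket]
    · rw [finKet_eq_zero (by omega), finKet_eq_zero (by omega), map_zero, smul_zero]
  have h2 : finUp p s lam (finKet s 0) = 0 := by
    have e : finKet s 0 = ket (⟨0, by omega⟩ : Fin (s + 1)) := by rw [finKet, dif_pos]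
    rw [e, finUp, linearCombination_ket]
    simp [qsNum_zero]
  have h3 : ∀ k, k + 1 < s + 1 →
      finUp p s lam (finKet s (k + 1)) = (lam * p.qsNum ((k + 1 : ℕ) : ℂ)) • finKet s k := by
    intro k h
    have e : finKet s (k + 1) = ket (⟨k + 1, h⟩ : Fin (s + 1)) := by rw [finKet, dif_pos h]
    rw [e, finUp, linearCombination_ket]
    rfl
  have h5 : ∀ k : ℕ, p.qsNum ((k + 1 : ℕ) : ℂ) * p.qsNum ((s : ℂ) - (k : ℕ)) =
      vermaCoeff p s (k + 1) := by
    intro k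
    rw [vermaCoeff]
    congr 2
    push_cast
    ring
  refine ⟨fun k => p.qsNum ((s : ℂ) - (k : ℕ)), fun k => p.qsNum (k : ℕ), h1, h2, h3, ?_, h5⟩
  intro k
  rcases lt_trichotomy k s with h | rfl | h
  · rw [h1, map_smul, h3 k (by omega), smul_smul, ← h5]
    congr 1
    ring
  · rw [h1, finKet_eq_zero (by omega : k < k + 1), smul_zero, map_zero, ← h5]
    simp [qsNum_zero]
  · simp [finKet_eq_zero h]

theorem fin_serre_down (p : QParam) (s : ℕ) (lam : ℂ) :
    finDown p s lam ^ 3 * finUp p s lam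
      + p.three • (finDown p s lam ^ 2 * finUp p s lam * finDown p s lam)
      - p.three • (finDown p s lam * finUp p s lam * finDown p s lam ^ 2)
      - finUp p s lam * finDown p s lam ^ 3 = 0 := by
  obtain ⟨a, b, hd, hu0, hu, hn, hab⟩ := exists_finDown p s lam
  have n2 : ∀ k, finUp p s lam (finDown p s lam (finDown p s lam (finKet s k))) =
      (lam * a k * (lam ^ 2 * vermaCoeff p s (k + 2))) • finKet s (k + 1) := fun k => by
    rw [hd k, map_smul, map_smul, hn, smul_smul]
  have n3 : ∀ k, finUp p s lam (finDown p s lam (finDown p s lam (finDown p s lam (finKet s k)))) =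
      (lam * a k * (lam * a (k + 1) * (lam ^ 2 * vermaCoeff p s (k + 3)))) • finKet s (k + 2) :=
    fun k => by rw [hd k, map_smul, map_smul, map_smul, n2, smul_smul]
  refine end_ext fun k' => ?_
  rw [ket_eq_finKet]
  obtain ⟨k, hk⟩ := k'
  simp only [pow_succ, pow_zero, one_mul, Module.End.mul_apply, LinearMap.smul_apply,
    LinearMap.add_apply, LinearMap.sub_apply, LinearMap.zero_apply]
  cases k with
  | zero =>
    have h := vermaCoeff_serre p s 0
    simp only [vermaCoeff_zero, zero_add] at h
    rw [hu0]
    simp only [hn, n2, n3, map_smul, smul_smul, map_zero, zero_add]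
    simp only [hd, map_smul, smul_smul, zero_add]
    match_scalars
    linear_combination (lam ^ 4 * a 0 * a 1) * h
  | succ k =>
    have h := vermaCoeff_serre p s (k + 1)
    rw [hu k hk]
    simp only [hn, n2, n3, map_smul, smul_smul]
    simp only [hd, map_smul, smul_smul]
    match_scalars
    linear_combination (lam ^ 4 * a (k + 1) * a (k + 2)) * h +
      (lam ^ 4 * a (k + 1) * a (k + 2)) * hab k

theorem fin_serre_up (p : QParam) (s : ℕ) (lam : ℂ) :
    finUp p s lam ^ 3 * finDown p s lam
      + p.three • (finUp p s lam ^ 2 * finDown p s lam * finUp p s lam)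
      - p.three • (finUp p s lam * finDown p s lam * finUp p s lam ^ 2)
      - finDown p s lam * finUp p s lam ^ 3 = 0 := by
  obtain ⟨a, b, hd, hu0, hu, hn, hab⟩ := exists_finDown p s lam
  refine end_ext fun k' => ?_
  rw [ket_eq_finKet]
  obtain ⟨k, hk⟩ := k'
  simp only [pow_succ, pow_zero, one_mul, Module.End.mul_apply, LinearMap.smul_apply,
    LinearMap.add_apply, LinearMap.sub_apply, LinearMap.zero_apply]
  rcases k with _ | _ | _ | k
  · simp only [hn, hu0, map_smul, map_zero, smul_zero, add_zero, sub_zero]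
  · have h1 := hu 0 hk
    rw [zero_add] at h1
    simp only [zero_add, hn, h1, hu0, map_smul, map_zero, smul_zero, add_zero, sub_zero]
  · have h := vermaCoeff_serre p s 0
    simp only [vermaCoeff_zero, zero_add] at h
    have h2 := hu 1 hk
    have h1 := hu 0 (by omega)
    simp only [zero_add, Nat.reduceAdd] at h1 h2 ⊢
    simp only [zero_add, hn, h1, h2, hu0, map_smul, map_zero, smul_zero, sub_zero, smul_smul,
      Nat.reduceAdd]
    match_scalars
    linear_combination (-lam ^ 4 * b 1 * b 2) * h
  · have h := vermaCoeff_serre p s (k + 1)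
    have h3 := hu (k + 2) hk
    have h2 := hu (k + 1) (by omega)
    have h1 := hu k (by omega)
    simp only [hn, h1, h2, h3, map_smul, smul_smul]
    simp only [hd, smul_smul]
    match_scalars
    linear_combination (-lam ^ 4 * b (k + 2) * b (k + 3)) * h -
      (lam ^ 4 * b (k + 2) * b (k + 3)) * hab k

/-- The scalar `± q_* ^ (2m)`, `m = l - k`, where `±` is the sign `ε (-1) ^ k`. -/
def finEig (p : QParam) (s : ℕ) (ε : ℤˣ) (k : ℕ) : ℂ :=
  ((ε : ℤ) : ℂ) * (-1) ^ k * p.qsPow (s - 2 * k)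

theorem qsPow_sub_two_mul (p : QParam) (r : ℂ) (k : ℕ) :
    (-1) ^ k * p.qsPow (r - 2 * k) = p.qsPow r * (p.q ^ (2 * k))⁻¹ := by
  have h : p.qsPow (r - 2 * k) = p.qsPow r * (p.qs ^ (2 * k))⁻¹ := by
    rw [sub_eq_add_neg, p.qsPow_add, p.qsPow_neg, ← p.qsPow_natCast]
    push_cast
    rfl
  have h2 : p.q ^ (2 * k) = (-1) ^ k * p.qs ^ (2 * k) := by
    rw [pow_mul, p.q_sq, neg_pow, ← pow_mul]
  have h3 : ((-1 : ℂ) ^ k)⁻¹ = (-1) ^ k := by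
    rw [← inv_pow]; norm_num
  rw [h, h2, mul_inv, h3]
  ring

theorem finEig_eq (p : QParam) (s : ℕ) (ε : ℤˣ) (k : ℕ) :
    finEig p s ε k = ((ε : ℤ) : ℂ) * p.qsPow s * (p.q ^ (2 * k))⁻¹ := by
  rw [finEig, mul_assoc, qsPow_sub_two_mul, mul_assoc]

theorem finEig_ne_zero (p : QParam) (s : ℕ) (ε : ℤˣ) (k : ℕ) : finEig p s ε k ≠ 0 := by
  rw [finEig_eq]
  exact mul_ne_zero (mul_ne_zero (units_ne ε) (p.qsPow_ne_zero s))
    (inv_ne_zero (pow_ne_zero _ p.q_ne_zero))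

theorem diag_finKet (s : ℕ) (d : ℕ → ℂ) (k : ℕ) :
    diag (fun k : Fin (s + 1) => d k) (finKet s k) = d k • finKet s k := by
  by_cases h : k < s + 1
  · have e : finKet s k = ket (⟨k, h⟩ : Fin (s + 1)) := by rw [finKet, dif_pos h]
    rw [e, diag_ket]
  · rw [finKet_eq_zero (by omega), map_zero, smul_zero]

theorem diag_mul_finDown (p : QParam) (s : ℕ) (lam : ℂ) (d : ℕ → ℂ) (t : ℂ)
    (hd : ∀ k, d (k + 1) = t * d k) :
    diag (fun k : Fin (s + 1) => d k) * finDown p s lam =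
      t • (finDown p s lam * diag (fun k : Fin (s + 1) => d k)) := by
  obtain ⟨a, b, h1, -, -, -, -⟩ := exists_finDown p s lam
  refine end_ext fun k => ?_
  rw [ket_eq_finKet]
  simp only [Module.End.mul_apply, LinearMap.smul_apply, h1, diag_finKet, map_smul, smul_smul, hd]
  congr 1
  ring

theorem diag_mul_finUp (p : QParam) (s : ℕ) (lam : ℂ) (d : ℕ → ℂ) (t : ℂ)
    (hd : ∀ k, t * d (k + 1) = d k) :
    diag (fun k : Fin (s + 1) => d k) * finUp p s lam =
      t • (finUp p s lam * diag (fun k : Fin (s + 1) => d k)) := by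
  obtain ⟨a, b, -, h1, h2, -, -⟩ := exists_finDown p s lam
  refine end_ext fun k' => ?_
  rw [ket_eq_finKet]
  obtain ⟨k, hk⟩ := k'
  cases k with
  | zero =>
    simp only [Module.End.mul_apply, LinearMap.smul_apply, h1, diag_finKet, map_smul, map_zero,
      smul_zero]
  | succ k =>
    simp only [Module.End.mul_apply, LinearMap.smul_apply, h2 k hk, diag_finKet, map_smul,
      smul_smul]
    congr 1
    linear_combination (-lam * b (k + 1)) * hd k

/-- The evaluation module `W_s^ε(λ)` of dimension `s + 1 = 2l + 1`, restricted to `𝔟₊`. The basis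
vector indexed by `k` is `e_m`, `m = l - k`, of parity `ε (-1) ^ k`, and
`E₁ e_m = λ [l - m]_{q_*} e_{m+1}`, `E₀ e_m = λ [l + m]_{q_*} e_{m-1}`,
`K₁ e_m = ε (-1) ^ k q_* ^ (2m) e_m`, `K₀ = K₁⁻¹`. -/
def finDim (p : QParam) (s : ℕ) (ε : ℤˣ) (lam : ℂ) : Rep p where
  V := Fin (s + 1) →₀ ℂ
  parity := diag fun k => ((ε : ℤ) : ℂ) * (-1) ^ (k : ℕ)
  E := ![finDown p s lam, finUp p s lam]
  K := ![diag fun k => (finEig p s ε k)⁻¹, diag fun k => finEig p s ε k]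
  Kinv := ![diag fun k => finEig p s ε k, diag fun k => (finEig p s ε k)⁻¹]
  parity_sq := by
    rw [diag_mul, ← diag_one]
    congr 1; funext k
    linear_combination ((-1 : ℂ) ^ (k : ℕ) * (-1) ^ (k : ℕ)) * units_sq ε + neg_one_pow_sq k
  parity_E i := by
    have h1 := diag_mul_finDown p s lam (fun k => ((ε : ℤ) : ℂ) * (-1) ^ k) (-1)
      (fun k => by rw [pow_succ]; ring)
    have h2 := diag_mul_finUp p s lam (fun k => ((ε : ℤ) : ℂ) * (-1) ^ k) (-1)
      (fun k => by rw [pow_succ]; ring)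
    fin_cases i
    · exact h1.trans (LinearMap.ext fun v => by simp)
    · exact h2.trans (LinearMap.ext fun v => by simp)
  parity_K i := by
    fin_cases i <;> simp [diag_mul, mul_comm]
  K_Kinv i := by
    have h := finEig_ne_zero p s ε
    fin_cases i <;> simp [diag_mul, h, diag_one]
  Kinv_K i := by
    have h := finEig_ne_zero p s ε
    fin_cases i <;> simp [diag_mul, h, diag_one]
  K_comm i j := by
    fin_cases i <;> fin_cases j <;> simp [diag_mul, mul_comm]
  K_E i j := by
    have hq := p.q_ne_zero
    have z2 : p.q ^ (2 : ℤ) = p.q ^ 2 := by norm_cast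
    have z2' : p.q ^ (-2 : ℤ) = (p.q ^ 2)⁻¹ := by rw [zpow_neg, z2]
    have c00 : p.q ^ cartan 0 0 = p.q ^ 2 := by rw [← z2]; rfl
    have c11 : p.q ^ cartan 1 1 = p.q ^ 2 := by rw [← z2]; rfl
    have c01 : p.q ^ cartan 0 1 = (p.q ^ 2)⁻¹ := by rw [← z2']; rfl
    have c10 : p.q ^ cartan 1 0 = (p.q ^ 2)⁻¹ := by rw [← z2']; rfl
    have e1 : ∀ k, p.q ^ 2 * finEig p s ε (k + 1) = finEig p s ε k := by
      intro k
      rw [finEig_eq, finEig_eq, mul_add, pow_add, mul_one]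
      field_simp
    have e2 : ∀ k, finEig p s ε (k + 1) = (p.q ^ 2)⁻¹ * finEig p s ε k := by
      intro k
      rw [← e1 k]
      field_simp
    have e3 : ∀ k, (p.q ^ 2)⁻¹ * (finEig p s ε (k + 1))⁻¹ = (finEig p s ε k)⁻¹ := by
      intro k
      rw [← e1 k, mul_inv]
    have e4 : ∀ k, (finEig p s ε (k + 1))⁻¹ = p.q ^ 2 * (finEig p s ε k)⁻¹ := by
      intro k
      rw [← e3 k]
      field_simp
    fin_cases i <;> fin_cases j
    · change _ = p.q ^ cartan 0 0 • _
      rw [c00]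
      exact diag_mul_finDown p s lam (fun k => (finEig p s ε k)⁻¹) _ e4
    · change _ = p.q ^ cartan 0 1 • _
      rw [c01]
      exact diag_mul_finUp p s lam (fun k => (finEig p s ε k)⁻¹) _ e3
    · change _ = p.q ^ cartan 1 0 • _
      rw [c10]
      exact diag_mul_finDown p s lam (fun k => finEig p s ε k) _ e2
    · change _ = p.q ^ cartan 1 1 • _
      rw [c11]
      exact diag_mul_finUp p s lam (fun k => finEig p s ε k) _ e1
  serre i j hij := by
    fin_cases i <;> fin_cases j <;> first | exact absurd rfl hij | skip
    · exact fin_serre_down p s lam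
    · exact fin_serre_up p s lam

theorem finDim_inO (p : QParam) (s : ℕ) (ε : ℤˣ) (lam : ℂ) : (finDim p s ε lam).InO := by
  classical
  refine Rep.inO_of_span _ (fun k : Fin (s + 1) => (ket k : Fin (s + 1) →₀ ℂ))
    (fun k => ![(finEig p s ε k)⁻¹, finEig p s ε k]) ?_ span_ket (fun ω => Set.toFinite _)
    {![(((ε : ℤ) : ℂ) * p.qsPow s)⁻¹, ((ε : ℤ) : ℂ) * p.qsPow s]} ?_
  · intro k i
    fin_cases i
    · exact diag_ket _ k
    · exact diag_ket _ k
  · intro k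
    refine ⟨_, Finset.mem_singleton_self _, k, ?_, ?_⟩
    · change (finEig p s ε k)⁻¹ = (((ε : ℤ) : ℂ) * p.qsPow s)⁻¹ * p.q ^ (2 * (k : ℕ))
      rw [finEig_eq, mul_inv, inv_inv]
    · exact finEig_eq p s ε k

theorem oneDim_inO (p : QParam) (x : Fin 2 → ℂ) (hx : ∀ i, x i ≠ 0) (ε : ℤˣ) :
    (Rep.oneDim p x hx ε).InO := by
  classical
  refine Rep.inO_of_span _ (fun _ : Unit => (1 : ℂ)) (fun _ => x) ?_ ?_ (fun ω => Set.toFinite _)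
    {x} ?_
  · intro k i
    rfl
  · change Submodule.span ℂ (Set.range fun _ : Unit => (1 : ℂ)) = (⊤ : Submodule ℂ ℂ)
    rw [Set.range_const]
    exact Ideal.span_singleton_one
  · intro k
    exact ⟨x, Finset.mem_singleton_self _, 0, by simp, by simp⟩

theorem charU_weight_ne_zero (p : QParam) (r : ℂ) (ε : ℤˣ) (i : Fin 2) :
    (![((ε : ℤ) : ℂ) * p.qsPow (-r), ((ε : ℤ) : ℂ) * p.qsPow r] : Fin 2 → ℂ) i ≠ 0 := by
  fin_cases i
  · exact mul_ne_zero (units_ne ε) (p.qsPow_ne_zero _)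
  · exact mul_ne_zero (units_ne ε) (p.qsPow_ne_zero _)

/-- The one-dimensional representation `U_r^ε`: `E₀`, `E₁` act as `0`, `K₁` as `ε q_* ^ r` and `K₀`
as `ε q_* ^ (-r)`, and the vector is even if `ε = 1`, odd if `ε = -1`. -/
def charU (p : QParam) (r : ℂ) (ε : ℤˣ) : Rep p :=
  Rep.oneDim p ![((ε : ℤ) : ℂ) * p.qsPow (-r), ((ε : ℤ) : ℂ) * p.qsPow r]
    (charU_weight_ne_zero p r ε) ε

theorem span_lof {F : ℕ → Type} [∀ m, AddCommGroup (F m)] [∀ m, Module ℂ (F m)] (b : ∀ m, F m)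
    (hb : ∀ m (x : F m), ∃ c : ℂ, x = c • b m) :
    Submodule.span ℂ (Set.range fun m => DirectSum.lof ℂ ℕ F m (b m)) = ⊤ := by
  rw [eq_top_iff]
  rintro v -
  induction v using DirectSum.induction_on with
  | zero => exact zero_mem _
  | of m x =>
    obtain ⟨c, rfl⟩ := hb m x
    change DirectSum.lof ℂ ℕ F m (c • b m) ∈ _
    rw [map_smul]
    exact Submodule.smul_mem _ _ (Submodule.subset_span ⟨m, rfl⟩)
  | add x y hx hy => exact add_mem hx hy

theorem directSum_K_lof {p : QParam} (M : ℕ → Rep p) (m : ℕ) (i : Fin 2) (b : (M m).V) (c : ℂ)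
    (h : (M m).K i b = c • b) :
    (Rep.directSum M).K i (DirectSum.lof ℂ ℕ (fun m => (M m).V) m b) =
      c • DirectSum.lof ℂ ℕ (fun m => (M m).V) m b := by
  rw [← map_smul, ← h]
  exact DirectSum.lmap_lof _ _ _

theorem directSum_charU_inO (p : QParam) (s : ℂ) :
    (Rep.directSum fun m : ℕ => charU p (-s - 2 * m) ((-1) ^ m)).InO := by
  classical
  have hpow : ∀ m : ℕ, ((((-1 : ℤˣ) ^ m : ℤˣ) : ℤ) : ℂ) = (-1) ^ m := fun m => by simp
  have e2 : ∀ m : ℕ, ((((-1 : ℤˣ) ^ m : ℤˣ) : ℤ) : ℂ) * p.qsPow (-s - 2 * m) =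
      p.qsPow (-s) * (p.q ^ (2 * m))⁻¹ := by
    intro m
    rw [hpow, qsPow_sub_two_mul]
  have e1 : ∀ m : ℕ, ((((-1 : ℤˣ) ^ m : ℤˣ) : ℤ) : ℂ) * p.qsPow (-(-s - 2 * m)) =
      p.qsPow s * p.q ^ (2 * m) := by
    intro m
    have h3 : ((-1 : ℂ) ^ m)⁻¹ = (-1) ^ m := by rw [← inv_pow]; norm_num
    have h := congrArg (·⁻¹) (e2 m)
    simp only [mul_inv, inv_inv, hpow, p.qsPow_neg s, h3] at h
    rw [p.qsPow_neg (-s - 2 * m), hpow, h]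
  refine Rep.inO_of_span _
    (fun m : ℕ => DirectSum.lof ℂ ℕ (fun m : ℕ => (charU p (-s - 2 * m) ((-1) ^ m)).V) m (1 : ℂ))
    (fun m => ![p.qsPow s * p.q ^ (2 * m), p.qsPow (-s) * (p.q ^ (2 * m))⁻¹]) ?_ ?_ ?_
    {![p.qsPow s, p.qsPow (-s)]} ?_
  · intro m i
    refine directSum_K_lof (fun m : ℕ => charU p (-s - 2 * m) ((-1) ^ m)) m i (1 : ℂ) _ ?_
    fin_cases i
    · exact congrArg (fun c : ℂ => c • (1 : ℂ)) (e1 m)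
    · exact congrArg (fun c : ℂ => c • (1 : ℂ)) (e2 m)
  · exact span_lof (F := fun m : ℕ => (charU p (-s - 2 * m) ((-1) ^ m)).V) (fun _ => (1 : ℂ))
      fun m x => ⟨x, (mul_one (M := ℂ) x).symm⟩
  · intro ω
    refine Set.Subsingleton.finite ?_
    rintro k rfl l hl
    have h0 := congrFun hl 0
    exact (p.q_pow_injective (mul_left_cancel₀ (p.qsPow_ne_zero s) h0)).symm
  · intro k
    exact ⟨_, Finset.mem_singleton_self _, k, rfl, rfl⟩

/-- The objects of category `𝒪` of `𝔟₊`. -/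
def CatO (p : QParam) : Type 1 := {M : Rep p // M.InO}

/-- The relations of the Grothendieck ring: `[M] = [M'] + [M'']` for every short exact sequence
`0 → M' → M → M'' → 0`, `[M ⊗ N] = [M] [N]`, and `[𝟙] = 1` for the trivial representation `𝟙`. -/
inductive GrothendieckRel (p : QParam) :
    FreeAlgebra ℤ (CatO p) → FreeAlgebra ℤ (CatO p) → Prop
  | exact (M' M M'' : CatO p) (f : Rep.Hom M'.1 M.1) (g : Rep.Hom M.1 M''.1)
      (hf : Function.Injective f.toLin) (hfg : Function.Exact f.toLin g.toLin)
      (hg : Function.Surjective g.toLin) :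
      GrothendieckRel p (FreeAlgebra.ι ℤ M) (FreeAlgebra.ι ℤ M' + FreeAlgebra.ι ℤ M'')
  | tensor (M N : CatO p) :
      GrothendieckRel p (FreeAlgebra.ι ℤ (⟨M.1.tensor N.1, M.2.tensor N.2⟩ : CatO p))
        (FreeAlgebra.ι ℤ M * FreeAlgebra.ι ℤ N)
  | one : GrothendieckRel p
      (FreeAlgebra.ι ℤ (⟨Rep.oneDim p 1 (fun _ => one_ne_zero) 1, oneDim_inO p _ _ _⟩ : CatO p)) 1

/-- The Grothendieck ring of category `𝒪` (no infinite relations are imposed): the ring generated by the classes of the objects, with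
the sum given by short exact sequences and the product by the tensor product. -/
def GrothendieckRing (p : QParam) : Type 1 := RingQuot (GrothendieckRel p)

instance (p : QParam) : Ring (GrothendieckRing p) :=
  inferInstanceAs (Ring (RingQuot (GrothendieckRel p)))

/-- The class `[M]` of an object in the Grothendieck ring. -/
def cls {p : QParam} (M : Rep p) (hM : M.InO) : GrothendieckRing p :=
  RingQuot.mkRingHom (GrothendieckRel p) (FreeAlgebra.ι ℤ (⟨M, hM⟩ : CatO p))

theorem verma_inO (p : QParam) (s : ℂ) (ε : ℤˣ) (lam : ℂ) : (verma p s ε lam).InO :=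
  ladder_inO ..

theorem rhoPlus_inO (p : QParam) (lam : ℂ) : (rhoPlus p lam).InO := ladder_inO ..

theorem rhoMinus_inO (p : QParam) (lam : ℂ) : (rhoMinus p lam).InO := ladder_inO ..

theorem charU_inO (p : QParam) (r : ℂ) (ε : ℤˣ) : (charU p r ε).InO := oneDim_inO ..

/-- `[𝒲_s^ε(λ)]`. -/
def clsVerma (p : QParam) (s : ℂ) (ε : ℤˣ) (lam : ℂ) : GrothendieckRing p :=
  cls (verma p s ε lam) (verma_inO p s ε lam)

/-- `[W_s^ε(λ)]`. -/
def clsW (p : QParam) (s : ℕ) (ε : ℤˣ) (lam : ℂ) : GrothendieckRing p :=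
  cls (finDim p s ε lam) (finDim_inO p s ε lam)

/-- `[U_r^ε]`. -/
def clsU (p : QParam) (r : ℂ) (ε : ℤˣ) : GrothendieckRing p := cls (charU p r ε) (charU_inO p r ε)

/-- `[ρ₊(λ)]`. -/
def clsRhoPlus (p : QParam) (lam : ℂ) : GrothendieckRing p := cls (rhoPlus p lam) (rhoPlus_inO p lam)

/-- `[ρ₋(λ)]`. -/
def clsRhoMinus (p : QParam) (lam : ℂ) : GrothendieckRing p :=
  cls (rhoMinus p lam) (rhoMinus_inO p lam)

/-- The parity element `σ = [U_0^-]`. -/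
def sigma (p : QParam) : GrothendieckRing p := clsU p 0 (-1)

/-- `f_s = ∑_{m ≥ 0} σ ^ m [U_{-s-2m}]`. As always in category `𝒪`, the infinite sum of classes is
the class of the direct sum, here of the representations `U_{-s-2m}^{(-1) ^ m}`, `m ≥ 0`. -/
def fSum (p : QParam) (s : ℂ) : GrothendieckRing p :=
  cls (Rep.directSum fun m : ℕ => charU p (-s - 2 * m) ((-1) ^ m)) (directSum_charU_inO p s)

end

end BorelC22

/-! All identities come from a few explicit extensions of weight modules. Most of these modules are
ladders: a sequence of vectors raised by $\mathcal E_0$, lowered by $\mathcal E_1$ with prescribed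
coefficients, and scaled by $\mathcal K_i$. Two modules with ladder bases and equal ladder data are
isomorphic (`IsLadder.cls_eq`), so identifying a submodule or a twist by $U_r^{\pm}$ reduces to
comparing scalars. The Grothendieck ring is not known to be commutative, so each commutation that is
used is proved separately, by exhibiting an isomorphism.

The sum $f_s$ is a geometric series: tensoring with $U_{-2}^-$ moves the $m$-th summand to the next
one, whence $f_s=[U_{-s}]+\sigma[U_{-2}]f_s$ (`fSum_eq_add`). For $s=0$ this exhibits $f_0$ as the
inverse of $1-\sigma[U_{-2}]$, and the formula for every $f_s$ follows.

For $X=[\rho_+(\mu)][\rho_-(\nu)]$ the same recursion replaces an infinite filtration. The vectors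
$\mathcal E_0^k(|m\rangle\otimes|0\rangle)$ form a basis (`towerBasis`). The two summands of
$\Delta(\mathcal E_1)$ each commute with $\mathcal E_0$ up to a factor and an additive scalar, which
gives $\mathcal E_1$ on this basis in closed form (`tower_E1_succ`): one term keeps $m$ and has
coefficient $\mu^2c^+_k+\nu^2c^-_k$, the other lowers $m$ by one. For the chosen $\mu,\nu$ the first
coefficient is a multiple of $[k]_{q_*}[s-k+1]_{q_*}$ (`fockCoeff_eq_vermaCoeff`). Hence the vectors
with $m=0$ span a copy of $U_{-s}\otimes\mathcal W_s^+$. Since no $c^+_{m+1}$ vanishes, the quotient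
is $U_{-2}^-\otimes\rho_+(\mu)\otimes\rho_-(\nu)$ via $m\mapsto m-1$. Thus $X=[U_{-s}][\mathcal
W_s^+]+\sigma[U_{-2}]X$ (`cls_rhoTensor_eq_add`), the equation also satisfied by $[\mathcal
W_s^+]f_s$, and $1-\sigma[U_{-2}]$ can be cancelled.

For an integer $s\ge0$ the vector $|s+1\rangle$ of $\mathcal W_s$ is annihilated by $\mathcal E_1$;
it generates a module of the same kind with parameter $-s-2$, and the quotient is $W_s$
(`clsVerma_eq_add`). Substituting the factorisation of $X$ gives the formula for $[W_s]$, and $s=0$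
is the Wronskian identity. The Baxter relations come from $W_1\otimes\rho_\pm$, which is an
extension of two twisted copies of $\rho_\pm$ with shifted parameters; the submodule is written down
explicitly (`plusVec`, `minusVec`). -/

namespace BorelC22

noncomputable section

open QParam

/-! ### Morphisms, images and the zero object -/

namespace Rep

variable {p : QParam}

/-- Images of a spanning family of weight vectors are again such a family. Infinite direct sums are
shown to lie in $\mathcal O$ by transport from a tensor product along this lemma. -/
theorem InO.of_surjective {M N : Rep p} (hM : M.InO) (f : Hom M N)
    (hf : Function.Surjective f.toLin) : N.InO := by
  obtain ⟨ι, b, wt, hb, hspan, hfin, -, S, hS⟩ := hM.exists_span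
  refine inO_of_span N (fun k => f.toLin (b k)) wt (fun k i => ?_) ?_ hfin S hS
  · rw [← f.map_K, hb, map_smul]
  · rw [Set.range_comp' f.toLin b, ← Submodule.map_span, hspan, Submodule.map_top,
      LinearMap.range_eq_top.2 hf]

/-- An equality of linear maps that holds on a spanning family holds everywhere. -/
theorem lin_ext_span {V W : Type} [AddCommGroup V] [Module ℂ V] [AddCommGroup W] [Module ℂ W]
    {ι : Type} {b : ι → V} (hb : Submodule.span ℂ (Set.range b) = ⊤) {S T : V →ₗ[ℂ] W}
    (h : ∀ k, S (b k) = T (b k)) : S = T :=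
  LinearMap.ext_on_range hb h

/-- A linear map that intertwines the action on a spanning family is a morphism. -/
def Hom.ofSpan {M N : Rep p} {ι : Type} (b : ι → M.V)
    (hb : Submodule.span ℂ (Set.range b) = ⊤) (T : M.V →ₗ[ℂ] N.V)
    (hP : ∀ k, T (M.parity (b k)) = N.parity (T (b k)))
    (hE : ∀ i k, T (M.E i (b k)) = N.E i (T (b k)))
    (hK : ∀ i k, T (M.K i (b k)) = N.K i (T (b k))) : Hom M N where
  toLin := T
  map_parity v := LinearMap.congr_fun
    (lin_ext_span (S := T ∘ₗ M.parity) (T := N.parity ∘ₗ T) hb hP) v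
  map_E i v := LinearMap.congr_fun
    (lin_ext_span (S := T ∘ₗ M.E i) (T := N.E i ∘ₗ T) hb (hE i)) v
  map_K i v := LinearMap.congr_fun
    (lin_ext_span (S := T ∘ₗ M.K i) (T := N.K i ∘ₗ T) hb (hK i)) v

/-- The zero representation. -/
def zero (p : QParam) : Rep p where
  V := PUnit
  parity := 0
  E _ := 0
  K _ := 0
  Kinv _ := 0
  parity_sq := LinearMap.ext fun _ => rfl
  parity_E _ := LinearMap.ext fun _ => rfl
  parity_K _ := LinearMap.ext fun _ => rfl
  K_Kinv _ := LinearMap.ext fun _ => rfl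
  Kinv_K _ := LinearMap.ext fun _ => rfl
  K_comm _ _ := LinearMap.ext fun _ => rfl
  K_E _ _ := LinearMap.ext fun _ => rfl
  serre _ _ _ := LinearMap.ext fun _ => rfl

/-- The zero morphism. -/
def Hom.zero (M N : Rep p) : Hom M N where
  toLin := 0
  map_parity _ := by simp
  map_E _ _ := by simp
  map_K _ _ := by simp

theorem zero_inO : (zero p).InO := by
  refine inO_of_span _ (fun k : Empty => k.elim) (fun k => k.elim) (fun k => k.elim) ?_
    (fun _ => Set.toFinite _) ∅ (fun k => k.elim)
  exact (Submodule.eq_bot_of_subsingleton (R := ℂ) (M := PUnit)).trans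
    (Submodule.eq_bot_of_subsingleton (R := ℂ) (M := PUnit)).symm

end Rep

/-! ### Classes in the Grothendieck ring -/

variable {p : QParam}

theorem cls_exact {M' M M'' : Rep p} (hM' : M'.InO) (hM : M.InO) (hM'' : M''.InO)
    (f : Rep.Hom M' M) (g : Rep.Hom M M'') (hf : Function.Injective f.toLin)
    (hfg : Function.Exact f.toLin g.toLin) (hg : Function.Surjective g.toLin) :
    cls M hM = cls M' hM' + cls M'' hM'' :=
  (RingQuot.mkRingHom_rel
    (GrothendieckRel.exact ⟨M', hM'⟩ ⟨M, hM⟩ ⟨M'', hM''⟩ f g hf hfg hg)).trans (map_add _ _ _)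

theorem cls_tensor {M N : Rep p} (hM : M.InO) (hN : N.InO) :
    cls (M.tensor N) (hM.tensor hN) = cls M hM * cls N hN :=
  (RingQuot.mkRingHom_rel (GrothendieckRel.tensor ⟨M, hM⟩ ⟨N, hN⟩)).trans (map_mul _ _ _)

theorem cls_trivial :
    cls (Rep.oneDim p 1 (fun _ => one_ne_zero) 1) (oneDim_inO p _ _ _) = 1 :=
  (RingQuot.mkRingHom_rel GrothendieckRel.one).trans (map_one _)

/-- The sequence $0\to0\to0\to0\to0$ is exact, so the class $c$ of the zero object satisfies
$c=c+c$. -/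
theorem cls_zero : cls (Rep.zero p) Rep.zero_inO = 0 := by
  have h := cls_exact (p := p) Rep.zero_inO Rep.zero_inO Rep.zero_inO (Rep.Hom.zero _ _)
    (Rep.Hom.zero _ _) (fun _ _ _ => rfl) (fun _ => ⟨fun _ => ⟨0, rfl⟩, fun _ => rfl⟩)
    (fun _ => ⟨0, rfl⟩)
  simpa using h

/-- Invariance under isomorphism is not among the defining relations; it follows from the short
exact sequence with zero kernel. -/
theorem cls_eq_of_bijective {M N : Rep p} (hM : M.InO) (hN : N.InO) (f : Rep.Hom M N)
    (hf : Function.Bijective f.toLin) : cls M hM = cls N hN := by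
  have h := cls_exact Rep.zero_inO hM hN (Rep.Hom.zero _ M) f
    (fun _ _ _ => rfl) (fun v => ⟨fun hv => ⟨0, ?_⟩, ?_⟩) hf.2
  · rw [h, cls_zero, zero_add]
  · rw [map_zero]
    exact (hf.1 (hv.trans (map_zero _).symm)).symm
  · rintro ⟨w, rfl⟩
    exact map_zero _

/-- The class of an extension, exactness being witnessed by a linear splitting. -/
theorem cls_eq_add_of_splitting {M' M M'' : Rep p} (hM' : M'.InO) (hM : M.InO) (hM'' : M''.InO)
    (f : Rep.Hom M' M) (g : Rep.Hom M M'') (r : M.V →ₗ[ℂ] M'.V) (s : M''.V →ₗ[ℂ] M.V)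
    (hrf : ∀ v, r (f.toLin v) = v) (hgs : ∀ v, g.toLin (s v) = v)
    (hsum : ∀ v, f.toLin (r v) + s (g.toLin v) = v) :
    cls M hM = cls M' hM' + cls M'' hM'' := by
  refine cls_exact hM' hM hM'' f g (Function.LeftInverse.injective hrf) (fun v => ⟨?_, ?_⟩)
    (Function.RightInverse.surjective hgs)
  · intro hv
    have h := hsum v
    rw [hv, map_zero, add_zero] at h
    exact ⟨r v, h⟩
  · rintro ⟨w, rfl⟩
    have h := hsum (f.toLin w)
    rw [hrf, add_eq_left] at h
    rw [← hgs (g.toLin (f.toLin w)), h, map_zero]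

/-! ### Direct sums and tensor products -/

namespace Rep

/-- The inclusion of a summand into a direct sum. -/
def incl (M : ℕ → Rep p) (m : ℕ) : (M m).V →ₗ[ℂ] (directSum M).V :=
  DirectSum.lof ℂ ℕ (fun m => (M m).V) m

/-- The linear map out of a direct sum with given restrictions to the summands. -/
def descDirectSum {M : ℕ → Rep p} {W : Type} [AddCommGroup W] [Module ℂ W]
    (F : ∀ m, (M m).V →ₗ[ℂ] W) : (directSum M).V →ₗ[ℂ] W :=
  DirectSum.toModule ℂ ℕ W F

theorem descDirectSum_incl {M : ℕ → Rep p} {W : Type} [AddCommGroup W] [Module ℂ W]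
    (F : ∀ m, (M m).V →ₗ[ℂ] W) (m : ℕ) (v : (M m).V) :
    descDirectSum F (incl M m v) = F m v :=
  DirectSum.toModule_lof _ _ _

theorem directSum_linHom_ext {M : ℕ → Rep p} {W : Type} [AddCommGroup W] [Module ℂ W]
    {S T : (directSum M).V →ₗ[ℂ] W} (h : ∀ m v, S (incl M m v) = T (incl M m v)) : S = T :=
  DirectSum.linearMap_ext ℂ fun m => LinearMap.ext (h m)

theorem directSum_parity_incl (M : ℕ → Rep p) (m : ℕ) (v : (M m).V) :
    (directSum M).parity (incl M m v) = incl M m ((M m).parity v) :=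
  DirectSum.lmap_lof _ _ _

theorem directSum_E_incl (M : ℕ → Rep p) (i : Fin 2) (m : ℕ) (v : (M m).V) :
    (directSum M).E i (incl M m v) = incl M m ((M m).E i v) :=
  DirectSum.lmap_lof _ _ _

theorem directSum_K_incl (M : ℕ → Rep p) (i : Fin 2) (m : ℕ) (v : (M m).V) :
    (directSum M).K i (incl M m v) = incl M m ((M m).K i v) :=
  DirectSum.lmap_lof _ _ _

/-- The morphism out of a direct sum with given restrictions to the summands. -/
def Hom.descDirectSum {M : ℕ → Rep p} {N : Rep p} (F : ∀ m, Hom (M m) N) :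
    Hom (directSum M) N where
  toLin := Rep.descDirectSum fun m => (F m).toLin
  map_parity v := LinearMap.congr_fun (directSum_linHom_ext
    (S := Rep.descDirectSum (fun m => (F m).toLin) ∘ₗ (directSum M).parity)
    (T := N.parity ∘ₗ Rep.descDirectSum fun m => (F m).toLin) fun m v => by
      rw [LinearMap.comp_apply, LinearMap.comp_apply, directSum_parity_incl, descDirectSum_incl,
        descDirectSum_incl, (F m).map_parity]) v
  map_E i v := LinearMap.congr_fun (directSum_linHom_ext
    (S := Rep.descDirectSum (fun m => (F m).toLin) ∘ₗ (directSum M).E i)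
    (T := N.E i ∘ₗ Rep.descDirectSum fun m => (F m).toLin) fun m v => by
      rw [LinearMap.comp_apply, LinearMap.comp_apply, directSum_E_incl, descDirectSum_incl,
        descDirectSum_incl, (F m).map_E]) v
  map_K i v := LinearMap.congr_fun (directSum_linHom_ext
    (S := Rep.descDirectSum (fun m => (F m).toLin) ∘ₗ (directSum M).K i)
    (T := N.K i ∘ₗ Rep.descDirectSum fun m => (F m).toLin) fun m v => by
      rw [LinearMap.comp_apply, LinearMap.comp_apply, directSum_K_incl, descDirectSum_incl,
        descDirectSum_incl, (F m).map_K]) v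

/-- The inclusion of a summand, as a morphism. -/
def Hom.incl (M : ℕ → Rep p) (m : ℕ) : Hom (M m) (directSum M) where
  toLin := Rep.incl M m
  map_parity v := (directSum_parity_incl M m v).symm
  map_E i v := (directSum_E_incl M i m v).symm
  map_K i v := (directSum_K_incl M i m v).symm

/-- The composition of morphisms. -/
def Hom.comp {L M N : Rep p} (g : Hom M N) (f : Hom L M) : Hom L N where
  toLin := g.toLin ∘ₗ f.toLin
  map_parity v := by simp [f.map_parity, g.map_parity]
  map_E i v := by simp [f.map_E, g.map_E]
  map_K i v := by simp [f.map_K, g.map_K]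

/-- The direct sum of a sequence of morphisms. -/
def Hom.directSum {M N : ℕ → Rep p} (F : ∀ m, Hom (M m) (N m)) :
    Hom (Rep.directSum M) (Rep.directSum N) :=
  Hom.descDirectSum fun m => (Hom.incl N m).comp (F m)

theorem Hom.directSum_bijective {M N : ℕ → Rep p} (F : ∀ m, Hom (M m) (N m))
    (hF : ∀ m, Function.Bijective (F m).toLin) :
    Function.Bijective (Hom.directSum F).toLin := by
  let e := fun m => (LinearEquiv.ofBijective (F m).toLin (hF m))
  let G : (Rep.directSum N).V →ₗ[ℂ] (Rep.directSum M).V :=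
    Rep.descDirectSum fun m => Rep.incl M m ∘ₗ (e m).symm.toLinearMap
  have hF' : ∀ m v, (Hom.directSum F).toLin (Rep.incl M m v) = Rep.incl N m (e m v) :=
    fun m v => descDirectSum_incl _ _ _
  have hG : ∀ m v, G (Rep.incl N m v) = Rep.incl M m ((e m).symm v) :=
    fun m v => descDirectSum_incl _ _ _
  refine Function.bijective_iff_has_inverse.2 ⟨G, fun v => ?_, fun v => ?_⟩
  · refine LinearMap.congr_fun (directSum_linHom_ext (S := G ∘ₗ (Hom.directSum F).toLin)
      (T := LinearMap.id) fun m v => ?_) v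
    rw [LinearMap.comp_apply, hF', hG, LinearEquiv.symm_apply_apply, LinearMap.id_apply]
  · refine LinearMap.congr_fun (directSum_linHom_ext (S := (Hom.directSum F).toLin ∘ₗ G)
      (T := LinearMap.id) fun m v => ?_) v
    rw [LinearMap.comp_apply, hG, hF', LinearEquiv.apply_symm_apply, LinearMap.id_apply]

/-- The pure tensor `v ⊗ w` as a vector of the tensor product of two representations. -/
def tmul (M N : Rep p) : M.V →ₗ[ℂ] N.V →ₗ[ℂ] (M.tensor N).V := TensorProduct.mk ℂ M.V N.V

theorem tensor_parity_tmul (M N : Rep p) (v : M.V) (w : N.V) :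
    (M.tensor N).parity (tmul M N v w) = tmul M N (M.parity v) (N.parity w) := rfl

theorem tensor_K_tmul (M N : Rep p) (i : Fin 2) (v : M.V) (w : N.V) :
    (M.tensor N).K i (tmul M N v w) = tmul M N (M.K i v) (N.K i w) := rfl

theorem tensor_E_tmul (M N : Rep p) (i : Fin 2) (v : M.V) (w : N.V) :
    (M.tensor N).E i (tmul M N v w) =
      tmul M N (M.E i v) (N.K i w) + tmul M N (M.parity v) (N.E i w) := rfl

theorem tensor_linHom_ext {M N : Rep p} {W : Type} [AddCommGroup W] [Module ℂ W]
    {S T : (M.tensor N).V →ₗ[ℂ] W} (h : ∀ v w, S (tmul M N v w) = T (tmul M N v w)) : S = T :=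
  TensorProduct.ext' h

/-- The linear map out of a tensor product given by a bilinear map. -/
def descTensor {M N : Rep p} {W : Type} [AddCommGroup W] [Module ℂ W]
    (F : M.V →ₗ[ℂ] N.V →ₗ[ℂ] W) : (M.tensor N).V →ₗ[ℂ] W := TensorProduct.lift F

theorem descTensor_tmul {M N : Rep p} {W : Type} [AddCommGroup W] [Module ℂ W]
    (F : M.V →ₗ[ℂ] N.V →ₗ[ℂ] W) (v : M.V) (w : N.V) : descTensor F (tmul M N v w) = F v w := rfl

/-- The morphism between tensor products induced by a morphism of the second factors. -/
def Hom.lTensor (N : Rep p) {M M' : Rep p} (f : Hom M M') : Hom (N.tensor M) (N.tensor M') where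
  toLin := Rep.descTensor ((Rep.tmul N M').compl₂ f.toLin)
  map_parity v := LinearMap.congr_fun (tensor_linHom_ext
    (S := Rep.descTensor ((Rep.tmul N M').compl₂ f.toLin) ∘ₗ (N.tensor M).parity)
    (T := (N.tensor M').parity ∘ₗ Rep.descTensor ((Rep.tmul N M').compl₂ f.toLin)) fun x y => by
      simp only [LinearMap.comp_apply, tensor_parity_tmul, descTensor_tmul, LinearMap.compl₂_apply,
        f.map_parity]) v
  map_E i v := LinearMap.congr_fun (tensor_linHom_ext
    (S := Rep.descTensor ((Rep.tmul N M').compl₂ f.toLin) ∘ₗ (N.tensor M).E i)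
    (T := (N.tensor M').E i ∘ₗ Rep.descTensor ((Rep.tmul N M').compl₂ f.toLin)) fun x y => by
      simp only [LinearMap.comp_apply, tensor_E_tmul, descTensor_tmul, LinearMap.compl₂_apply,
        map_add, f.map_E, f.map_K]) v
  map_K i v := LinearMap.congr_fun (tensor_linHom_ext
    (S := Rep.descTensor ((Rep.tmul N M').compl₂ f.toLin) ∘ₗ (N.tensor M).K i)
    (T := (N.tensor M').K i ∘ₗ Rep.descTensor ((Rep.tmul N M').compl₂ f.toLin)) fun x y => by
      simp only [LinearMap.comp_apply, tensor_K_tmul, descTensor_tmul, LinearMap.compl₂_apply,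
        f.map_K]) v

/-- The isomorphism `⨁ (N ⊗ M_m) → N ⊗ ⨁ M_m`. -/
def Hom.directSumTensor (N : Rep p) (M : ℕ → Rep p) :
    Hom (Rep.directSum fun m => N.tensor (M m)) (N.tensor (Rep.directSum M)) :=
  Hom.descDirectSum fun m => Hom.lTensor N (Hom.incl M m)

/-- The underlying linear map is the inverse of the distributivity isomorphism, so only agreement on
pure tensors in each summand has to be checked. -/
theorem Hom.directSumTensor_bijective (N : Rep p) (M : ℕ → Rep p) :
    Function.Bijective (Hom.directSumTensor N M).toLin := by
  have h : (Hom.directSumTensor N M).toLin =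
      (TensorProduct.directSumRight ℂ ℂ N.V fun m => (M m).V).symm.toLinearMap :=
    directSum_linHom_ext fun m v => LinearMap.congr_fun (tensor_linHom_ext
      (S := (Hom.directSumTensor N M).toLin ∘ₗ Rep.incl (fun m => N.tensor (M m)) m)
      (T := (TensorProduct.directSumRight ℂ ℂ N.V fun m => (M m).V).symm.toLinearMap ∘ₗ
        Rep.incl (fun m => N.tensor (M m)) m) fun x y =>
          (descDirectSum_incl (M := fun m => N.tensor (M m)) _ m _).trans
          (TensorProduct.directSumRight_symm_lof_tmul (M₂ := fun m => (M m).V) ℂ ℂ x m y).symm) v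
  rw [h]
  exact (TensorProduct.directSumRight ℂ ℂ N.V fun m => (M m).V).symm.bijective

/-- The inverse of a bijective morphism. -/
def Hom.symm {M N : Rep p} (f : Hom M N) (hf : Function.Bijective f.toLin) : Hom N M where
  toLin := (LinearEquiv.ofBijective f.toLin hf).symm
  map_parity v := by
    obtain ⟨w, rfl⟩ := (LinearEquiv.ofBijective f.toLin hf).surjective v
    rw [LinearEquiv.coe_coe, LinearEquiv.symm_apply_apply, LinearEquiv.symm_apply_eq]
    exact (f.map_parity w).symm
  map_E i v := by
    obtain ⟨w, rfl⟩ := (LinearEquiv.ofBijective f.toLin hf).surjective v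
    rw [LinearEquiv.coe_coe, LinearEquiv.symm_apply_apply, LinearEquiv.symm_apply_eq]
    exact (f.map_E i w).symm
  map_K i v := by
    obtain ⟨w, rfl⟩ := (LinearEquiv.ofBijective f.toLin hf).surjective v
    rw [LinearEquiv.coe_coe, LinearEquiv.symm_apply_apply, LinearEquiv.symm_apply_eq]
    exact (f.map_K i w).symm

theorem Hom.symm_bijective {M N : Rep p} (f : Hom M N) (hf : Function.Bijective f.toLin) :
    Function.Bijective (f.symm hf).toLin :=
  (LinearEquiv.ofBijective f.toLin hf).symm.bijective

end Rep

/-! ### Classes of infinite direct sums -/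

/-- If `L m ≅ N ⊗ M m` for all `m`, then `[⨁ L m] = [N] [⨁ M m]`. -/
theorem exists_cls_directSum_eq_mul {L M : ℕ → Rep p} {N : Rep p} (hN : N.InO)
    (hM : (Rep.directSum M).InO) (F : ∀ m, Rep.Hom (N.tensor (M m)) (L m))
    (hF : ∀ m, Function.Bijective (F m).toLin) :
    ∃ h : (Rep.directSum L).InO, cls _ h = cls N hN * cls _ hM := by
  have b1 := Rep.Hom.directSumTensor_bijective N M
  have b2 := Rep.Hom.symm_bijective _ b1
  have b3 := Rep.Hom.directSum_bijective F hF
  have h1 := (hN.tensor hM).of_surjective _ b2.2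
  have h2 := h1.of_surjective _ b3.2
  refine ⟨h2, ?_⟩
  rw [← cls_tensor, ← cls_eq_of_bijective h1 h2 _ b3, cls_eq_of_bijective h1 _ _ b1]

/-- Splitting off the first summand of a direct sum. -/
theorem cls_directSum_eq_add {M : ℕ → Rep p} (hM : (Rep.directSum M).InO) (h0 : (M 0).InO)
    (hM' : (Rep.directSum fun m => M (m + 1)).InO) :
    cls _ hM = cls _ h0 + cls _ hM' := by
  -- The projection kills the summand 0 and moves the summand $m+1$ to position $m$.
  let F : ∀ m, Rep.Hom (M m) (Rep.directSum fun m => M (m + 1)) := fun m => Nat.casesOn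
    (motive := fun m => Rep.Hom (M m) (Rep.directSum fun m => M (m + 1))) m
      (Rep.Hom.zero _ _) (fun m => Rep.Hom.incl (fun m => M (m + 1)) m)
  let g := Rep.Hom.descDirectSum F
  have hg0 : ∀ v, g.toLin (Rep.incl M 0 v) = 0 := fun v => Rep.descDirectSum_incl _ _ _
  have hg1 : ∀ m v, g.toLin (Rep.incl M (m + 1) v) = Rep.incl (fun m => M (m + 1)) m v :=
    fun m v => Rep.descDirectSum_incl _ _ _
  let r : (Rep.directSum M).V →ₗ[ℂ] (M 0).V := Rep.descDirectSum fun m => Nat.casesOn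
    (motive := fun m => (M m).V →ₗ[ℂ] (M 0).V) m LinearMap.id (fun _ => 0)
  have hr0 : ∀ v, r (Rep.incl M 0 v) = v := fun v => Rep.descDirectSum_incl _ _ _
  have hr1 : ∀ m v, r (Rep.incl M (m + 1) v) = 0 := fun m v => Rep.descDirectSum_incl _ _ _
  let s : (Rep.directSum fun m => M (m + 1)).V →ₗ[ℂ] (Rep.directSum M).V :=
    Rep.descDirectSum fun m => Rep.incl M (m + 1)
  have hs : ∀ m v, s (Rep.incl (fun m => M (m + 1)) m v) = Rep.incl M (m + 1) v :=
    fun m v => Rep.descDirectSum_incl _ _ _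
  refine cls_eq_add_of_splitting h0 hM hM' (Rep.Hom.incl M 0) g r s hr0 ?_ ?_
  · intro v
    refine LinearMap.congr_fun (Rep.directSum_linHom_ext (S := g.toLin ∘ₗ s) (T := LinearMap.id)
      fun m v => ?_) v
    rw [LinearMap.comp_apply, hs, hg1, LinearMap.id_apply]
  · intro v
    refine LinearMap.congr_fun (Rep.directSum_linHom_ext
      (S := Rep.incl M 0 ∘ₗ r + s ∘ₗ g.toLin) (T := LinearMap.id) fun m v => ?_) v
    rw [LinearMap.add_apply, LinearMap.comp_apply, LinearMap.comp_apply, LinearMap.id_apply]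
    cases m with
    | zero => rw [hg0, map_zero, add_zero, hr0]
    | succ m => rw [hg1, hs, hr1, map_zero, zero_add]

/-- Two objects on which `E 0` and `E 1` act as zero commute in the Grothendieck ring. -/
theorem cls_commute_of_E_eq_zero {M N : Rep p} (hM : M.InO) (hN : N.InO)
    (h1 : ∀ i, M.E i = 0) (h2 : ∀ i, N.E i = 0) : Commute (cls M hM) (cls N hN) := by
  rw [Commute, SemiconjBy, ← cls_tensor, ← cls_tensor]
  -- The flip without the super sign suffices: the $\mathcal E_i$ act as zero on both tensor
  -- products, so only the parity and the $\mathcal K_i$ have to be respected.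
  let T : (M.tensor N).V ≃ₗ[ℂ] (N.tensor M).V := TensorProduct.comm ℂ M.V N.V
  have e : ∀ {M N : Rep p}, (∀ i, M.E i = 0) → (∀ i, N.E i = 0) → ∀ i, (M.tensor N).E i = 0 :=
    fun h1 h2 i => Rep.tensor_linHom_ext fun v w => by simp [Rep.tensor_E_tmul, h1, h2]
  refine cls_eq_of_bijective _ _ ⟨T.toLinearMap, fun v => ?_, fun i v => ?_, fun i v => ?_⟩
    T.bijective
  · exact LinearMap.congr_fun (Rep.tensor_linHom_ext (S := T.toLinearMap ∘ₗ (M.tensor N).parity)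
      (T := (N.tensor M).parity ∘ₗ T.toLinearMap) fun x y => rfl) v
  · rw [e h1 h2, e h2 h1, LinearMap.zero_apply, LinearMap.zero_apply, map_zero]
  · exact LinearMap.congr_fun (Rep.tensor_linHom_ext (S := T.toLinearMap ∘ₗ (M.tensor N).K i)
      (T := (N.tensor M).K i ∘ₗ T.toLinearMap) fun x y => rfl) v

/-! ### Morphisms and extensions in terms of bases -/

namespace Rep

/-- A basis of the tensor product of two representations. -/
def tensorBasis {M N : Rep p} {ι κ : Type} (b : Module.Basis ι ℂ M.V) (b' : Module.Basis κ ℂ N.V) :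
    Module.Basis (ι × κ) ℂ (M.tensor N).V := b.tensorProduct b'

theorem tensorBasis_apply {M N : Rep p} {ι κ : Type} (b : Module.Basis ι ℂ M.V)
    (b' : Module.Basis κ ℂ N.V) (k : ι × κ) :
    tensorBasis b b' k = tmul M N (b k.1) (b' k.2) :=
  Module.Basis.tensorProduct_apply' _ _ _

/-- A linear map that intertwines the action on a basis is a morphism. -/
def Hom.ofBasis {M N : Rep p} {ι : Type} (b : Module.Basis ι ℂ M.V) (v : ι → N.V)
    (hP : ∀ k, b.constr ℂ v (M.parity (b k)) = N.parity (v k))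
    (hE : ∀ i k, b.constr ℂ v (M.E i (b k)) = N.E i (v k))
    (hK : ∀ i k, b.constr ℂ v (M.K i (b k)) = N.K i (v k)) : Hom M N :=
  Hom.ofSpan b b.span_eq (b.constr ℂ v) (fun k => by rw [hP, b.constr_basis])
    (fun i k => by rw [hE, b.constr_basis]) (fun i k => by rw [hK, b.constr_basis])

theorem Hom.ofBasis_apply {M N : Rep p} {ι : Type} (b : Module.Basis ι ℂ M.V) (v : ι → N.V)
    (hP : ∀ k, b.constr ℂ v (M.parity (b k)) = N.parity (v k))
    (hE : ∀ i k, b.constr ℂ v (M.E i (b k)) = N.E i (v k))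
    (hK : ∀ i k, b.constr ℂ v (M.K i (b k)) = N.K i (v k)) (k : ι) :
    (Hom.ofBasis b v hP hE hK).toLin (b k) = v k :=
  b.constr_basis _ _ _

end Rep

theorem cls_eq_add_of_basis {M' M M'' : Rep p} (hM' : M'.InO) (hM : M.InO) (hM'' : M''.InO)
    {ι' ι ι'' : Type} (b' : Module.Basis ι' ℂ M'.V) (b : Module.Basis ι ℂ M.V)
    (b'' : Module.Basis ι'' ℂ M''.V)
    (f : Rep.Hom M' M) (g : Rep.Hom M M'') (r : M.V →ₗ[ℂ] M'.V) (s : M''.V →ₗ[ℂ] M.V)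
    (hrf : ∀ k, r (f.toLin (b' k)) = b' k) (hgs : ∀ k, g.toLin (s (b'' k)) = b'' k)
    (hsum : ∀ k, f.toLin (r (b k)) + s (g.toLin (b k)) = b k) :
    cls M hM = cls M' hM' + cls M'' hM'' :=
  cls_eq_add_of_splitting hM' hM hM'' f g r s
    (LinearMap.congr_fun (b'.ext (f₁ := r ∘ₗ f.toLin) (f₂ := LinearMap.id) hrf))
    (LinearMap.congr_fun (b''.ext (f₁ := g.toLin ∘ₗ s) (f₂ := LinearMap.id) hgs))
    (LinearMap.congr_fun (b.ext (f₁ := f.toLin ∘ₗ r + s ∘ₗ g.toLin) (f₂ := LinearMap.id) hsum))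

/-! ### Ladder modules and their classification -/

/-- A family of vectors on which `𝔟₊` acts as on the basis of a ladder representation. -/
structure IsLadder (M : Rep p) (x : ℂ) (ε : ℤˣ) (u : ℂ) (c : ℕ → ℂ) (v : ℕ → M.V) : Prop where
  parity : ∀ k, M.parity (v k) = (((ε : ℤ) : ℂ) * (-1) ^ k) • v k
  E0 : ∀ k, M.E 0 (v k) = u • v (k + 1)
  E1_zero : M.E 1 (v 0) = 0
  E1_succ : ∀ k, M.E 1 (v (k + 1)) = (u * c (k + 1)) • v k
  K0 : ∀ k, M.K 0 (v k) = (x⁻¹ * p.q ^ (2 * k)) • v k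
  K1 : ∀ k, M.K 1 (v k) = (x * (p.q ^ (2 * k))⁻¹) • v k

/-- The basis `|k⟩` of a ladder representation. -/
def ladderBasis (p : QParam) (x : ℂ) (hx : x ≠ 0) (ε : ℤˣ) (u : ℂ) (c : ℕ → ℂ) (hc0 : c 0 = 0)
    (hc : SerreCoeff p c) : Module.Basis ℕ ℂ (ladder p x hx ε u c hc0 hc).V :=
  Finsupp.basisSingleOne

theorem ladder_isLadder (p : QParam) (x : ℂ) (hx : x ≠ 0) (ε : ℤˣ) (u : ℂ) (c : ℕ → ℂ)
    (hc0 : c 0 = 0) (hc : SerreCoeff p c) :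
    IsLadder (ladder p x hx ε u c hc0 hc) x ε u c (ladderBasis p x hx ε u c hc0 hc) := by
  have hb : ∀ k, ladderBasis p x hx ε u c hc0 hc k = (ket k : ℕ →₀ ℂ) :=
    fun k => congrFun (Finsupp.coe_basisSingleOne (R := ℂ)) k
  refine ⟨fun k => ?_, fun k => ?_, ?_, fun k => ?_, fun k => ?_, fun k => ?_⟩
  · rw [hb]; exact diag_ket _ k
  · rw [hb, hb]; exact congrArg (u • ·) (up_ket k)
  · rw [hb]; exact (congrArg (fun v : ℕ →₀ ℂ => u • v) (down_ket_zero c hc0)).trans (smul_zero u)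
  · rw [hb, hb]; exact (congrArg (u • ·) (down_ket c k)).trans (smul_smul _ _ _)
  · rw [hb]; exact diag_ket _ k
  · rw [hb]; exact diag_ket _ k

/-- The basis of `𝒲_s^ε(λ)`. -/
def vermaBasis (p : QParam) (s : ℂ) (ε : ℤˣ) (lam : ℂ) : Module.Basis ℕ ℂ (verma p s ε lam).V :=
  ladderBasis ..

theorem verma_isLadder (p : QParam) (s : ℂ) (ε : ℤˣ) (lam : ℂ) :
    IsLadder (verma p s ε lam) (((ε : ℤ) : ℂ) * p.qsPow s) ε lam (vermaCoeff p s)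
      (vermaBasis p s ε lam) := ladder_isLadder ..

/-- The basis of `ρ₊(λ)`. -/
def rhoPlusBasis (p : QParam) (lam : ℂ) : Module.Basis ℕ ℂ (rhoPlus p lam).V := ladderBasis ..

theorem rhoPlus_isLadder (p : QParam) (lam : ℂ) :
    IsLadder (rhoPlus p lam) 1 1 lam (fockPlusCoeff p) (rhoPlusBasis p lam) := ladder_isLadder ..

/-- The basis of `ρ₋(λ)`. -/
def rhoMinusBasis (p : QParam) (lam : ℂ) : Module.Basis ℕ ℂ (rhoMinus p lam).V := ladderBasis ..

theorem rhoMinus_isLadder (p : QParam) (lam : ℂ) :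
    IsLadder (rhoMinus p lam) 1 1 lam (fockMinusCoeff p) (rhoMinusBasis p lam) :=
  ladder_isLadder ..

namespace IsLadder

variable {M N : Rep p} {x u : ℂ} {ε : ℤˣ} {c : ℕ → ℂ}

/-- The morphism that sends the basis of a ladder representation to a ladder of vectors. -/
def hom {b : Module.Basis ℕ ℂ M.V} (hb : IsLadder M x ε u c b) {v : ℕ → N.V}
    (hv : IsLadder N x ε u c v) : Rep.Hom M N :=
  Rep.Hom.ofBasis b v
    (fun k => by rw [hb.parity, map_smul, b.constr_basis, hv.parity])
    (fun i k => by
      fin_cases i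
      · change b.constr ℂ v (M.E 0 (b k)) = N.E 0 (v k)
        rw [hb.E0, map_smul, b.constr_basis, hv.E0]
      · change b.constr ℂ v (M.E 1 (b k)) = N.E 1 (v k)
        cases k with
        | zero => rw [hb.E1_zero, map_zero, hv.E1_zero]
        | succ k => rw [hb.E1_succ, map_smul, b.constr_basis, hv.E1_succ])
    (fun i k => by
      fin_cases i
      · change b.constr ℂ v (M.K 0 (b k)) = N.K 0 (v k)
        rw [hb.K0, map_smul, b.constr_basis, hv.K0]
      · change b.constr ℂ v (M.K 1 (b k)) = N.K 1 (v k)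
        rw [hb.K1, map_smul, b.constr_basis, hv.K1])

theorem hom_apply {b : Module.Basis ℕ ℂ M.V} (hb : IsLadder M x ε u c b) {v : ℕ → N.V}
    (hv : IsLadder N x ε u c v) (k : ℕ) : (hb.hom hv).toLin (b k) = v k :=
  Rep.Hom.ofBasis_apply _ _ _ _ _ k

theorem hom_bijective {b : Module.Basis ℕ ℂ M.V} (hb : IsLadder M x ε u c b)
    {b' : Module.Basis ℕ ℂ N.V} (hb' : IsLadder N x ε u c b') :
    Function.Bijective (hb.hom hb').toLin := by
  have h : (hb.hom hb').toLin = (b.equiv b' (Equiv.refl ℕ)).toLinearMap :=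
    b.ext fun k => by rw [hom_apply]; simp
  rw [h]
  exact (b.equiv b' (Equiv.refl ℕ)).bijective

/-- A ladder basis determines the module up to isomorphism. The data enter through equations because
in the applications they agree only after a computation with $q$ and $q_*$. -/
theorem cls_eq {b : Module.Basis ℕ ℂ M.V} (hb : IsLadder M x ε u c b)
    {b' : Module.Basis ℕ ℂ N.V} {x' u' : ℂ} {ε' : ℤˣ} {c' : ℕ → ℂ}
    (hb' : IsLadder N x' ε' u' c' b') (hM : M.InO) (hN : N.InO)
    (hx : x = x') (hε : ε = ε') (hu : u = u') (hc : c = c') :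
    cls M hM = cls N hN := by
  subst hx hε hu hc
  exact cls_eq_of_bijective hM hN _ (hb.hom_bijective hb')

end IsLadder

/-! ### One-dimensional modules and twisting by them -/

/-- The basis vector of `U_r^ε`. -/
def charUBasis (p : QParam) (r : ℂ) (ε : ℤˣ) : Module.Basis Unit ℂ (charU p r ε).V :=
  Module.Basis.singleton Unit ℂ

theorem charU_parity (p : QParam) (r : ℂ) (ε : ℤˣ) (v : (charU p r ε).V) :
    (charU p r ε).parity v = ((ε : ℤ) : ℂ) • v := rfl

theorem charU_E (p : QParam) (r : ℂ) (ε : ℤˣ) (i : Fin 2) : (charU p r ε).E i = 0 := rfl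

theorem charU_K0 (p : QParam) (r : ℂ) (ε : ℤˣ) (v : (charU p r ε).V) :
    (charU p r ε).K 0 v = (((ε : ℤ) : ℂ) * p.qsPow (-r)) • v := rfl

theorem charU_K1 (p : QParam) (r : ℂ) (ε : ℤˣ) (v : (charU p r ε).V) :
    (charU p r ε).K 1 v = (((ε : ℤ) : ℂ) * p.qsPow r) • v := rfl

theorem qsPow_mul_qsPow_neg (p : QParam) (r : ℂ) : p.qsPow r * p.qsPow (-r) = 1 := by
  rw [← p.qsPow_add, add_neg_cancel, p.qsPow_zero]

theorem inv_units_mul_qsPow (p : QParam) (r : ℂ) (ε : ℤˣ) :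
    (((ε : ℤ) : ℂ) * p.qsPow r)⁻¹ = ((ε : ℤ) : ℂ) * p.qsPow (-r) := by
  refine inv_eq_of_mul_eq_one_right ?_
  linear_combination units_sq ε * p.qsPow r * p.qsPow (-r) + qsPow_mul_qsPow_neg p r

section Character

variable {M : Rep p} {x u : ℂ} {ε : ℤˣ} {c : ℕ → ℂ}

/-- The basis of `U_r^ε' ⊗ M`, adapted to the sign rule. -/
def charUTensorBasis (r : ℂ) (ε' : ℤˣ) (b : Module.Basis ℕ ℂ M.V) :
    Module.Basis ℕ ℂ ((charU p r ε').tensor M).V :=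
  ((Rep.tensorBasis (charUBasis p r ε') b).reindex (Equiv.punitProd ℕ)).isUnitSMul
    (w := fun k => ((ε' : ℤ) : ℂ) ^ k) fun k => (pow_ne_zero k (units_ne ε')).isUnit

theorem charUTensorBasis_apply (r : ℂ) (ε' : ℤˣ) (b : Module.Basis ℕ ℂ M.V) (k : ℕ) :
    charUTensorBasis r ε' b k =
      (((ε' : ℤ) : ℂ) ^ k) • Rep.tmul (charU p r ε') M (charUBasis p r ε' ()) (b k) := by
  rw [charUTensorBasis, Module.Basis.isUnitSMul_apply, Module.Basis.reindex_apply,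
    Rep.tensorBasis_apply]
  rfl

/-- Since $\mathcal E_i$ kills the line, it acts on the tensor product as
$\varepsilon'\otimes\mathcal E_i$. Rescaling the $k$-th vector by $\varepsilon'^k$ absorbs this sign
for $\mathcal E_0$, and for $\mathcal E_1$ as well because $\varepsilon'^2=1$; only the top weight
and the parity change. -/
theorem IsLadder.charU_tensor {b : Module.Basis ℕ ℂ M.V} (hb : IsLadder M x ε u c b)
    (r : ℂ) (ε' : ℤˣ) :
    IsLadder ((charU p r ε').tensor M) (((ε' : ℤ) : ℂ) * p.qsPow r * x) (ε' * ε) u c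
      (charUTensorBasis r ε' b) := by
  refine ⟨fun k => ?_, fun k => ?_, ?_, fun k => ?_, fun k => ?_, fun k => ?_⟩ <;>
  simp only [charUTensorBasis_apply, map_smul, Rep.tensor_parity_tmul, Rep.tensor_E_tmul,
    Rep.tensor_K_tmul, charU_parity, charU_E, charU_K0, charU_K1, hb.parity, hb.E0, hb.E1_zero,
    hb.E1_succ, hb.K0, hb.K1, LinearMap.zero_apply, map_zero, zero_add, smul_zero,
    LinearMap.smul_apply, smul_smul, mul_inv, ← inv_units_mul_qsPow]
  · congr 1
    push_cast
    ring
  · congr 1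
    ring
  · congr 1
    linear_combination ((ε' : ℤ) : ℂ) ^ k * u * c (k + 1) * units_sq ε'
  · congr 1
    ring
  · congr 1
    ring

/-- The basis of `M ⊗ U_r^ε'`, adapted to the action of `K`. -/
def tensorCharUBasis (r : ℂ) (ε' : ℤˣ) (b : Module.Basis ℕ ℂ M.V) :
    Module.Basis ℕ ℂ (M.tensor (charU p r ε')).V :=
  ((Rep.tensorBasis b (charUBasis p r ε')).reindex (Equiv.prodPUnit ℕ)).isUnitSMul
    (w := fun k => (((ε' : ℤ) : ℂ) * p.qsPow (-r)) ^ k)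
    fun k => (pow_ne_zero k (mul_ne_zero (units_ne ε') (p.qsPow_ne_zero _))).isUnit

theorem tensorCharUBasis_apply (r : ℂ) (ε' : ℤˣ) (b : Module.Basis ℕ ℂ M.V) (k : ℕ) :
    tensorCharUBasis r ε' b k = ((((ε' : ℤ) : ℂ) * p.qsPow (-r)) ^ k) •
      Rep.tmul M (charU p r ε') (b k) (charUBasis p r ε' ()) := by
  rw [tensorCharUBasis, Module.Basis.isUnitSMul_apply, Module.Basis.reindex_apply,
    Rep.tensorBasis_apply]
  rfl

/-- Here $\mathcal E_i$ acts as $\mathcal E_i\otimes\mathcal K_i$. The scalars of $\mathcal K_0$ and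
$\mathcal K_1$ on the line are inverse to each other, so rescaling by powers of the first removes
both. The resulting ladder data are those of the tensor product in the other order. -/
theorem IsLadder.tensor_charU {b : Module.Basis ℕ ℂ M.V} (hb : IsLadder M x ε u c b)
    (r : ℂ) (ε' : ℤˣ) :
    IsLadder (M.tensor (charU p r ε')) (((ε' : ℤ) : ℂ) * p.qsPow r * x) (ε' * ε) u c
      (tensorCharUBasis r ε' b) := by
  refine ⟨fun k => ?_, fun k => ?_, ?_, fun k => ?_, fun k => ?_, fun k => ?_⟩ <;>
  simp only [tensorCharUBasis_apply, map_smul, Rep.tensor_parity_tmul, Rep.tensor_E_tmul,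
    Rep.tensor_K_tmul, charU_parity, charU_E, charU_K0, charU_K1, hb.parity, hb.E0, hb.E1_zero,
    hb.E1_succ, hb.K0, hb.K1, LinearMap.zero_apply, map_zero, add_zero, smul_zero,
    LinearMap.smul_apply, smul_smul, mul_inv]
  · congr 1
    push_cast
    ring
  · congr 1
    ring
  · congr 1
    have h : ((ε' : ℤ) : ℂ) * p.qsPow (-r) * (((ε' : ℤ) : ℂ) * p.qsPow r) = 1 := by
      linear_combination units_sq ε' * p.qsPow r * p.qsPow (-r) + qsPow_mul_qsPow_neg p r
    linear_combination (((ε' : ℤ) : ℂ) * p.qsPow (-r)) ^ k * u * c (k + 1) * h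
  · congr 1
    rw [← inv_units_mul_qsPow, mul_inv]
    ring
  · congr 1
    ring

theorem clsU_mul_of_isLadder {N : Rep p} {b : Module.Basis ℕ ℂ M.V} (hb : IsLadder M x ε u c b)
    {b' : Module.Basis ℕ ℂ N.V} {x' : ℂ} {ε₁ : ℤˣ} (hb' : IsLadder N x' ε₁ u c b')
    (r : ℂ) (ε' : ℤˣ) (hx : ((ε' : ℤ) : ℂ) * p.qsPow r * x = x') (hε : ε' * ε = ε₁)
    (hM : M.InO) (hN : N.InO) : clsU p r ε' * cls M hM = cls N hN := by
  rw [clsU, ← cls_tensor]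
  exact (hb.charU_tensor r ε').cls_eq hb' _ _ hx hε rfl rfl

/-- The two orders of the tensor product have the same ladder data; this provides commutation
although the ring is not known to be commutative. -/
theorem clsU_commute_of_isLadder {b : Module.Basis ℕ ℂ M.V} (hb : IsLadder M x ε u c b)
    (r : ℂ) (ε' : ℤˣ) (hM : M.InO) : Commute (clsU p r ε') (cls M hM) := by
  rw [Commute, SemiconjBy, clsU, ← cls_tensor, ← cls_tensor]
  exact (hb.charU_tensor r ε').cls_eq (hb.tensor_charU r ε') _ _ rfl rfl rfl rfl

end Character

/-- A one-dimensional representation on which `E 0` and `E 1` act as zero is some `U_r^ε`. -/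
theorem exists_hom_charU {M : Rep p} (b : Module.Basis Unit ℂ M.V) (r : ℂ) (ε : ℤˣ)
    (hP : M.parity (b ()) = ((ε : ℤ) : ℂ) • b ()) (hE : ∀ i, M.E i (b ()) = 0)
    (hK0 : M.K 0 (b ()) = (((ε : ℤ) : ℂ) * p.qsPow (-r)) • b ())
    (hK1 : M.K 1 (b ()) = (((ε : ℤ) : ℂ) * p.qsPow r) • b ()) :
    ∃ f : Rep.Hom M (charU p r ε), Function.Bijective f.toLin := by
  let b' := charUBasis p r ε
  let f : Rep.Hom M (charU p r ε) := Rep.Hom.ofBasis b b'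
    (fun _ => by rw [hP, map_smul, b.constr_basis, charU_parity])
    (fun i _ => by rw [hE, map_zero, charU_E, LinearMap.zero_apply])
    (fun i _ => by
      fin_cases i
      · exact (congrArg _ hK0).trans (by rw [map_smul, b.constr_basis]; rfl)
      · exact (congrArg _ hK1).trans (by rw [map_smul, b.constr_basis]; rfl))
  refine ⟨f, ?_⟩
  have h : f.toLin = (b.equiv b' (Equiv.refl Unit)).toLinearMap :=
    b.ext fun k => by rw [Rep.Hom.ofBasis_apply]; simp
  rw [h]
  exact (b.equiv b' (Equiv.refl Unit)).bijective

theorem exists_hom_charU_tensor (p : QParam) {r r' r'' : ℂ} {ε ε' ε'' : ℤˣ} (hr : r + r' = r'')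
    (hε : ε * ε' = ε'') : ∃ f : Rep.Hom ((charU p r ε).tensor (charU p r' ε')) (charU p r'' ε''),
      Function.Bijective f.toLin := by
  subst hr hε
  let b := (Rep.tensorBasis (charUBasis p r ε) (charUBasis p r' ε')).reindex (Equiv.punitProd Unit)
  have hb : b () = Rep.tmul _ _ (charUBasis p r ε ()) (charUBasis p r' ε' ()) := by
    rw [Module.Basis.reindex_apply, Rep.tensorBasis_apply]
  refine exists_hom_charU b _ _ ?_ (fun i => ?_) ?_ ?_ <;>
  simp only [hb, Rep.tensor_parity_tmul, Rep.tensor_E_tmul,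
    Rep.tensor_K_tmul, charU_parity, charU_E, charU_K0, charU_K1, map_smul, LinearMap.smul_apply,
    LinearMap.zero_apply, map_zero, add_zero, smul_smul, neg_add, p.qsPow_add] <;>
  congr 1 <;> push_cast <;> ring

theorem clsU_mul (p : QParam) (r r' : ℂ) (ε ε' : ℤˣ) :
    clsU p r ε * clsU p r' ε' = clsU p (r + r') (ε * ε') := by
  obtain ⟨f, hf⟩ := exists_hom_charU_tensor p (r := r) (r' := r') (ε := ε) (ε' := ε') rfl rfl
  rw [clsU, clsU, ← cls_tensor]
  exact cls_eq_of_bijective _ _ f hf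

theorem clsU_zero_one (p : QParam) : clsU p 0 1 = 1 := by
  obtain ⟨f, hf⟩ := exists_hom_charU (p := p) (M := Rep.oneDim p 1 (fun _ => one_ne_zero) 1)
    (Module.Basis.singleton Unit ℂ) 0 1 rfl (fun _ => rfl)
    (by rw [neg_zero, p.qsPow_zero, Units.val_one, Int.cast_one, one_mul]; rfl)
    (by rw [p.qsPow_zero, Units.val_one, Int.cast_one, one_mul]; rfl)
  rw [← cls_trivial]
  exact (cls_eq_of_bijective _ _ f hf).symm

theorem clsU_commute (p : QParam) (r r' : ℂ) (ε ε' : ℤˣ) :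
    Commute (clsU p r ε) (clsU p r' ε') := by
  rw [Commute, SemiconjBy, clsU_mul, clsU_mul, add_comm, mul_comm]

theorem sigma_mul_clsU (p : QParam) (r : ℂ) (ε : ℤˣ) : sigma p * clsU p r ε = clsU p r (-ε) := by
  rw [sigma, clsU_mul, zero_add, neg_one_mul]

theorem sigma_mul_sigma (p : QParam) : sigma p * sigma p = 1 := by
  rw [sigma, clsU_mul, ← clsU_zero_one]
  simp

theorem sigma_mul_clsVerma (p : QParam) (s : ℂ) (ε : ℤˣ) (lam : ℂ) :
    sigma p * clsVerma p s ε lam = clsVerma p s (-ε) lam :=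
  clsU_mul_of_isLadder (verma_isLadder p s ε lam) (verma_isLadder p s (-ε) lam) 0 (-1)
    (by rw [p.qsPow_zero]; push_cast; ring) (neg_one_mul ε) _ _

/-! ### The geometric series $f_s$ -/

theorem clsU_commute_fSum (p : QParam) (r s : ℂ) (ε : ℤˣ) : Commute (clsU p r ε) (fSum p s) :=
  cls_commute_of_E_eq_zero _ _ (fun i => charU_E p r ε i)
    fun i => Rep.directSum_linHom_ext fun m v => by
      rw [Rep.directSum_E_incl, charU_E, LinearMap.zero_apply, LinearMap.zero_apply, map_zero]

/-- The terms with $m\ge1$ are the terms of the whole sum tensored with $U_{-2}^-$, whose class is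
$\sigma[U_{-2}]$. So a single shift of the index stands in for the summation of the series. -/
theorem fSum_eq_add (p : QParam) (s : ℂ) :
    fSum p s = clsU p (-s) 1 + sigma p * clsU p (-2) 1 * fSum p s := by
  have F : ∀ m : ℕ, ∃ f : Rep.Hom ((charU p (-2) (-1)).tensor (charU p (-s - 2 * m) ((-1) ^ m)))
      (charU p (-s - 2 * (m + 1 : ℕ)) ((-1) ^ (m + 1))), Function.Bijective f.toLin := fun m =>
    exists_hom_charU_tensor p (by push_cast; ring) (pow_succ' _ _).symm
  choose f hf using F
  obtain ⟨h, e⟩ := exists_cls_directSum_eq_mul (charU_inO p (-2) (-1))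
    (directSum_charU_inO p s) f hf
  have e2 := cls_directSum_eq_add (directSum_charU_inO p s) (charU_inO ..) h
  rw [e] at e2
  rw [sigma_mul_clsU]
  refine e2.trans (congrArg₂ (· + ·) ?_ rfl)
  change clsU p (-s - 2 * (0 : ℕ)) ((-1) ^ 0) = clsU p (-s) 1
  simp

theorem one_sub_mul_fSum (p : QParam) (s : ℂ) :
    (1 - sigma p * clsU p (-2) 1) * fSum p s = clsU p (-s) 1 := by
  rw [sub_mul, one_mul, sub_eq_iff_eq_add]
  exact fSum_eq_add p s

/-- As $[U_0]=1$, the recursion at $s=0$ makes $f_0$ a right inverse. It is also a left inverse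
because $f_0$ commutes with the classes $[U_r^{\pm}]$. -/
theorem isUnit_one_sub (p : QParam) : IsUnit (1 - sigma p * clsU p (-2) 1) := by
  have h := one_sub_mul_fSum p 0
  rw [neg_zero, clsU_zero_one] at h
  refine isUnit_iff_exists.2 ⟨fSum p 0, h, Eq.trans ?_ h⟩
  rw [sigma_mul_clsU]
  exact (((Commute.one_left _).sub_left (clsU_commute_fSum p (-2) 0 (-1))).eq).symm

theorem one_sub_commute_clsU (p : QParam) (r : ℂ) (ε : ℤˣ) :
    Commute (1 - sigma p * clsU p (-2) 1) (clsU p r ε) := by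
  rw [sigma_mul_clsU]
  exact (Commute.one_left _).sub_left (clsU_commute ..)

theorem commute_ringInverse {R : Type*} [Ring R] {a b : R} (h : Commute a b) (hb : IsUnit b) :
    Commute a (Ring.inverse b) := by
  obtain ⟨u, rfl⟩ := hb
  rw [Ring.inverse_unit]
  exact h.units_inv_right

theorem fSum_eq (p : QParam) (s : ℂ) :
    fSum p s = clsU p (-s) 1 * Ring.inverse (1 - sigma p * clsU p (-2) 1) := by
  have hu := isUnit_one_sub p
  rw [(commute_ringInverse (one_sub_commute_clsU p (-s) 1).symm hu).eq, ← one_sub_mul_fSum p s,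
    Ring.inverse_mul_cancel_left _ _ hu]

theorem isUnit_clsU (p : QParam) (r : ℂ) : IsUnit (clsU p r 1) := by
  refine isUnit_iff_exists.2 ⟨clsU p (-r) 1, ?_, ?_⟩ <;> simp [clsU_mul, clsU_zero_one]

theorem isUnit_fSum (p : QParam) (s : ℂ) : IsUnit (fSum p s) := by
  rw [fSum_eq]
  exact (isUnit_clsU p _).mul (isUnit_one_sub p).ringInverse

/-! ### Finite-dimensional quotients of Verma type modules -/

theorem qs_pow_ne_one (p : QParam) {n : ℕ} (hn : 0 < n) : (p.qs ^ 2) ^ n ≠ 1 := by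
  intro h
  apply p.generic' (4 * n) (by omega)
  -- From $q^2=-q_*^2$ one gets $q^4=q_*^4$, so a relation $q_*^{2n}=1$ would give $q^{4n}=1$.
  have e : p.q ^ (4 * n) = ((p.q ^ 2) ^ 2) ^ n := by rw [← pow_mul, ← pow_mul]; ring_nf
  rw [e, q_sq, neg_sq, ← pow_mul, mul_comm, pow_mul, ← pow_mul, pow_mul, h, one_pow]

theorem qsNum_natCast_ne_zero (p : QParam) {n : ℕ} (hn : 0 < n) : p.qsNum n ≠ 0 := by
  rw [QParam.qsNum, p.qsPow_neg, p.qsPow_natCast]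
  refine div_ne_zero (fun h => qs_pow_ne_one p hn ?_) p.qs_sub_inv_ne
  have h0 : p.qs ^ n ≠ 0 := pow_ne_zero _ p.qs_ne_zero
  rw [sub_eq_zero, eq_comm, inv_eq_iff_eq_inv, ← mul_eq_one_iff_eq_inv₀ h0] at h
  rw [← h, ← pow_mul, mul_comm, pow_mul, sq]

theorem qsNum_neg (p : QParam) (x : ℂ) : p.qsNum (-x) = -p.qsNum x := by
  rw [QParam.qsNum, QParam.qsNum, neg_neg]
  ring

section Finite

variable (p : QParam) (s : ℕ) (ε : ℤˣ) (lam : ℂ)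

/-- The vector `e_{l-k}`, `s = 2l`, of `W_s^ε(λ)`, zero for `k > s`. -/
def finVec (k : ℕ) : (finDim p s ε lam).V := finKet s k

/-- The basis of `W_s^ε(λ)`. -/
def finBasis : Module.Basis (Fin (s + 1)) ℂ (finDim p s ε lam).V := Finsupp.basisSingleOne

theorem finBasis_apply (k : Fin (s + 1)) : finBasis p s ε lam k = finVec p s ε lam k :=
  (congrFun (Finsupp.coe_basisSingleOne (R := ℂ)) k).trans (ket_eq_finKet s k)

theorem finVec_eq_zero {k : ℕ} (h : s < k) : finVec p s ε lam k = 0 := finKet_eq_zero h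

theorem finDim_E0 (k : ℕ) : (finDim p s ε lam).E 0 (finVec p s ε lam k) =
    (lam * p.qsNum ((s : ℂ) - k)) • finVec p s ε lam (k + 1) := by
  by_cases h : k < s + 1
  · have e : finKet s k = ket (⟨k, h⟩ : Fin (s + 1)) := by rw [finKet, dif_pos h]
    exact (congrArg (finDown p s lam) e).trans (linearCombination_ket _ _)
  · rw [finVec_eq_zero p s ε lam (by omega), finVec_eq_zero p s ε lam (by omega), map_zero,
      smul_zero]

theorem finDim_E1 {k : ℕ} (h : k ≤ s) : (finDim p s ε lam).E 1 (finVec p s ε lam k) =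
    (lam * p.qsNum k) • finVec p s ε lam (k - 1) := by
  have e : finKet s k = ket (⟨k, by omega⟩ : Fin (s + 1)) := by rw [finKet, dif_pos]
  exact (congrArg (finUp p s lam) e).trans (linearCombination_ket _ _)

theorem finDim_parity (k : ℕ) : (finDim p s ε lam).parity (finVec p s ε lam k) =
    (((ε : ℤ) : ℂ) * (-1) ^ k) • finVec p s ε lam k :=
  diag_finKet s (fun k => ((ε : ℤ) : ℂ) * (-1) ^ k) k

theorem finDim_K0 (k : ℕ) : (finDim p s ε lam).K 0 (finVec p s ε lam k) =
    ((((ε : ℤ) : ℂ) * p.qsPow s)⁻¹ * p.q ^ (2 * k)) • finVec p s ε lam k := by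
  refine (diag_finKet s (fun k => (finEig p s ε k)⁻¹) k).trans ?_
  rw [finEig_eq, mul_inv, inv_inv]
  rfl

theorem finDim_K1 (k : ℕ) : (finDim p s ε lam).K 1 (finVec p s ε lam k) =
    (((ε : ℤ) : ℂ) * p.qsPow s * (p.q ^ (2 * k))⁻¹) • finVec p s ε lam k := by
  refine (diag_finKet s (fun k => finEig p s ε k) k).trans ?_
  rw [finEig_eq]
  rfl

/-- The product `[s] [s - 1] ⋯ [s - k + 1]` of quantum numbers. -/
def qsFalling (k : ℕ) : ℂ := ∏ j ∈ Finset.range k, p.qsNum ((s : ℂ) - j)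

theorem qsFalling_ne_zero {k : ℕ} (h : k ≤ s) : qsFalling p s k ≠ 0 := by
  refine Finset.prod_ne_zero_iff.2 fun j hj => ?_
  have hj := Finset.mem_range.1 hj
  rw [← Nat.cast_sub (by omega)]
  exact qsNum_natCast_ne_zero p (by omega)

/-- The projection of the Verma type module onto its finite-dimensional quotient. -/
def vermaToFin : Rep.Hom (verma p s ε lam) (finDim p s ε lam) :=
  have hb := verma_isLadder p s ε lam
  have key := fun k => (vermaBasis p s ε lam).constr_basis ℂ
    (fun k => qsFalling p s k • finVec p s ε lam k) k
  Rep.Hom.ofBasis (vermaBasis p s ε lam) (fun k => qsFalling p s k • finVec p s ε lam k)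
    (fun k => by rw [hb.parity, map_smul, key, map_smul, finDim_parity, smul_comm])
    (fun i k => by
      fin_cases i
      · change (vermaBasis p s ε lam).constr ℂ _ ((verma p s ε lam).E 0 _) =
          (finDim p s ε lam).E 0 _
        -- On $W_s$ the operator $\mathcal E_0$ produces the extra factor $[s-k]_{q_*}$, which is
        -- the next factor of the falling product.
        rw [hb.E0, map_smul, key, map_smul, finDim_E0, smul_smul, smul_smul, qsFalling,
          Finset.prod_range_succ, ← qsFalling]
        congr 1
        ring
      · change (vermaBasis p s ε lam).constr ℂ _ ((verma p s ε lam).E 1 _) =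
          (finDim p s ε lam).E 1 _
        cases k with
        | zero =>
          rw [hb.E1_zero, map_zero, map_smul, finDim_E1 _ _ _ _ (Nat.zero_le s), Nat.cast_zero,
            qsNum_zero, mul_zero, zero_smul, smul_zero]
        | succ k =>
          have hc : vermaCoeff p s (k + 1) = p.qsNum ((k + 1 : ℕ) : ℂ) * p.qsNum ((s : ℂ) - k) := by
            rw [vermaCoeff]
            congr 2
            push_cast
            ring
          rw [hb.E1_succ, map_smul, key, map_smul]
          rcases lt_trichotomy k s with h | h | h
          · rw [finDim_E1 _ _ _ _ h, smul_smul, smul_smul, hc, qsFalling, qsFalling,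
              Finset.prod_range_succ, Nat.succ_eq_add_one, Nat.add_sub_cancel]
            congr 1
            ring
          -- At $k=s$ the image of $|s+1\rangle$ is zero, and the coefficient of $\mathcal
          -- E_1|s+1\rangle$ vanishes too because it contains $[0]_{q_*}$.
          · rw [hc, h, sub_self, qsNum_zero, finVec_eq_zero p s ε lam (Nat.lt_succ_self s)]
            simp
          · rw [finVec_eq_zero p s ε lam h, finVec_eq_zero p s ε lam (h.trans (Nat.lt_succ_self k))]
            simp)
    (fun i k => by
      fin_cases i
      · change (vermaBasis p s ε lam).constr ℂ _ ((verma p s ε lam).K 0 _) =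
          (finDim p s ε lam).K 0 _
        rw [hb.K0, map_smul, key, map_smul, finDim_K0, smul_comm]
      · change (vermaBasis p s ε lam).constr ℂ _ ((verma p s ε lam).K 1 _) =
          (finDim p s ε lam).K 1 _
        rw [hb.K1, map_smul, key, map_smul, finDim_K1, smul_comm])

theorem vermaToFin_apply (k : ℕ) : (vermaToFin p s ε lam).toLin (vermaBasis p s ε lam k) =
    qsFalling p s k • finVec p s ε lam k :=
  (vermaBasis p s ε lam).constr_basis ℂ (fun k => qsFalling p s k • finVec p s ε lam k) k

/-- The vectors `|k⟩`, `k > s`, span a submodule of Verma type. -/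
theorem verma_isLadder_shift : IsLadder (verma p s ε lam)
    ((((ε * (-1) ^ (s + 1) : ℤˣ) : ℤ) : ℂ) * p.qsPow (-s - 2)) (ε * (-1) ^ (s + 1)) lam
    (vermaCoeff p (-s - 2)) (fun k => vermaBasis p s ε lam (k + (s + 1))) := by
  have hb := verma_isLadder p s ε lam
  have hc : ∀ k : ℕ, vermaCoeff p s (k + (s + 1)) = vermaCoeff p (-s - 2) k := by
    intro k
    rw [vermaCoeff, vermaCoeff]
    -- Both coefficients equal $-[k]_{q_*}[k+s+1]_{q_*}$.
    have e1 : (s : ℂ) - (k + (s + 1) : ℕ) + 1 = -(k : ℂ) := by push_cast; ring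
    have e2 : -(s : ℂ) - 2 - k + 1 = -((k + (s + 1) : ℕ) : ℂ) := by push_cast; ring
    rw [e1, e2, qsNum_neg, qsNum_neg]
    ring
  -- The sign comes from $q^{-2(s+1)}=(-1)^{s+1}q_*^{-2(s+1)}$. It coincides with the parity sign of
  -- $|s+1\rangle$, so one sign $\varepsilon(-1)^{s+1}$ serves for both.
  have hx : (((ε * (-1) ^ (s + 1) : ℤˣ) : ℤ) : ℂ) * p.qsPow (-s - 2) =
      ((ε : ℤ) : ℂ) * p.qsPow s * (p.q ^ (2 * (s + 1)))⁻¹ := by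
    have e := qsPow_sub_two_mul p s (s + 1)
    have e3 : (s : ℂ) - 2 * ((s + 1 : ℕ) : ℂ) = -s - 2 := by push_cast; ring
    rw [e3] at e
    rw [mul_assoc, ← e]
    push_cast
    ring
  rw [hx]
  refine ⟨fun k => ?_, fun k => ?_, ?_, fun k => ?_, fun k => ?_, fun k => ?_⟩
  · rw [hb.parity]
    congr 1
    push_cast
    ring
  · rw [hb.E0, add_right_comm]
  · rw [zero_add, hb.E1_succ, ← zero_add (s + 1), hc, vermaCoeff_zero, mul_zero, zero_smul]
  · rw [add_right_comm, hb.E1_succ, ← hc, add_right_comm]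
  · rw [hb.K0]
    congr 1
    rw [mul_inv _ (_⁻¹), inv_inv]
    ring
  · rw [hb.K1]
    congr 1
    rw [mul_add 2 k, pow_add, mul_inv]
    ring

/-- The vectors $|k\rangle$ with $k>s$ form the kernel of the projection onto $W_s$, because the
falling products $[s]\cdots[s-k+1]$ are nonzero for $k\le s$ ($q_*^2$ is not a root of unity).
Dividing by these products gives the linear section. -/
theorem clsVerma_eq_add : clsVerma p s ε lam =
    clsW p s ε lam + clsVerma p (-s - 2) (ε * (-1) ^ (s + 1)) lam := by
  have hb' := verma_isLadder p (-s - 2) (ε * (-1) ^ (s + 1)) lam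
  have hv := verma_isLadder_shift p s ε lam
  rw [add_comm]
  refine cls_eq_add_of_basis (verma_inO ..) (verma_inO ..) (finDim_inO ..) (vermaBasis ..)
    (vermaBasis ..) (finBasis ..) (hb'.hom hv) (vermaToFin p s ε lam)
    ((vermaBasis p s ε lam).constr ℂ fun k =>
      if k ≤ s then 0 else vermaBasis p (-s - 2) (ε * (-1) ^ (s + 1)) lam (k - (s + 1)))
    ((finBasis p s ε lam).constr ℂ fun k => (qsFalling p s k)⁻¹ • vermaBasis p s ε lam k)
    (fun k => ?_) (fun k => ?_) (fun k => ?_)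
  · rw [hb'.hom_apply hv, Module.Basis.constr_basis, if_neg (by omega), Nat.add_sub_cancel]
  · rw [Module.Basis.constr_basis, map_smul, vermaToFin_apply, smul_smul, finBasis_apply,
      inv_mul_cancel₀ (qsFalling_ne_zero p s (Nat.lt_succ_iff.1 k.2)), one_smul]
  · rw [Module.Basis.constr_basis, vermaToFin_apply]
    split_ifs with h
    · have e : finVec p s ε lam k = finBasis p s ε lam ⟨k, by omega⟩ := by rw [finBasis_apply]
      rw [e, map_smul, Module.Basis.constr_basis, smul_smul,
        mul_inv_cancel₀ (qsFalling_ne_zero p s h), one_smul, map_zero, zero_add]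
    · rw [hb'.hom_apply hv, finVec_eq_zero p s ε lam (by omega), smul_zero, map_zero, add_zero,
        Nat.sub_add_cancel (by omega)]

end Finite

theorem clsW_zero (p : QParam) (lam : ℂ) : clsW p 0 1 lam = 1 := by
  let b := (finBasis p 0 1 lam).reindex (Equiv.ofUnique (Fin 1) Unit)
  have hb : b () = finVec p 0 1 lam 0 := by
    rw [Module.Basis.reindex_apply, finBasis_apply]
    rfl
  obtain ⟨f, hf⟩ := exists_hom_charU (p := p) b 0 1 (by rw [hb, finDim_parity, pow_zero, mul_one])
    (fun i => by
      rw [hb]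
      fin_cases i
      · exact (finDim_E0 p 0 1 lam 0).trans
          (by rw [finVec_eq_zero p 0 1 lam (Nat.lt_succ_self 0), smul_zero])
      · exact (finDim_E1 p 0 1 lam le_rfl).trans
          (by rw [Nat.cast_zero, qsNum_zero, mul_zero, zero_smul]))
    (by rw [hb, finDim_K0]; simp [p.qsPow_zero]) (by rw [hb, finDim_K1]; simp [p.qsPow_zero])
  rw [← clsU_zero_one]
  exact cls_eq_of_bijective _ _ f hf

/-! ### The direct sum of twisted Verma type modules -/

/-- `[⨁ U_{-s-2m} ⊗ 𝒲_s^{(-1)^m}(λ)] = [𝒲_s^+(λ)] f_s`. -/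
theorem exists_cls_directSum_charU_tensor_verma (p : QParam) (s lam : ℂ) :
    ∃ h : (Rep.directSum fun m : ℕ =>
        (charU p (-s - 2 * m) 1).tensor (verma p s ((-1) ^ m) lam)).InO,
      cls _ h = clsVerma p s 1 lam * fSum p s := by
  -- The sign $(-1)^m$ may sit on either tensor factor: $U_r\otimes\mathcal W_s^{(-1)^m}$ and
  -- $\mathcal W_s^+\otimes U_r^{(-1)^m}$ have the same ladder data.
  have e : ∀ m : ℕ, ((((1 : ℤˣ) : ℤ) : ℂ) * p.qsPow (-s - 2 * m) *
      (((((-1 : ℤˣ) ^ m : ℤˣ) : ℤ) : ℂ) * p.qsPow s)) =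
      (((((-1 : ℤˣ) ^ m : ℤˣ) : ℤ) : ℂ) * p.qsPow (-s - 2 * m) *
        (((1 : ℤˣ) : ℤ) * p.qsPow s)) := fun m => by
    push_cast
    ring
  have h1 := fun m : ℕ => (verma_isLadder p s ((-1) ^ m) lam).charU_tensor (-s - 2 * m) 1
  have h2 := fun m : ℕ => (verma_isLadder p s 1 lam).tensor_charU (-s - 2 * m) ((-1) ^ m)
  simp only [e, mul_comm (1 : ℤˣ)] at h1
  exact exists_cls_directSum_eq_mul (verma_inO p s 1 lam) (directSum_charU_inO p s)
    (fun m => (h2 m).hom (h1 m)) fun m => (h2 m).hom_bijective (h1 m)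

/-! ### Commutation with powers and oscillator coefficients -/

/-- Moving $C$ through a power of $X$ collects the geometric sum $d_k=(1+t+\dots+t^{k-1})d_1$. It is
applied with $X=\mathcal E_0$ and $C$ one of the two summands of $\Delta(\mathcal E_1)$. -/
theorem mul_pow_of_q_commute {A : Type*} [Ring A] [Algebra ℂ A] {C X : A} {t : ℂ} {d : ℕ → ℂ}
    (h : C * X = t • (X * C) + d 1 • 1) (h0 : d 0 = 0) (hd : ∀ k, d (k + 1) = t * d k + d 1)
    (k : ℕ) : C * X ^ (k + 1) = t ^ (k + 1) • (X ^ (k + 1) * C) + d (k + 1) • X ^ k := by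
  induction k with
  | zero => simp [h]
  | succ k ih =>
    rw [pow_succ X (k + 1), ← mul_assoc, ih, add_mul, smul_mul_assoc, smul_mul_assoc, mul_assoc, h,
      ← pow_succ, hd (k + 1), mul_add, mul_smul_comm, mul_smul_comm, mul_one, pow_succ t (k + 1),
      ← mul_assoc, ← pow_succ]
    -- The geometric sum can be extended at either end; the hypothesis does it at one end, the
    -- induction step at the other.
    have e : ∀ k, t * d k + d 1 = t ^ k * d 1 + d k := by
      intro k
      induction k with
      | zero => simp [h0]
      | succ k ih => rw [hd k, pow_succ]; linear_combination t * ih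
    rw [e]
    module

theorem fockPlusCoeff_succ (p : QParam) (k : ℕ) :
    fockPlusCoeff p (k + 1) = -(p.q ^ 2)⁻¹ * fockPlusCoeff p k + fockPlusCoeff p 1 := by
  have hq := p.q_ne_zero
  have hq1 := p.q_add_inv_ne
  simp only [fockPlusCoeff, pow_succ, mul_add]
  field_simp
  ring

theorem fockMinusCoeff_succ (p : QParam) (k : ℕ) :
    fockMinusCoeff p (k + 1) = -p.q ^ 2 * fockMinusCoeff p k + fockMinusCoeff p 1 := by
  have hq := p.q_ne_zero
  have hq1 := p.q_add_inv_ne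
  simp only [fockMinusCoeff, pow_succ, mul_add]
  field_simp
  ring

/-- Since $-q^2=q_*^2$, passing from $q$ to $q_*$ absorbs the signs of the superalgebra. -/
theorem neg_one_pow_mul_q_pow (p : QParam) (k : ℕ) :
    (-1) ^ k * p.q ^ (2 * k) = (p.qs ^ 2) ^ k := by
  rw [pow_mul, ← mul_pow, q_sq]
  ring

theorem neg_one_pow_mul_inv_q_pow (p : QParam) (k : ℕ) :
    (-1) ^ k * (p.q ^ (2 * k))⁻¹ = ((p.qs ^ 2) ^ k)⁻¹ := by
  rw [← neg_one_pow_mul_q_pow, mul_inv, ← inv_pow (-1 : ℂ), inv_neg_one]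

/-- The numerator is $q_*^{-2k}-1$. Nonvanishing is what makes the projection `towerProj` hit every
basis vector of its target. -/
theorem fockPlusCoeff_ne_zero (p : QParam) {k : ℕ} (hk : 0 < k) : fockPlusCoeff p k ≠ 0 := by
  rw [fockPlusCoeff, neg_one_pow_mul_inv_q_pow]
  refine div_ne_zero (fun h => qs_pow_ne_one p hk ?_) (pow_ne_zero _ p.q_add_inv_ne)
  rwa [sub_eq_zero, inv_eq_one] at h

/-- The product of the shifted oscillator coefficients is the coefficient of the Verma module. -/
theorem fockCoeff_eq_vermaCoeff (p : QParam) (s : ℂ) (k : ℕ) :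
    p.qsPow (s + 1) * fockPlusCoeff p k + p.qsPow (-s - 1) * fockMinusCoeff p k =
      vermaCoeff p s k := by
  -- Because $q=iq_*$, one has $q+q^{-1}=i(q_*-q_*^{-1})$; this reconciles the denominators of the
  -- oscillator coefficients and of the quantum numbers.
  have e : (p.q + p.q⁻¹) ^ 2 = -(p.qs - p.qs⁻¹) ^ 2 := by
    have h1 : p.q⁻¹ ^ 2 = -p.qs⁻¹ ^ 2 := by rw [inv_pow, q_sq, inv_neg, inv_pow]
    linear_combination p.q_sq + h1 + 2 * mul_inv_cancel₀ p.q_ne_zero -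
      2 * mul_inv_cancel₀ p.qs_ne_zero
  have hS := p.qsPow_ne_zero s
  have hQ := p.qs_ne_zero
  have hT : p.qs ^ k ≠ 0 := pow_ne_zero _ hQ
  have hd := p.qs_sub_inv_ne
  have e1 : p.qsPow (s + 1) = p.qsPow s * p.qs := p.qsPow_add s 1
  have e2 : p.qsPow (-s - 1) = (p.qsPow s)⁻¹ * p.qs⁻¹ := by
    rw [← mul_inv, ← e1, ← p.qsPow_neg]; ring_nf
  have e3 : p.qsPow (s - k + 1) = p.qsPow s * (p.qs ^ k)⁻¹ * p.qs := by
    rw [sub_eq_add_neg, p.qsPow_add, p.qsPow_add, p.qsPow_neg, p.qsPow_natCast]; rfl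
  have e4 : (p.qs ^ 2) ^ k = p.qs ^ k * p.qs ^ k := by rw [← pow_mul, ← pow_add]; ring_nf
  rw [fockPlusCoeff, fockMinusCoeff, neg_one_pow_mul_q_pow, neg_one_pow_mul_inv_q_pow, e, vermaCoeff,
    QParam.qsNum, QParam.qsNum, p.qsPow_neg, p.qsPow_neg, e1, e2, e3, e4, p.qsPow_natCast]
  rw [div_neg, div_neg, mul_neg, mul_neg, ← mul_div_assoc, ← mul_div_assoc, div_mul_div_comm,
    ← neg_add, ← add_div, ← neg_div]
  congr 1
  · field_simp
    ring
  · exact sq _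

/-! ### The tensor product of the two Fock modules -/

section Oscillator

variable (p : QParam) (mu nu : ℂ)

/-- The representation `ρ₊(μ) ⊗ ρ₋(ν)`. -/
abbrev rhoTensor : Rep p := (rhoPlus p mu).tensor (rhoMinus p nu)

/-- The vector `|a⟩ ⊗ |b⟩` of `ρ₊(μ) ⊗ ρ₋(ν)`. -/
def oscVec (a b : ℕ) : (rhoTensor p mu nu).V :=
  Rep.tmul _ _ (rhoPlusBasis p mu a) (rhoMinusBasis p nu b)

/-- The basis `|a⟩ ⊗ |b⟩` of `ρ₊(μ) ⊗ ρ₋(ν)`. -/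
def oscBasis : Module.Basis (ℕ × ℕ) ℂ (rhoTensor p mu nu).V :=
  Rep.tensorBasis (rhoPlusBasis p mu) (rhoMinusBasis p nu)

theorem oscBasis_apply (k : ℕ × ℕ) : oscBasis p mu nu k = oscVec p mu nu k.1 k.2 :=
  Rep.tensorBasis_apply _ _ _

theorem constr_oscVec {W : Type} [AddCommGroup W] [Module ℂ W] (F : ℕ × ℕ → W) (a b : ℕ) :
    (oscBasis p mu nu).constr ℂ F (oscVec p mu nu a b) = F (a, b) := by
  rw [← oscBasis_apply p mu nu (a, b), Module.Basis.constr_basis]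

theorem osc_E0 (a b : ℕ) : (rhoTensor p mu nu).E 0 (oscVec p mu nu a b) =
    (mu * p.q ^ (2 * b)) • oscVec p mu nu (a + 1) b +
      ((-1) ^ a * nu) • oscVec p mu nu a (b + 1) := by
  rw [oscVec, Rep.tensor_E_tmul, (rhoPlus_isLadder p mu).E0, (rhoMinus_isLadder p nu).E0,
    (rhoPlus_isLadder p mu).parity, (rhoMinus_isLadder p nu).K0]
  simp only [map_smul, LinearMap.smul_apply, smul_smul, oscVec]
  simp [mul_comm]

theorem osc_parity (a b : ℕ) : (rhoTensor p mu nu).parity (oscVec p mu nu a b) =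
    (-1 : ℂ) ^ (a + b) • oscVec p mu nu a b := by
  rw [oscVec, Rep.tensor_parity_tmul, (rhoPlus_isLadder p mu).parity,
    (rhoMinus_isLadder p nu).parity]
  simp only [map_smul, LinearMap.smul_apply, smul_smul, pow_add]
  simp [mul_comm]

theorem osc_K0 (a b : ℕ) : (rhoTensor p mu nu).K 0 (oscVec p mu nu a b) =
    p.q ^ (2 * (a + b)) • oscVec p mu nu a b := by
  rw [oscVec, Rep.tensor_K_tmul, (rhoPlus_isLadder p mu).K0, (rhoMinus_isLadder p nu).K0]
  simp only [map_smul, LinearMap.smul_apply, smul_smul, mul_add, pow_add]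
  simp [mul_comm]

theorem osc_K1 (a b : ℕ) : (rhoTensor p mu nu).K 1 (oscVec p mu nu a b) =
    (p.q ^ (2 * (a + b)))⁻¹ • oscVec p mu nu a b := by
  rw [oscVec, Rep.tensor_K_tmul, (rhoPlus_isLadder p mu).K1, (rhoMinus_isLadder p nu).K1]
  simp only [map_smul, LinearMap.smul_apply, smul_smul, mul_add, pow_add]
  simp [mul_comm]

/-- The summand `E₁ ⊗ K₁` of the action of `E₁`. -/
def oscLeft : Module.End ℂ (rhoTensor p mu nu).V := (oscBasis p mu nu).constr ℂ fun k =>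
  -- The truncated subtraction is harmless at 0, where the coefficient vanishes.
  (mu * fockPlusCoeff p k.1 * (p.q ^ (2 * k.2))⁻¹) • oscVec p mu nu (k.1 - 1) k.2

/-- The summand `(-1)^{|·|} ⊗ E₁` of the action of `E₁`. -/
def oscRight : Module.End ℂ (rhoTensor p mu nu).V := (oscBasis p mu nu).constr ℂ fun k =>
  ((-1) ^ k.1 * (nu * fockMinusCoeff p k.2)) • oscVec p mu nu k.1 (k.2 - 1)

theorem oscLeft_apply (a b : ℕ) : oscLeft p mu nu (oscVec p mu nu a b) =
    (mu * fockPlusCoeff p a * (p.q ^ (2 * b))⁻¹) • oscVec p mu nu (a - 1) b :=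
  constr_oscVec ..

theorem oscRight_apply (a b : ℕ) : oscRight p mu nu (oscVec p mu nu a b) =
    ((-1) ^ a * (nu * fockMinusCoeff p b)) • oscVec p mu nu a (b - 1) :=
  constr_oscVec ..

theorem osc_E1 : (rhoTensor p mu nu).E 1 = oscLeft p mu nu + oscRight p mu nu := by
  refine (oscBasis p mu nu).ext fun ⟨a, b⟩ => ?_
  rw [oscBasis_apply, LinearMap.add_apply, oscLeft_apply, oscRight_apply, oscVec, Rep.tensor_E_tmul,
    (rhoPlus_isLadder p mu).parity, (rhoMinus_isLadder p nu).K1]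
  congr 1
  · cases a with
    | zero =>
      rw [(rhoPlus_isLadder p mu).E1_zero, fockPlusCoeff_zero, mul_zero, zero_mul, zero_smul,
        map_zero, LinearMap.zero_apply]
    | succ a =>
      rw [(rhoPlus_isLadder p mu).E1_succ]
      simp only [map_smul, LinearMap.smul_apply, smul_smul, oscVec, Nat.add_sub_cancel]
      congr 1
      ring
  · cases b with
    | zero =>
      rw [(rhoMinus_isLadder p nu).E1_zero, fockMinusCoeff_zero, mul_zero, mul_zero, zero_smul,
        map_zero]
    | succ b =>
      rw [(rhoMinus_isLadder p nu).E1_succ]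
      simp only [map_smul, LinearMap.smul_apply, smul_smul, oscVec, Nat.add_sub_cancel]
      congr 1
      push_cast
      ring

/-- Against $\mathcal E_0\otimes\mathcal K_0$ the Fock recursion gives the factor $-q^{-2}$ and a
scalar, as $\mathcal K_0\mathcal K_1=1$ on $\rho_-$. Against the parity term, the sign rule and
$\mathcal K_1\mathcal E_0=q^{-2}\mathcal E_0\mathcal K_1$ give the same factor $-q^{-2}$ and no
scalar. The coincidence of the two factors is what yields a relation with all of $\mathcal E_0$. -/
theorem oscLeft_mul_E0 : oscLeft p mu nu * (rhoTensor p mu nu).E 0 =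
    (-(p.q ^ 2)⁻¹) • ((rhoTensor p mu nu).E 0 * oscLeft p mu nu) +
      (mu ^ 2 * fockPlusCoeff p 1) • 1 := by
  have hq := p.q_ne_zero
  refine (oscBasis p mu nu).ext fun ⟨a, b⟩ => ?_
  have h := fockPlusCoeff_succ p a
  simp only [oscBasis_apply, Module.End.mul_apply, LinearMap.add_apply, LinearMap.smul_apply,
    Module.End.one_apply, osc_E0, oscLeft_apply, map_add, map_smul, smul_add, smul_smul, h]
  cases a with
  | zero =>
    simp only [fockPlusCoeff_zero, Nat.add_sub_cancel]
    match_scalars <;> field_simp <;> ring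
  | succ a =>
    simp only [Nat.add_sub_cancel, pow_succ, mul_add]
    match_scalars <;> field_simp

/-- The mirror image: the scalar now comes from $\rho_-$, and the common factor is $-q^2$. -/
theorem oscRight_mul_E0 : oscRight p mu nu * (rhoTensor p mu nu).E 0 =
    (-p.q ^ 2) • ((rhoTensor p mu nu).E 0 * oscRight p mu nu) +
      (nu ^ 2 * fockMinusCoeff p 1) • 1 := by
  refine (oscBasis p mu nu).ext fun ⟨a, b⟩ => ?_
  have h := fockMinusCoeff_succ p b
  have h1 := neg_one_pow_sq a
  simp only [oscBasis_apply, Module.End.mul_apply, LinearMap.add_apply, LinearMap.smul_apply,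
    Module.End.one_apply, osc_E0, oscRight_apply, map_add, map_smul, smul_add, smul_smul, h]
  cases b with
  | zero =>
    simp only [fockMinusCoeff_zero, Nat.add_sub_cancel]
    match_scalars
    · ring
    · linear_combination (nu ^ 2 * fockMinusCoeff p 1) * h1
    · ring
  | succ b =>
    simp only [Nat.add_sub_cancel, pow_succ, mul_add]
    match_scalars
    · ring
    · linear_combination (nu ^ 2 * fockMinusCoeff p 1) * h1

/-- The vector `E₀ ^ k (|m⟩ ⊗ |0⟩)`. -/
def towerVec (k m : ℕ) : (rhoTensor p mu nu).V :=
  ((rhoTensor p mu nu).E 0 ^ k) (oscVec p mu nu m 0)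

theorem tower_E0 (k m : ℕ) :
    (rhoTensor p mu nu).E 0 (towerVec p mu nu k m) = towerVec p mu nu (k + 1) m := by
  rw [towerVec, towerVec, pow_succ', Module.End.mul_apply]

theorem tower_parity (k m : ℕ) : (rhoTensor p mu nu).parity (towerVec p mu nu k m) =
    (-1 : ℂ) ^ (k + m) • towerVec p mu nu k m := by
  induction k with
  | zero => exact (osc_parity p mu nu m 0).trans (by rw [zero_add, add_zero]; rfl)
  | succ k ih =>
    have h := LinearMap.congr_fun ((rhoTensor p mu nu).parity_E 0) (towerVec p mu nu k m)
    rw [Module.End.mul_apply, LinearMap.neg_apply, Module.End.mul_apply, ih, map_smul,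
      tower_E0] at h
    rw [h, add_right_comm, pow_succ, mul_neg_one, neg_smul]

theorem tower_K0 (k m : ℕ) : (rhoTensor p mu nu).K 0 (towerVec p mu nu k m) =
    p.q ^ (2 * (k + m)) • towerVec p mu nu k m := by
  induction k with
  | zero => exact (osc_K0 p mu nu m 0).trans (by rw [zero_add, add_zero]; rfl)
  | succ k ih =>
    have h := LinearMap.congr_fun ((rhoTensor p mu nu).K_E 0 0) (towerVec p mu nu k m)
    have c : p.q ^ cartan 0 0 = p.q ^ 2 := by simp only [cartan]; norm_cast
    rw [Module.End.mul_apply, LinearMap.smul_apply, Module.End.mul_apply, ih, map_smul,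
      tower_E0, c, smul_smul] at h
    rw [h]
    congr 1
    ring

theorem tower_K1 (k m : ℕ) : (rhoTensor p mu nu).K 1 (towerVec p mu nu k m) =
    (p.q ^ (2 * (k + m)))⁻¹ • towerVec p mu nu k m := by
  induction k with
  | zero => exact (osc_K1 p mu nu m 0).trans (by rw [zero_add, add_zero]; rfl)
  | succ k ih =>
    have h := LinearMap.congr_fun ((rhoTensor p mu nu).K_E 1 0) (towerVec p mu nu k m)
    have c : p.q ^ cartan 1 0 = (p.q ^ 2)⁻¹ := by
      have : cartan 1 0 = -2 := rfl
      rw [this, zpow_neg]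
      norm_cast
    rw [Module.End.mul_apply, LinearMap.smul_apply, Module.End.mul_apply, ih, map_smul,
      tower_E0, c, smul_smul, ← mul_inv] at h
    rw [h]
    congr 2
    ring

theorem tower_E1_zero (m : ℕ) : (rhoTensor p mu nu).E 1 (towerVec p mu nu 0 m) =
    (mu * fockPlusCoeff p m) • towerVec p mu nu 0 (m - 1) := by
  have h : towerVec p mu nu 0 m = oscVec p mu nu m 0 := rfl
  rw [h, osc_E1, LinearMap.add_apply, oscLeft_apply, oscRight_apply, fockMinusCoeff_zero]
  simp [towerVec]

/-- Each half of $\mathcal E_1$ is moved through $\mathcal E_0^{k+1}$. What then acts on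
$|m\rangle\otimes|0\rangle$ is zero for the right half and lowers $m$ for the left half, so the
$\mathcal E_0$-orbits are filtered by $m$. -/
theorem tower_E1_succ (k m : ℕ) : (rhoTensor p mu nu).E 1 (towerVec p mu nu (k + 1) m) =
    (mu ^ 2 * fockPlusCoeff p (k + 1) + nu ^ 2 * fockMinusCoeff p (k + 1)) • towerVec p mu nu k m +
      ((-(p.q ^ 2)⁻¹) ^ (k + 1) * (mu * fockPlusCoeff p m)) •
        towerVec p mu nu (k + 1) (m - 1) := by
  have h1 := LinearMap.congr_fun (mul_pow_of_q_commute (d := fun k => mu ^ 2 * fockPlusCoeff p k)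
    (oscLeft_mul_E0 p mu nu) (by simp [fockPlusCoeff_zero])
    (fun k => by rw [fockPlusCoeff_succ]; ring) k) (oscVec p mu nu m 0)
  have h2 := LinearMap.congr_fun (mul_pow_of_q_commute (d := fun k => nu ^ 2 * fockMinusCoeff p k)
    (oscRight_mul_E0 p mu nu) (by simp [fockMinusCoeff_zero])
    (fun k => by rw [fockMinusCoeff_succ]; ring) k) (oscVec p mu nu m 0)
  simp only [Module.End.mul_apply, LinearMap.add_apply, LinearMap.smul_apply, oscLeft_apply,
    oscRight_apply, fockMinusCoeff_zero, mul_zero, zero_smul, map_zero, smul_zero, zero_add,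
    pow_zero, inv_one, mul_one, map_smul, smul_smul] at h1 h2
  rw [towerVec, osc_E1, LinearMap.add_apply, h1, h2, towerVec, towerVec]
  module

/-- The shift `E₀` in the coordinates with respect to the vectors `E₀ ^ k (|m⟩ ⊗ |0⟩)`. -/
def towerShift : Module.End ℂ (ℕ × ℕ →₀ ℂ) :=
  Finsupp.linearCombination ℂ fun k => Finsupp.single (k.1 + 1, k.2) 1

theorem towerShift_single (k m : ℕ) :
    towerShift (Finsupp.single (k, m) 1) = Finsupp.single (k + 1, m) 1 := by
  rw [towerShift, Finsupp.linearCombination_single, one_smul]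

/-- The coordinates of `|a⟩ ⊗ |b⟩` with respect to the vectors `E₀ ^ k (|m⟩ ⊗ |0⟩)`. -/
def towerCoord : ℕ → ℕ → (ℕ × ℕ →₀ ℂ)
  | 0, a => Finsupp.single (0, a) 1
  -- The formula `osc_E0` solved for $|a\rangle\otimes|b+1\rangle$, with $\mathcal E_0$ replaced by
  -- the shift; inverting the coefficient requires $\nu\ne0$.
  | b + 1, a => ((-1) ^ a * nu)⁻¹ •
      (towerShift (towerCoord b a) - (mu * p.q ^ (2 * b)) • towerCoord b (a + 1))

variable {nu} in
/-- The basis `E₀ ^ k (|m⟩ ⊗ |0⟩)` of `ρ₊(μ) ⊗ ρ₋(ν)`. -/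
def towerBasis (hnu : nu ≠ 0) : Module.Basis (ℕ × ℕ) ℂ (rhoTensor p mu nu).V :=
  let Psi : (rhoTensor p mu nu).V →ₗ[ℂ] (ℕ × ℕ →₀ ℂ) :=
    (oscBasis p mu nu).constr ℂ fun k => towerCoord p mu nu k.2 k.1
  let Phi : (ℕ × ℕ →₀ ℂ) →ₗ[ℂ] (rhoTensor p mu nu).V :=
    Finsupp.linearCombination ℂ fun k => towerVec p mu nu k.1 k.2
  have hne : ∀ a : ℕ, (-1) ^ a * nu ≠ 0 := fun a =>
    mul_ne_zero (pow_ne_zero _ (neg_ne_zero.2 one_ne_zero)) hnu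
  have hPsi : ∀ a b, Psi (oscVec p mu nu a b) = towerCoord p mu nu b a :=
    fun a b => constr_oscVec ..
  have hPhi : ∀ k m, Phi (Finsupp.single (k, m) 1) = towerVec p mu nu k m := fun k m =>
    (Finsupp.linearCombination_single ..).trans (one_smul ..)
  -- Both candidate maps intertwine $\mathcal E_0$ with the shift, so that they are mutually inverse
  -- follows by induction, on $k$ in one direction and on $b$ in the other.
  have hPsiE : Psi ∘ₗ (rhoTensor p mu nu).E 0 = towerShift ∘ₗ Psi :=
    (oscBasis p mu nu).ext fun k => by
      rw [oscBasis_apply, LinearMap.comp_apply, LinearMap.comp_apply, osc_E0, map_add, map_smul,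
        map_smul, hPsi, hPsi, hPsi, towerCoord, smul_smul, mul_inv_cancel₀ (hne _), one_smul,
        add_sub_cancel]
  have hPhiE : Phi ∘ₗ towerShift = (rhoTensor p mu nu).E 0 ∘ₗ Phi :=
    Finsupp.lhom_ext' fun ⟨k, m⟩ => LinearMap.ext_ring (by
      change Phi (towerShift (Finsupp.single (k, m) 1)) =
        (rhoTensor p mu nu).E 0 (Phi (Finsupp.single (k, m) 1))
      rw [towerShift_single, hPhi, hPhi, tower_E0])
  have h1 : ∀ k m, Psi (towerVec p mu nu k m) = Finsupp.single (k, m) 1 := fun k m => by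
    induction k with
    | zero => exact hPsi m 0
    | succ k ih => rw [← tower_E0, ← LinearMap.comp_apply, hPsiE, LinearMap.comp_apply, ih,
        towerShift_single]
  have h2 : ∀ b a, Phi (towerCoord p mu nu b a) = oscVec p mu nu a b := fun b => by
    induction b with
    | zero => exact fun a => hPhi 0 a
    | succ b ih =>
      intro a
      rw [towerCoord, map_smul, map_sub, map_smul, ← LinearMap.comp_apply, hPhiE,
        LinearMap.comp_apply, ih, ih, osc_E0, add_sub_cancel_left, smul_smul,
        inv_mul_cancel₀ (hne _), one_smul]
  Module.Basis.ofRepr (LinearEquiv.ofLinearMap Psi Phi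
    (Finsupp.lhom_ext' fun ⟨k, m⟩ => LinearMap.ext_ring (by
      change Psi (Phi (Finsupp.single (k, m) 1)) = Finsupp.single (k, m) 1
      rw [hPhi, h1]))
    ((oscBasis p mu nu).ext fun k => by
      rw [oscBasis_apply, LinearMap.comp_apply, hPsi, h2, LinearMap.id_apply]))

theorem towerBasis_apply {nu : ℂ} (hnu : nu ≠ 0) (k m : ℕ) :
    towerBasis p mu hnu (k, m) = towerVec p mu nu k m :=
  (Finsupp.linearCombination_single ..).trans (one_smul ..)

end Oscillator

/-! ### The factorisation of $[\rho_+][\rho_-]$ -/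

section Decomposition

variable (p : QParam) {lam mu nu : ℂ} (s : ℂ)

/-- For $m=0$ the $m$-lowering term of $\mathcal E_1$ disappears, since $c^+_0=0$, and
`fockCoeff_eq_vermaCoeff` identifies the remaining coefficient. Only the squares of $\mu$ and $\nu$
enter. The factor $\lambda^{-k}$ makes $\mathcal E_0$ act with coefficient $\lambda$. -/
theorem tower_isLadder (hlam : lam ≠ 0) (hmu : mu ^ 2 = p.qsPow (s + 1) * lam ^ 2)
    (hnu : nu ^ 2 = p.qsPow (-s - 1) * lam ^ 2) :
    IsLadder (rhoTensor p mu nu) 1 1 lam (vermaCoeff p s)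
      (fun k => (lam ^ k)⁻¹ • towerVec p mu nu k 0) := by
  refine ⟨fun k => ?_, fun k => ?_, ?_, fun k => ?_, fun k => ?_, fun k => ?_⟩
  · rw [map_smul, tower_parity, smul_comm]
    simp
  · rw [map_smul, tower_E0, smul_smul]
    congr 1
    field_simp
    ring
  · rw [map_smul, tower_E1_zero, fockPlusCoeff_zero, mul_zero, zero_smul, smul_zero]
  · rw [map_smul, tower_E1_succ, fockPlusCoeff_zero, mul_zero, mul_zero, zero_smul, add_zero,
      smul_smul, smul_smul, hmu, hnu, ← fockCoeff_eq_vermaCoeff]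
    congr 1
    field_simp
    ring
  · rw [map_smul, tower_K0, smul_comm]
    simp
  · rw [map_smul, tower_K1, smul_comm]
    simp

/-- The vectors `1 ⊗ E₀ ^ k (|m⟩ ⊗ |0⟩)` of `U_{-2}^- ⊗ (ρ₊(μ) ⊗ ρ₋(ν))`. -/
def shiftVec (mu nu : ℂ) (k m : ℕ) : ((charU p (-2) (-1)).tensor (rhoTensor p mu nu)).V :=
  Rep.tmul _ _ (charUBasis p (-2) (-1) ()) (towerVec p mu nu k m)

theorem qsPow_two (p : QParam) : p.qsPow 2 = -p.q ^ 2 := by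
  rw [q_sq, neg_neg]
  exact_mod_cast p.qsPow_natCast 2

/-- The coefficients of the projection of `ρ₊(μ) ⊗ ρ₋(ν)` onto its quotient by a Verma module. -/
def towerScalar (mu : ℂ) (k m : ℕ) : ℂ := (-1) ^ (k + m) * (mu * fockPlusCoeff p (m + 1))

theorem towerScalar_ne_zero (hmu : mu ≠ 0) (k m : ℕ) : towerScalar p mu k m ≠ 0 :=
  mul_ne_zero (pow_ne_zero _ (neg_ne_zero.2 one_ne_zero))
    (mul_ne_zero hmu (fockPlusCoeff_ne_zero p m.succ_pos))

/-- The images of the vectors `E₀ ^ k (|m⟩ ⊗ |0⟩)` in the quotient. -/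
def towerImage (mu nu : ℂ) : ℕ × ℕ → ((charU p (-2) (-1)).tensor (rhoTensor p mu nu)).V
  | (_, 0) => 0
  | (k, m + 1) => towerScalar p mu k m • shiftVec p mu nu k m

/-- Only the term with the parity operator survives on the line, and the line is odd. -/
theorem shift_E (mu nu : ℂ) (i : Fin 2) (v : (rhoTensor p mu nu).V) :
    ((charU p (-2) (-1)).tensor (rhoTensor p mu nu)).E i
      (Rep.tmul _ _ (charUBasis p (-2) (-1) ()) v) =
    -Rep.tmul _ _ (charUBasis p (-2) (-1) ()) ((rhoTensor p mu nu).E i v) := by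
  rw [Rep.tensor_E_tmul, charU_E, charU_parity]
  simp

/-- The projection of `ρ₊(μ) ⊗ ρ₋(ν)` onto its quotient by a Verma module. -/
def towerProj (mu : ℂ) (hnu : nu ≠ 0) :
    Rep.Hom (rhoTensor p mu nu) ((charU p (-2) (-1)).tensor (rhoTensor p mu nu)) :=
  have key : ∀ k m, (towerBasis p mu hnu).constr ℂ (towerImage p mu nu) (towerVec p mu nu k m) =
      towerImage p mu nu (k, m) := fun k m => by
    rw [← towerBasis_apply p mu hnu, Module.Basis.constr_basis]
  Rep.Hom.ofBasis (towerBasis p mu hnu) (towerImage p mu nu)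
    (fun ⟨k, m⟩ => by
      rw [towerBasis_apply, tower_parity, map_smul, key]
      cases m with
      | zero => simp [towerImage]
      | succ m =>
        rw [towerImage, map_smul, shiftVec, Rep.tensor_parity_tmul, charU_parity, tower_parity]
        simp only [map_smul, LinearMap.smul_apply]
        push_cast
        module)
    (fun i ⟨k, m⟩ => by
      rw [towerBasis_apply]
      fin_cases i
      · change (towerBasis p mu hnu).constr ℂ (towerImage p mu nu) ((rhoTensor p mu nu).E 0 _) =
          Rep.E _ 0 _
        rw [tower_E0, key]
        cases m with
        | zero => simp [towerImage]
        | succ m =>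
          -- The sign $(-1)^k$ in `towerScalar` compensates the sign that the odd line gives to
          -- $\mathcal E_0$.
          rw [towerImage, towerImage, map_smul, shiftVec, shiftVec, shift_E, tower_E0, towerScalar,
            towerScalar, add_right_comm, pow_succ]
          module
      · change (towerBasis p mu hnu).constr ℂ (towerImage p mu nu) ((rhoTensor p mu nu).E 1 _) =
          Rep.E _ 1 _
        cases k with
        | zero =>
          rw [tower_E1_zero, map_smul, key]
          rcases m with _ | _ | m
          · simp [towerImage]
          · simp [towerImage, shiftVec, shift_E, tower_E1_zero, fockPlusCoeff_zero]
          -- Lowering $m$ before or after the projection gives $c^+_{m+2}$ or $-c^+_{m+1}$; the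
          -- factor $(-1)^mc^+_{m+1}$ in `towerScalar` makes the two agree.
          · simp only [Nat.add_sub_cancel, towerImage, shiftVec, shift_E, tower_E1_zero, map_smul,
              towerScalar]
            module
        | succ k =>
          rw [tower_E1_succ, map_add, map_smul, map_smul, key, key]
          rcases m with _ | _ | m
          · simp [towerImage]
          · simp only [zero_add, Nat.sub_self, towerImage, shiftVec, shift_E, tower_E1_succ,
              map_smul, map_add, towerScalar, fockPlusCoeff_zero]
            module
          · simp only [Nat.add_sub_cancel, towerImage, shiftVec, shift_E, tower_E1_succ, map_smul,
              map_add, towerScalar]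
            module)
    (fun i ⟨k, m⟩ => by
      rw [towerBasis_apply]
      fin_cases i
      · change (towerBasis p mu hnu).constr ℂ (towerImage p mu nu) ((rhoTensor p mu nu).K 0 _) =
          Rep.K _ 0 _
        rw [tower_K0, map_smul, key]
        cases m with
        | zero => simp [towerImage]
        | succ m =>
          -- The twist $U_{-2}^-$ is dictated here: its $\mathcal K_0$-scalar $-q_*^2=q^2$ makes up
          -- for the lowering of $m$ by one.
          rw [towerImage, map_smul, shiftVec, Rep.tensor_K_tmul, charU_K0, tower_K0, neg_neg,
            qsPow_two]
          simp only [map_smul, LinearMap.smul_apply]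
          push_cast
          module
      · change (towerBasis p mu hnu).constr ℂ (towerImage p mu nu) ((rhoTensor p mu nu).K 1 _) =
          Rep.K _ 1 _
        rw [tower_K1, map_smul, key]
        cases m with
        | zero => simp [towerImage]
        | succ m =>
          rw [towerImage, map_smul, shiftVec, Rep.tensor_K_tmul, charU_K1, tower_K1,
            p.qsPow_neg, qsPow_two]
          simp only [map_smul, LinearMap.smul_apply, ← add_assoc, mul_add, pow_add, mul_inv]
          have hq := p.q_ne_zero
          match_scalars
          push_cast
          field_simp)

theorem towerProj_apply (mu : ℂ) (hnu : nu ≠ 0) (k m : ℕ) :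
    (towerProj p mu hnu).toLin (towerVec p mu nu k m) = towerImage p mu nu (k, m) := by
  rw [← towerBasis_apply p mu hnu]
  exact (towerBasis p mu hnu).constr_basis ℂ (towerImage p mu nu) (k, m)

/-- The module is an extension of a twisted copy of itself by $U_{-s}\otimes\mathcal W_s^+$. This
recursion makes any limit over the filtration by $m$ unnecessary. -/
theorem cls_rhoTensor_eq_add (hlam : lam ≠ 0) (hmu0 : mu ≠ 0) (hnu0 : nu ≠ 0)
    (hmu : mu ^ 2 = p.qsPow (s + 1) * lam ^ 2) (hnu : nu ^ 2 = p.qsPow (-s - 1) * lam ^ 2) :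
    clsRhoPlus p mu * clsRhoMinus p nu = clsU p (-s) 1 * clsVerma p s 1 lam +
      sigma p * clsU p (-2) 1 * (clsRhoPlus p mu * clsRhoMinus p nu) := by
  -- The ladder form of $U_{-s}\otimes\mathcal W_s^+(\lambda)$: the twist brings the top weight
  -- $q_*^s$ to 1, the weight of $|0\rangle\otimes|0\rangle$.
  let L := ladder p 1 one_ne_zero 1 lam (vermaCoeff p s) (vermaCoeff_zero p s) (vermaCoeff_serre p s)
  let bL : Module.Basis ℕ ℂ L.V := ladderBasis ..
  have hbL : IsLadder L 1 1 lam (vermaCoeff p s) bL := ladder_isLadder ..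
  have hL : clsU p (-s) 1 * clsVerma p s 1 lam = cls L (ladder_inO ..) :=
    clsU_mul_of_isLadder (verma_isLadder p s 1 lam) hbL (-s) 1
      (by
        have := qsPow_mul_qsPow_neg p s
        push_cast
        linear_combination this) (mul_one 1) _ _
  have hv := tower_isLadder p s hlam hmu hnu
  rw [hL, sigma_mul_clsU, clsRhoPlus, clsRhoMinus, clsU, ← cls_tensor, ← cls_tensor]
  let bT := Rep.tensorBasis (charUBasis p (-2) (-1)) (towerBasis p mu hnu0)
  have hbT : ∀ k m, bT ((), k, m) = shiftVec p mu nu k m := fun k m => by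
    rw [Rep.tensorBasis_apply, towerBasis_apply]
    rfl
  refine cls_eq_add_of_basis _ _ _ bL (towerBasis p mu hnu0) bT (hbL.hom hv)
    (towerProj p mu hnu0)
    ((towerBasis p mu hnu0).constr ℂ fun k => if k.2 = 0 then lam ^ k.1 • bL k.1 else 0)
    (bT.constr ℂ fun k => (towerScalar p mu k.2.1 k.2.2)⁻¹ • towerVec p mu nu k.2.1 (k.2.2 + 1))
    (fun k => ?_) (fun ⟨_, k, m⟩ => ?_) (fun ⟨k, m⟩ => ?_)
  · rw [hbL.hom_apply hv, map_smul, ← towerBasis_apply p mu hnu0, Module.Basis.constr_basis,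
      if_pos rfl, smul_smul, inv_mul_cancel₀ (pow_ne_zero _ hlam), one_smul]
  · rw [Module.Basis.constr_basis, map_smul, towerProj_apply, towerImage, smul_smul,
      inv_mul_cancel₀ (towerScalar_ne_zero p hmu0 _ _), one_smul]
    exact (hbT k m).symm
  · rw [Module.Basis.constr_basis, towerBasis_apply, towerProj_apply]
    cases m with
    | zero =>
      rw [if_pos rfl, map_smul, hbL.hom_apply hv, smul_smul, mul_inv_cancel₀ (pow_ne_zero _ hlam),
        one_smul, towerImage, map_zero, add_zero]
    | succ m =>
      rw [if_neg m.succ_ne_zero, map_zero, zero_add, towerImage, map_smul, ← hbT,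
        Module.Basis.constr_basis, smul_smul, mul_inv_cancel₀ (towerScalar_ne_zero p hmu0 _ _),
        one_smul]

theorem clsU_commute_clsVerma (r : ℂ) (ε ε' : ℤˣ) (lam : ℂ) :
    Commute (clsU p r ε) (clsVerma p s ε' lam) :=
  clsU_commute_of_isLadder (verma_isLadder p s ε' lam) r ε _

/-- By its closed form, $f_r$ is built from classes of one-dimensional modules, and these commute
with the class of a ladder. -/
theorem clsVerma_commute_fSum (r : ℂ) (ε : ℤˣ) (lam : ℂ) :
    Commute (clsVerma p s ε lam) (fSum p r) := by
  rw [fSum_eq]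
  refine (clsU_commute_clsVerma p s _ _ _ _).symm.mul_right (commute_ringInverse ?_
    (isUnit_one_sub p))
  rw [sigma_mul_clsU]
  exact (Commute.one_right _).sub_right (clsU_commute_clsVerma p s _ _ _ _).symm

/-- `[ρ₊(μ)] [ρ₋(ν)] = [𝒲_s^+(λ)] f_s`. -/
theorem clsRhoPlus_mul_clsRhoMinus (hlam : lam ≠ 0) :
    clsRhoPlus p (p.qsPow (s / 2 + 1 / 2) * lam) * clsRhoMinus p (p.qsPow (-s / 2 - 1 / 2) * lam) =
      clsVerma p s 1 lam * fSum p s := by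
  have h := cls_rhoTensor_eq_add p s hlam (mul_ne_zero (p.qsPow_ne_zero (s / 2 + 1 / 2)) hlam)
    (mul_ne_zero (p.qsPow_ne_zero (-s / 2 - 1 / 2)) hlam)
    (by rw [mul_pow, sq (p.qsPow _), ← p.qsPow_add]; ring_nf)
    (by rw [mul_pow, sq (p.qsPow _), ← p.qsPow_add]; ring_nf)
  rw [← sub_eq_iff_eq_add, ← one_sub_mul] at h
  -- Multiplied by $1-\sigma[U_{-2}]$, both sides become $[U_{-s}][\mathcal W_s^+]$.
  refine (isUnit_one_sub p).mul_left_cancel (h.trans ?_)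
  rw [(clsVerma_commute_fSum p s s 1 lam).eq, ← mul_assoc, one_sub_mul_fSum]

end Decomposition

/-! ### Tensor products of $W_1$ with a ladder -/

section Pair

variable (p : QParam) {lam : ℂ} {c : ℕ → ℂ} {N : Rep p} (b : Module.Basis ℕ ℂ N.V)

theorem qsNum_one (p : QParam) : p.qsNum 1 = 1 := by
  rw [QParam.qsNum, p.qsPow_neg]
  exact div_self p.qs_sub_inv_ne

variable (lam) in
/-- The vectors `e_{1/2 - i} ⊗ |k⟩` of `W₁(λ) ⊗ N`. -/
def pairVec (i : ℕ) (k : ℕ) : ((finDim p 1 1 lam).tensor N).V :=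
  Rep.tmul _ _ (finVec p 1 1 lam i) (b k)

variable (lam) in
/-- The basis `e_{1/2 - i} ⊗ |k⟩` of `W₁(λ) ⊗ N`. -/
def pairBasis : Module.Basis (Fin (1 + 1) × ℕ) ℂ ((finDim p 1 1 lam).tensor N).V :=
  Rep.tensorBasis (finBasis p 1 1 lam) b

theorem pairBasis_apply (i : Fin (1 + 1)) (k : ℕ) :
    pairBasis p lam b (i, k) = pairVec p lam b i k := by
  rw [pairBasis, Rep.tensorBasis_apply, finBasis_apply]
  rfl

variable {b}

theorem pair_parity (hb : IsLadder N 1 1 lam c b) (i k : ℕ) :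
    ((finDim p 1 1 lam).tensor N).parity (pairVec p lam b i k) =
      (-1 : ℂ) ^ (i + k) • pairVec p lam b i k := by
  rw [pairVec, Rep.tensor_parity_tmul, finDim_parity, hb.parity]
  simp only [map_smul, LinearMap.smul_apply, smul_smul]
  congr 1
  push_cast
  ring

theorem pair_K0 (hb : IsLadder N 1 1 lam c b) (i k : ℕ) :
    ((finDim p 1 1 lam).tensor N).K 0 (pairVec p lam b i k) =
      (p.qs⁻¹ * p.q ^ (2 * (i + k))) • pairVec p lam b i k := by
  rw [pairVec, Rep.tensor_K_tmul, finDim_K0, hb.K0]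
  simp only [map_smul, LinearMap.smul_apply, smul_smul, Nat.cast_one]
  rw [← QParam.qs]
  congr 1
  push_cast
  ring

theorem pair_K1 (hb : IsLadder N 1 1 lam c b) (i k : ℕ) :
    ((finDim p 1 1 lam).tensor N).K 1 (pairVec p lam b i k) =
      (p.qs * (p.q ^ (2 * (i + k)))⁻¹) • pairVec p lam b i k := by
  rw [pairVec, Rep.tensor_K_tmul, finDim_K1, hb.K1]
  simp only [map_smul, LinearMap.smul_apply, smul_smul, Nat.cast_one]
  rw [← QParam.qs, mul_add, pow_add, mul_inv]
  congr 1
  push_cast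
  ring

theorem pair_E0_zero (hb : IsLadder N 1 1 lam c b) (k : ℕ) :
    ((finDim p 1 1 lam).tensor N).E 0 (pairVec p lam b 0 k) =
      (lam * p.q ^ (2 * k)) • pairVec p lam b 1 k + lam • pairVec p lam b 0 (k + 1) := by
  simp only [pairVec, Rep.tensor_E_tmul, finDim_E0, hb.E0, hb.K0, finDim_parity]
  simp [smul_smul, qsNum_one, mul_comm]

theorem pair_E0_one (hb : IsLadder N 1 1 lam c b) (k : ℕ) :
    ((finDim p 1 1 lam).tensor N).E 0 (pairVec p lam b 1 k) =
      -(lam • pairVec p lam b 1 (k + 1)) := by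
  simp only [pairVec, Rep.tensor_E_tmul, finDim_E0, hb.E0, finDim_parity]
  simp [qsNum_zero]

theorem pair_E1_zero_zero (hb : IsLadder N 1 1 lam c b) :
    ((finDim p 1 1 lam).tensor N).E 1 (pairVec p lam b 0 0) = 0 := by
  simp only [pairVec, Rep.tensor_E_tmul, finDim_E1 p 1 1 lam (Nat.zero_le 1), hb.E1_zero]
  simp [qsNum_zero]

theorem pair_E1_zero_succ (hb : IsLadder N 1 1 lam c b) (k : ℕ) :
    ((finDim p 1 1 lam).tensor N).E 1 (pairVec p lam b 0 (k + 1)) =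
      (lam * c (k + 1)) • pairVec p lam b 0 k := by
  simp only [pairVec, Rep.tensor_E_tmul, finDim_E1 p 1 1 lam (Nat.zero_le 1), hb.E1_succ,
    finDim_parity]
  simp [qsNum_zero]

theorem pair_E1_one_zero (hb : IsLadder N 1 1 lam c b) :
    ((finDim p 1 1 lam).tensor N).E 1 (pairVec p lam b 1 0) = lam • pairVec p lam b 0 0 := by
  simp only [pairVec, Rep.tensor_E_tmul, finDim_E1 p 1 1 lam le_rfl, hb.E1_zero, hb.K1]
  simp [qsNum_one]

theorem pair_E1_one_succ (hb : IsLadder N 1 1 lam c b) (k : ℕ) :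
    ((finDim p 1 1 lam).tensor N).E 1 (pairVec p lam b 1 (k + 1)) =
      (lam * (p.q ^ (2 * (k + 1)))⁻¹) • pairVec p lam b 0 (k + 1) -
        (lam * c (k + 1)) • pairVec p lam b 1 k := by
  simp only [pairVec, Rep.tensor_E_tmul, finDim_E1 p 1 1 lam le_rfl, hb.E1_succ, hb.K1,
    finDim_parity]
  simp [qsNum_one, smul_smul, mul_comm, sub_eq_add_neg]

/-- A pair of sequences as a family indexed by the basis of `W₁(λ) ⊗ N`. -/
def pairFam {W : Type} (A B : ℕ → W) (k : Fin (1 + 1) × ℕ) : W := if k.1 = 0 then A k.2 else B k.2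

theorem constr_pairVec_zero {W : Type} [AddCommGroup W] [Module ℂ W] (A B : ℕ → W) (k : ℕ) :
    (pairBasis p lam b).constr ℂ (pairFam A B) (pairVec p lam b 0 k) = A k := by
  have h := pairBasis_apply p (lam := lam) b 0 k
  rw [show pairVec p lam b 0 k = pairBasis p lam b (0, k) from h.symm, Module.Basis.constr_basis]
  rfl

theorem constr_pairVec_one {W : Type} [AddCommGroup W] [Module ℂ W] (A B : ℕ → W) (k : ℕ) :
    (pairBasis p lam b).constr ℂ (pairFam A B) (pairVec p lam b 1 k) = B k := by
  have h := pairBasis_apply p (lam := lam) b 1 k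
  rw [show pairVec p lam b 1 k = pairBasis p lam b (1, k) from h.symm, Module.Basis.constr_basis]
  rfl

/-- A morphism out of `W₁(λ) ⊗ N` given by the images of the basis vectors. -/
def pairHom (hb : IsLadder N 1 1 lam c b) {T : Rep p} (A B : ℕ → T.V)
    (hPA : ∀ k, T.parity (A k) = (-1 : ℂ) ^ (0 + k) • A k)
    (hPB : ∀ k, T.parity (B k) = (-1 : ℂ) ^ (1 + k) • B k)
    (hE0A : ∀ k, T.E 0 (A k) = (lam * p.q ^ (2 * k)) • B k + lam • A (k + 1))
    (hE0B : ∀ k, T.E 0 (B k) = -(lam • B (k + 1)))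
    (hE1A0 : T.E 1 (A 0) = 0) (hE1A : ∀ k, T.E 1 (A (k + 1)) = (lam * c (k + 1)) • A k)
    (hE1B0 : T.E 1 (B 0) = lam • A 0)
    (hE1B : ∀ k, T.E 1 (B (k + 1)) =
      (lam * (p.q ^ (2 * (k + 1)))⁻¹) • A (k + 1) - (lam * c (k + 1)) • B k)
    (hK0A : ∀ k, T.K 0 (A k) = (p.qs⁻¹ * p.q ^ (2 * (0 + k))) • A k)
    (hK0B : ∀ k, T.K 0 (B k) = (p.qs⁻¹ * p.q ^ (2 * (1 + k))) • B k)
    (hK1A : ∀ k, T.K 1 (A k) = (p.qs * (p.q ^ (2 * (0 + k)))⁻¹) • A k)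
    (hK1B : ∀ k, T.K 1 (B k) = (p.qs * (p.q ^ (2 * (1 + k)))⁻¹) • B k) :
    Rep.Hom ((finDim p 1 1 lam).tensor N) T :=
  have e0 := constr_pairVec_zero p (lam := lam) (b := b) A B
  have e1 := constr_pairVec_one p (lam := lam) (b := b) A B
  Rep.Hom.ofBasis (pairBasis p lam b) (pairFam A B)
    (fun ⟨i, k⟩ => by
      rw [pairBasis_apply, pair_parity p hb, map_smul]
      fin_cases i
      · exact (congrArg _ (e0 k)).trans (hPA k).symm
      · exact (congrArg _ (e1 k)).trans (hPB k).symm)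
    (fun j ⟨i, k⟩ => by
      rw [pairBasis_apply]
      fin_cases j <;> fin_cases i
      · exact (congrArg _ (pair_E0_zero p hb k)).trans
          (by rw [map_add, map_smul, map_smul, e0, e1]; exact (hE0A k).symm)
      · exact (congrArg _ (pair_E0_one p hb k)).trans
          (by rw [map_neg, map_smul, e1]; exact (hE0B k).symm)
      · rcases k with _ | k
        · exact (congrArg _ (pair_E1_zero_zero p hb)).trans (by rw [map_zero]; exact hE1A0.symm)
        · exact (congrArg _ (pair_E1_zero_succ p hb k)).trans
            (by rw [map_smul, e0]; exact (hE1A k).symm)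
      · rcases k with _ | k
        · exact (congrArg _ (pair_E1_one_zero p hb)).trans
            (by rw [map_smul, e0]; exact hE1B0.symm)
        · exact (congrArg _ (pair_E1_one_succ p hb k)).trans
            (by rw [map_sub, map_smul, map_smul, e0, e1]; exact (hE1B k).symm))
    (fun j ⟨i, k⟩ => by
      rw [pairBasis_apply]
      fin_cases j
      · refine (congrArg _ (pair_K0 p hb _ k)).trans ?_
        rw [map_smul]
        fin_cases i
        · exact (congrArg _ (e0 k)).trans (hK0A k).symm
        · exact (congrArg _ (e1 k)).trans (hK0B k).symm
      · refine (congrArg _ (pair_K1 p hb _ k)).trans ?_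
        rw [map_smul]
        fin_cases i
        · exact (congrArg _ (e0 k)).trans (hK1A k).symm
        · exact (congrArg _ (e1 k)).trans (hK1B k).symm)

/-- A common frame for the two Baxter relations: `A`, `B` describe the projection on the two rows
$e_{\pm1/2}\otimes|k\rangle$, `rA`, `rB` the retraction, and `s` the section, so that exactness
becomes a finite list of identities on basis vectors. -/
theorem cls_pair_eq_add (hN : N.InO) {L T : Rep p} (hL : L.InO)
    (hT : T.InO) {x u : ℂ} {ε : ℤˣ} {c' : ℕ → ℂ} {bL : Module.Basis ℕ ℂ L.V}
    (hbL : IsLadder L x ε u c' bL) {bT : Module.Basis ℕ ℂ T.V}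
    {v : ℕ → ((finDim p 1 1 lam).tensor N).V} (hv : IsLadder _ x ε u c' v)
    (g : Rep.Hom ((finDim p 1 1 lam).tensor N) T) (A B : ℕ → T.V)
    (hg : g.toLin = (pairBasis p lam b).constr ℂ (pairFam A B))
    (rA rB : ℕ → L.V) (s : ℕ → ((finDim p 1 1 lam).tensor N).V)
    (hrf : ∀ k, (pairBasis p lam b).constr ℂ (pairFam rA rB) (v k) = bL k)
    (hgs : ∀ k, g.toLin (s k) = bT k)
    (h0 : ∀ k, bL.constr ℂ v (rA k) + bT.constr ℂ s (A k) = pairVec p lam b 0 k)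
    (h1 : ∀ k, bL.constr ℂ v (rB k) + bT.constr ℂ s (B k) = pairVec p lam b 1 k) :
    clsW p 1 1 lam * cls N hN = cls L hL + cls T hT := by
  rw [clsW, ← cls_tensor]
  refine cls_eq_add_of_basis _ _ _ bL (pairBasis p lam b) bT (hbL.hom hv) g
    ((pairBasis p lam b).constr ℂ (pairFam rA rB)) (bT.constr ℂ s) (fun k => ?_) (fun k => ?_)
    (fun ⟨i, k⟩ => ?_)
  · rw [hbL.hom_apply hv, hrf]
  · rw [Module.Basis.constr_basis, hgs]
  · rw [hg, Module.Basis.constr_basis, Module.Basis.constr_basis, pairBasis_apply]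
    fin_cases i
    · exact h0 k
    · exact h1 k

end Pair

/-! ### The Baxter relations -/

section Baxter

variable (p : QParam) (lam : ℂ)

/-- The alternating sum `q ^ (2k-2) - q ^ (2k-4) + ⋯`. -/
def altSum (k : ℕ) : ℂ := (p.q ^ (2 * k) - (-1) ^ k) / (p.q ^ 2 + 1)

theorem altSum_one : altSum p 1 = 1 := by
  have := p.q_sq_add_one_ne
  rw [altSum]
  field_simp
  ring

theorem altSum_succ (k : ℕ) : altSum p (k + 1) = p.q ^ (2 * k) - altSum p k := by
  have := p.q_sq_add_one_ne
  rw [altSum, altSum]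
  field_simp
  ring

theorem q_add_inv_sq : (p.q + p.q⁻¹) ^ 2 = (p.q ^ 2 + 1) ^ 2 / p.q ^ 2 := by
  have := p.q_ne_zero
  field_simp

theorem fockPlusCoeff_add_altSum (k : ℕ) :
    (p.q ^ (2 * k))⁻¹ * altSum p k = -((p.q ^ 2)⁻¹ + 1) * fockPlusCoeff p k := by
  have h0 := p.q_ne_zero
  have h1 := p.q_sq_add_one_ne
  rw [fockPlusCoeff, altSum, q_add_inv_sq]
  field_simp
  ring

theorem altSum_mul_fockPlusCoeff (k : ℕ) :
    altSum p (k + 1) * fockPlusCoeff p k = p.q ^ 2 * fockPlusCoeff p (k + 1) * altSum p k := by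
  have h0 := p.q_ne_zero
  have h1 := p.q_sq_add_one_ne
  rw [fockPlusCoeff, fockPlusCoeff, altSum, altSum, q_add_inv_sq]
  field_simp
  ring

/-- Equivariance under $\mathcal E_1$ amounts to this relation, both for the submodule and for the
quotient of $W_1\otimes\rho_-$. -/
theorem fockMinusCoeff_relation (k : ℕ) :
    -(p.q ^ 2 + 1) * (p.q ^ 2)⁻¹ * fockMinusCoeff p (k + 1) =
      1 + (p.q ^ 2 + 1) * fockMinusCoeff p k := by
  have h0 := p.q_ne_zero
  have h1 := p.q_sq_add_one_ne
  rw [fockMinusCoeff, fockMinusCoeff, q_add_inv_sq]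
  field_simp
  ring

theorem neg_inv_qs_ne_zero : -p.qs⁻¹ ≠ 0 := neg_ne_zero.2 (inv_ne_zero p.qs_ne_zero)

/-- The vectors spanning the submodule `U₁ ⊗ ρ₊(q_* λ)` of `W₁(λ) ⊗ ρ₊(λ)`. -/
def plusVec : ℕ → ((finDim p 1 1 lam).tensor (rhoPlus p lam)).V
  | 0 => pairVec p lam (rhoPlusBasis p lam) 0 0
  | k + 1 => (p.qs⁻¹ ^ (k + 1)) • (pairVec p lam (rhoPlusBasis p lam) 0 (k + 1) +
      altSum p (k + 1) • pairVec p lam (rhoPlusBasis p lam) 1 k)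

/-- The submodule is the $\mathcal E_0$-orbit of the top vector $e_{1/2}\otimes|0\rangle$. The sign
rule turns the action of $\mathcal E_0$ on the two rows into $a_{k+1}=q^{2k}-a_k$, which is the
recursion of `altSum`. The factor $q_*^{-k}$ accounts for the spectral parameter $q_*\lambda$. -/
theorem plusVec_isLadder : IsLadder ((finDim p 1 1 lam).tensor (rhoPlus p lam)) p.qs 1
    (p.qs * lam) (fockPlusCoeff p) (plusVec p lam) := by
  have hb := rhoPlus_isLadder p lam
  have hQ := p.qs_ne_zero
  have hq := p.q_ne_zero
  refine ⟨fun k => ?_, fun k => ?_, ?_, fun k => ?_, fun k => ?_, fun k => ?_⟩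
  · cases k with
    | zero => rw [plusVec, pair_parity p hb]; simp
    | succ k =>
      simp only [plusVec, map_smul, map_add, pair_parity p hb, zero_add]
      push_cast
      module
  · cases k with
    | zero =>
      simp only [plusVec, pair_E0_zero p hb, altSum_one, zero_add, mul_zero, pow_zero, pow_one]
      match_scalars <;> field_simp
    | succ k =>
      simp only [plusVec, map_smul, map_add, pair_E0_zero p hb, pair_E0_one p hb,
        altSum_succ p (k + 1), pow_succ]
      match_scalars <;> field_simp
      ring
  · exact pair_E1_zero_zero p hb
  · have h1 := fockPlusCoeff_add_altSum p (k + 1)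
    have h3 := p.q_sq
    -- The two contributions of $\mathcal E_1$ to the row $e_{1/2}$ add up to the Fock coefficient
    -- times $q_*^2$, as the shift of $\lambda$ to $q_*\lambda$ demands.
    have key : fockPlusCoeff p (k + 1) + (p.q ^ (2 * k))⁻¹ * altSum p (k + 1) =
        p.qs ^ 2 * fockPlusCoeff p (k + 1) := by
      have h : (p.q ^ (2 * k))⁻¹ = p.q ^ 2 * (p.q ^ (2 * (k + 1)))⁻¹ := by
        rw [mul_add, pow_add]
        field_simp
      rw [h, mul_assoc, h1]
      field_simp
      linear_combination -(fockPlusCoeff p (k + 1)) * h3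
    cases k with
    | zero =>
      simp only [plusVec, map_smul, map_add, pair_E1_zero_succ p hb, pair_E1_one_zero p hb]
      simp only [mul_zero, pow_zero, inv_one, one_mul] at key
      match_scalars
      linear_combination (p.qs⁻¹ * lam) * key +
        (p.qs * lam * fockPlusCoeff p (0 + 1)) * (inv_mul_cancel₀ hQ)
    | succ k =>
      have h2 := altSum_mul_fockPlusCoeff p (k + 1)
      simp only [plusVec, map_smul, map_add, pair_E1_zero_succ p hb, pair_E1_one_succ p hb,
        pow_succ p.qs⁻¹ (k + 1)]
      rw [h3] at h2
      match_scalars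
      · linear_combination (p.qs⁻¹ ^ (k + 1) * p.qs⁻¹ * lam) * key +
          (p.qs⁻¹ ^ (k + 1) * lam * p.qs * fockPlusCoeff p (k + 1 + 1)) *
            (inv_mul_cancel₀ hQ)
      · linear_combination (-p.qs⁻¹ ^ (k + 1) * p.qs⁻¹ * lam) * h2 +
          (p.qs⁻¹ ^ (k + 1) * lam * p.qs * fockPlusCoeff p (k + 1 + 1) * altSum p (k + 1)) *
            (inv_mul_cancel₀ hQ)
  · cases k with
    | zero => rw [plusVec, pair_K0 p hb]
    | succ k =>
      simp only [plusVec, map_smul, map_add, pair_K0 p hb, zero_add, add_comm 1 k]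
      module
  · cases k with
    | zero => rw [plusVec, pair_K1 p hb]
    | succ k =>
      simp only [plusVec, map_smul, map_add, pair_K1 p hb, zero_add, add_comm 1 k]
      module

theorem baxter_plus : clsW p 1 1 lam * clsRhoPlus p lam =
    clsU p 1 1 * clsRhoPlus p (p.qs * lam) +
      sigma p * clsU p (-1) 1 * clsRhoPlus p (p.qs⁻¹ * lam) := by
  have hb := rhoPlus_isLadder p lam
  have hQ := p.qs_ne_zero
  have hq := p.q_ne_zero
  let L := ladder p p.qs hQ 1 (p.qs * lam) (fockPlusCoeff p) (fockPlusCoeff_zero p)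
    (fockPlusCoeff_serre p)
  let bL : Module.Basis ℕ ℂ L.V := ladderBasis ..
  have hbL : IsLadder L _ _ _ _ bL := ladder_isLadder ..
  let T := ladder p (-p.qs⁻¹) (neg_inv_qs_ne_zero p) (-1) (p.qs⁻¹ * lam) (fockPlusCoeff p)
    (fockPlusCoeff_zero p) (fockPlusCoeff_serre p)
  let bT : Module.Basis ℕ ℂ T.V := ladderBasis ..
  have hbT : IsLadder T _ _ _ _ bT := ladder_isLadder ..
  have eL : clsU p 1 1 * clsRhoPlus p (p.qs * lam) = cls L (ladder_inO ..) :=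
    clsU_mul_of_isLadder (rhoPlus_isLadder p _) hbL 1 1 (by rw [← QParam.qs]; simp) rfl _ _
  have eT : sigma p * clsU p (-1) 1 * clsRhoPlus p (p.qs⁻¹ * lam) = cls T (ladder_inO ..) := by
    rw [sigma_mul_clsU]
    exact clsU_mul_of_isLadder (rhoPlus_isLadder p _) hbT (-1) (-1)
      (by rw [p.qsPow_neg, ← QParam.qs]; simp) (by simp) _ _
  rw [eL, eT]
  -- Modulo the submodule, the vectors $e_{-1/2}\otimes|k\rangle$ form a basis and
  -- $e_{1/2}\otimes|k+1\rangle$ equals $-a_{k+1}$ times $e_{-1/2}\otimes|k\rangle$. The powers of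
  -- $-q_*^{-1}$ contain both the shift of $\lambda$ and the sign of $\mathcal E_0$ past the odd
  -- vector $e_{-1/2}$.
  let B : ℕ → T.V := fun k => (-p.qs⁻¹) ^ k • bT k
  let A : ℕ → T.V := fun k => Nat.casesOn k 0 fun k => (-altSum p (k + 1) * (-p.qs⁻¹) ^ k) • bT k
  have hA0 : A 0 = 0 := rfl
  have hA : ∀ k, A (k + 1) = (-altSum p (k + 1) * (-p.qs⁻¹) ^ k) • bT k := fun _ => rfl
  have hB : ∀ k, B k = (-p.qs⁻¹) ^ k • bT k := fun _ => rfl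
  have hqQ : p.qs⁻¹ ^ 2 = -(p.q ^ 2)⁻¹ := by rw [q_sq, inv_pow, inv_neg, neg_neg]
  have hmQ : (-p.qs⁻¹)⁻¹ = -p.qs := by rw [inv_neg, inv_inv]
  let g := pairHom p hb A B
    (fun k => by
      rcases k with _ | k
      · rw [hA0, map_zero, smul_zero]
      · rw [hA, map_smul, hbT.parity]
        push_cast
        module)
    (fun k => by
      rw [hB, map_smul, hbT.parity]
      push_cast
      module)
    (fun k => by
      rcases k with _ | k
      · rw [hA0, hA, hB, altSum_one]
        simp
      · rw [hA, hA, hB, map_smul, hbT.E0, altSum_succ p (k + 1)]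
        module)
    (fun k => by
      rw [hB, hB, map_smul, hbT.E0]
      module)
    (by rw [hA0, map_zero])
    (fun k => by
      rcases k with _ | k
      · rw [hA0, hA, map_smul, hbT.E1_zero, smul_zero, smul_zero]
      · have h := altSum_mul_fockPlusCoeff p (k + 1)
        rw [hA, hA, map_smul, hbT.E1_succ]
        match_scalars
        have h' : altSum p (k + 1) * fockPlusCoeff p (k + 1 + 1) =
            (p.q ^ 2)⁻¹ * (altSum p (k + 1 + 1) * fockPlusCoeff p (k + 1)) := by
          rw [h]
          field_simp
        linear_combination (altSum p (k + 1 + 1) * fockPlusCoeff p (k + 1) * lam *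
          (-p.qs⁻¹) ^ k) * hqQ + (-p.qs⁻¹) ^ k * lam * h')
    (by rw [hA0, hB, map_smul, hbT.E1_zero, smul_zero, smul_zero])
    (fun k => by
      have h := fockPlusCoeff_add_altSum p (k + 1)
      rw [hA, hB, hB, map_smul, hbT.E1_succ]
      match_scalars
      linear_combination (-(-p.qs⁻¹) ^ k * lam * fockPlusCoeff p (k + 1)) * hqQ +
        (lam * (-p.qs⁻¹) ^ k) * h)
    (fun k => by
      rcases k with _ | k
      · rw [hA0, map_zero, smul_zero]
      · rw [hA, map_smul, hbT.K0, hmQ]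
        match_scalars
        linear_combination (altSum p (k + 1) * (-p.qs⁻¹) ^ k * p.q ^ (2 * k)) *
          (p.qs⁻¹ * p.q_sq - p.qs * mul_inv_cancel₀ hQ))
    (fun k => by
      rw [hB, map_smul, hbT.K0, hmQ]
      match_scalars
      linear_combination ((-p.qs⁻¹) ^ k * p.q ^ (2 * k)) *
        (p.qs * mul_inv_cancel₀ hQ - p.qs⁻¹ * p.q_sq))
    (fun k => by
      rcases k with _ | k
      · rw [hA0, map_zero, smul_zero]
      · rw [hA, map_smul, hbT.K1, zero_add, mul_add, pow_add, mul_one, mul_inv]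
        match_scalars
        linear_combination (altSum p (k + 1) * (-p.qs⁻¹) ^ k * (p.q ^ (2 * k))⁻¹) *
          (p.qs * hqQ - p.qs⁻¹ * mul_inv_cancel₀ hQ))
    (fun k => by
      rw [hB, map_smul, hbT.K1, mul_add, pow_add, mul_one, mul_inv]
      match_scalars
      linear_combination ((-p.qs⁻¹) ^ k * (p.q ^ (2 * k))⁻¹) *
        (p.qs⁻¹ * mul_inv_cancel₀ hQ - p.qs * hqQ))
  have e0 := constr_pairVec_zero p (lam := lam) (b := rhoPlusBasis p lam)
    (fun k => p.qs ^ k • bL k) (fun _ => 0)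
  have e1 := constr_pairVec_one p (lam := lam) (b := rhoPlusBasis p lam)
    (fun k => p.qs ^ k • bL k) (fun _ => 0)
  refine cls_pair_eq_add p _ _ _ hbL (plusVec_isLadder p lam) (bT := bT) g A B rfl
    (fun k => p.qs ^ k • bL k) (fun _ => 0)
    (fun k => ((-p.qs⁻¹) ^ k)⁻¹ • pairVec p lam (rhoPlusBasis p lam) 1 k)
    (fun k => ?_) (fun k => ?_) (fun k => ?_) (fun k => ?_)
  · rcases k with _ | k
    · rw [plusVec, e0, pow_zero, one_smul]
    · rw [plusVec, map_smul, map_add, map_smul, e0, e1, smul_zero, add_zero, smul_smul, inv_pow,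
        inv_mul_cancel₀ (pow_ne_zero _ hQ), one_smul]
  · rw [map_smul]
    refine (congrArg _ (constr_pairVec_one p A B k)).trans ?_
    rw [hB, smul_smul, inv_mul_cancel₀ (pow_ne_zero _ (neg_inv_qs_ne_zero p)), one_smul]
  · rw [map_smul, Module.Basis.constr_basis]
    rcases k with _ | k
    · rw [hA0, map_zero, pow_zero, one_smul, add_zero, plusVec]
    · rw [hA, map_smul, Module.Basis.constr_basis, plusVec, smul_smul, smul_smul, inv_pow,
        mul_inv_cancel₀ (pow_ne_zero _ hQ), one_smul, mul_assoc,
        mul_inv_cancel₀ (pow_ne_zero _ (neg_inv_qs_ne_zero p)), mul_one, neg_smul,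
        add_neg_cancel_right]
  · rw [map_zero, zero_add, hB, map_smul, Module.Basis.constr_basis, smul_smul,
      mul_inv_cancel₀ (pow_ne_zero _ (neg_inv_qs_ne_zero p)), one_smul]

/-- The vectors spanning the submodule `U_{-1}^- ⊗ ρ₋(q_* λ)` of `W₁(λ) ⊗ ρ₋(λ)`. -/
def minusVec (k : ℕ) : ((finDim p 1 1 lam).tensor (rhoMinus p lam)).V :=
  (p.qs⁻¹ ^ k) • (p.q ^ (2 * (k + 1)) • pairVec p lam (rhoMinusBasis p lam) 1 k +
    (p.q ^ 2 + 1) • pairVec p lam (rhoMinusBasis p lam) 0 (k + 1))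

/-- Here the submodule starts one step below the top: the combination of $e_{-1/2}\otimes|0\rangle$
and $e_{1/2}\otimes|1\rangle$ annihilated by $\mathcal E_1$ generates it. Hence the roles of
submodule and quotient are interchanged compared with $\rho_+$. -/
theorem minusVec_isLadder : IsLadder ((finDim p 1 1 lam).tensor (rhoMinus p lam)) (-p.qs⁻¹) (-1)
    (p.qs * lam) (fockMinusCoeff p) (minusVec p lam) := by
  have hb := rhoMinus_isLadder p lam
  have hQ := p.qs_ne_zero
  have hq := p.q_ne_zero
  have h3 := p.q_sq
  have hmQ : (-p.qs⁻¹)⁻¹ = -p.qs := by rw [inv_neg, inv_inv]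
  -- At $k=0$ the right side vanishes and this says that `minusVec` at 0 is annihilated by $\mathcal
  -- E_1$.
  have key : ∀ k, p.q ^ 2 + (p.q ^ 2 + 1) * fockMinusCoeff p (k + 1) =
      p.qs ^ 2 * (p.q ^ 2 + 1) * fockMinusCoeff p k := fun k => by
    have h := fockMinusCoeff_relation p k
    field_simp at h
    linear_combination -h - (p.q ^ 2 + 1) * fockMinusCoeff p k * h3
  refine ⟨fun k => ?_, fun k => ?_, ?_, fun k => ?_, fun k => ?_, fun k => ?_⟩
  · simp only [minusVec, map_smul, map_add, pair_parity p hb]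
    push_cast
    module
  · simp only [minusVec, map_smul, map_add, pair_E0_zero p hb, pair_E0_one p hb, pow_succ p.qs⁻¹]
    match_scalars
    · linear_combination (-p.qs⁻¹ ^ k * lam * p.q ^ (2 * (k + 1 + 1))) * (mul_inv_cancel₀ hQ)
    · linear_combination (-p.qs⁻¹ ^ k * lam * (p.q ^ 2 + 1)) * (mul_inv_cancel₀ hQ)
  · simp only [minusVec, map_smul, map_add, pair_E1_zero_succ p hb, pair_E1_one_zero p hb]
    have h := key 0
    rw [fockMinusCoeff_zero, mul_zero] at h
    match_scalars
    linear_combination lam * h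
  · have h := key (k + 1)
    simp only [minusVec, map_smul, map_add, pair_E1_zero_succ p hb, pair_E1_one_succ p hb,
      pow_succ p.qs⁻¹]
    have h4 : p.q ^ (2 * (k + 1 + 1)) * (p.q ^ (2 * (k + 1)))⁻¹ = p.q ^ 2 := by
      rw [mul_add 2 (k + 1), pow_add]
      field_simp
    match_scalars
    · linear_combination (p.qs⁻¹ ^ k * p.qs⁻¹ * lam) * h + (p.qs⁻¹ ^ k * p.qs⁻¹ * lam) * h4 +
        (p.qs⁻¹ ^ k * lam * p.qs * (p.q ^ 2 + 1) * fockMinusCoeff p (k + 1)) * (inv_mul_cancel₀ hQ)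
    · linear_combination (-p.qs⁻¹ ^ k * p.qs⁻¹ * lam * p.q ^ (2 * (k + 1)) *
        fockMinusCoeff p (k + 1)) * h3 + (p.qs⁻¹ ^ k * lam * p.qs * p.q ^ (2 * (k + 1)) *
          fockMinusCoeff p (k + 1)) * (inv_mul_cancel₀ hQ)
  · simp only [minusVec, map_smul, map_add, pair_K0 p hb, hmQ, zero_add, add_comm 1 k, mul_add 2 k,
      pow_add, mul_one]
    match_scalars
    · linear_combination (p.qs⁻¹ ^ k * p.q ^ (2 * k) * p.q ^ 2 * p.q ^ (2 * k)) *
        (p.qs⁻¹ * h3 - p.qs * (inv_mul_cancel₀ hQ))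
    · linear_combination (p.qs⁻¹ ^ k * (p.q ^ 2 + 1) * p.q ^ (2 * k)) *
        (p.qs⁻¹ * h3 - p.qs * (inv_mul_cancel₀ hQ))
  · have hqQ : (p.q ^ 2)⁻¹ = -p.qs⁻¹ ^ 2 := by rw [q_sq, inv_pow, inv_neg]
    simp only [minusVec, map_smul, map_add, pair_K1 p hb, zero_add, add_comm 1 k, mul_add 2 k,
      pow_add, mul_one, mul_inv, hqQ]
    match_scalars
    · linear_combination (-p.qs⁻¹ ^ k * p.q ^ (2 * k) * p.q ^ 2 * (p.q ^ (2 * k))⁻¹ * p.qs⁻¹) *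
        (inv_mul_cancel₀ hQ)
    · linear_combination (-p.qs⁻¹ ^ k * (p.q ^ 2 + 1) * (p.q ^ (2 * k))⁻¹ * p.qs⁻¹) *
        (inv_mul_cancel₀ hQ)

theorem baxter_minus : clsW p 1 1 lam * clsRhoMinus p lam =
    clsU p 1 1 * clsRhoMinus p (p.qs⁻¹ * lam) +
      sigma p * clsU p (-1) 1 * clsRhoMinus p (p.qs * lam) := by
  have hb := rhoMinus_isLadder p lam
  have hQ := p.qs_ne_zero
  have hq := p.q_ne_zero
  let L := ladder p (-p.qs⁻¹) (neg_inv_qs_ne_zero p) (-1) (p.qs * lam) (fockMinusCoeff p)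
    (fockMinusCoeff_zero p) (fockMinusCoeff_serre p)
  let bL : Module.Basis ℕ ℂ L.V := ladderBasis ..
  have hbL : IsLadder L _ _ _ _ bL := ladder_isLadder ..
  let T := ladder p p.qs hQ 1 (p.qs⁻¹ * lam) (fockMinusCoeff p) (fockMinusCoeff_zero p)
    (fockMinusCoeff_serre p)
  let bT : Module.Basis ℕ ℂ T.V := ladderBasis ..
  have hbT : IsLadder T _ _ _ _ bT := ladder_isLadder ..
  have eT : clsU p 1 1 * clsRhoMinus p (p.qs⁻¹ * lam) = cls T (ladder_inO ..) :=
    clsU_mul_of_isLadder (rhoMinus_isLadder p _) hbT 1 1 (by rw [← QParam.qs]; simp) rfl _ _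
  have eL : sigma p * clsU p (-1) 1 * clsRhoMinus p (p.qs * lam) = cls L (ladder_inO ..) := by
    rw [sigma_mul_clsU]
    exact clsU_mul_of_isLadder (rhoMinus_isLadder p _) hbL (-1) (-1)
      (by rw [p.qsPow_neg, ← QParam.qs]; simp) (by simp) _ _
  rw [eL, eT, add_comm]
  -- Now $e_{1/2}\otimes|k\rangle$ represents the basis of the quotient, and
  -- $e_{-1/2}\otimes|k\rangle$ is eliminated by setting `minusVec` equal to zero.
  let A : ℕ → T.V := fun k => p.qs ^ k • bT k
  let B : ℕ → T.V := fun k =>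
    (-(p.q ^ 2 + 1) * (p.q ^ (2 * (k + 1)))⁻¹ * p.qs ^ (k + 1)) • bT (k + 1)
  have hA : ∀ k, A k = p.qs ^ k • bT k := fun _ => rfl
  have hB : ∀ k, B k =
    (-(p.q ^ 2 + 1) * (p.q ^ (2 * (k + 1)))⁻¹ * p.qs ^ (k + 1)) • bT (k + 1) := fun _ => rfl
  have hqi : p.qs⁻¹ = -p.qs * (p.q ^ 2)⁻¹ := by
    rw [q_sq, inv_neg]
    field_simp
  have h2 : p.q ^ 2 * (p.q ^ 2)⁻¹ = 1 := mul_inv_cancel₀ (pow_ne_zero _ hq)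
  let g := pairHom p hb A B
    (fun k => by
      rw [hA, map_smul, hbT.parity]
      push_cast
      module)
    (fun k => by
      rw [hB, map_smul, hbT.parity]
      push_cast
      module)
    (fun k => by
      rw [hA, hA, hB, map_smul, hbT.E0, mul_add, pow_add, mul_one, mul_inv, pow_succ, hqi]
      have h5 : p.q ^ (2 * k) * (p.q ^ (2 * k))⁻¹ = 1 := mul_inv_cancel₀ (pow_ne_zero _ hq)
      match_scalars
      linear_combination (lam * p.qs ^ k * p.qs * (p.q ^ 2 + 1) * (p.q ^ 2)⁻¹) * h5 +
        (lam * p.qs ^ k * p.qs) * h2)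
    (fun k => by
      rw [hB, hB, map_smul, hbT.E0, mul_add 2 (k + 1), pow_add p.q (2 * (k + 1)), mul_one,
        mul_inv _ (p.q ^ 2), pow_succ p.qs (k + 1), hqi]
      module)
    (by rw [hA, map_smul, hbT.E1_zero, smul_zero])
    (fun k => by
      rw [hA, hA, map_smul, hbT.E1_succ, pow_succ]
      match_scalars
      linear_combination (p.qs ^ k * lam * fockMinusCoeff p (k + 1)) * mul_inv_cancel₀ hQ)
    (by
      have h := fockMinusCoeff_relation p 0
      rw [fockMinusCoeff_zero, mul_zero, add_zero] at h
      rw [hA, hB, map_smul, hbT.E1_succ]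
      simp only [zero_add, mul_one, pow_one, pow_zero] at h ⊢
      match_scalars
      linear_combination lam * h - (p.q ^ 2 + 1) * (p.q ^ 2)⁻¹ * lam * fockMinusCoeff p 1 *
        mul_inv_cancel₀ hQ)
    (fun k => by
      have h := fockMinusCoeff_relation p (k + 1)
      rw [hA, hB, hB, map_smul, hbT.E1_succ, mul_add 2 (k + 1), pow_add _ (2 * (k + 1)), mul_one,
        mul_inv _ (p.q ^ 2), pow_succ p.qs (k + 1)]
      match_scalars
      linear_combination (lam * (p.q ^ (2 * (k + 1)))⁻¹ * p.qs ^ (k + 1)) * h -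
        ((p.q ^ 2 + 1) * (p.q ^ 2)⁻¹ * lam * fockMinusCoeff p (k + 1 + 1) *
          (p.q ^ (2 * (k + 1)))⁻¹ * p.qs ^ (k + 1)) * mul_inv_cancel₀ hQ)
    (fun k => by
      rw [hA, map_smul, hbT.K0, zero_add, smul_comm])
    (fun k => by
      rw [hB, map_smul, hbT.K0, add_comm 1 k, smul_comm])
    (fun k => by
      rw [hA, map_smul, hbT.K1, zero_add, smul_comm])
    (fun k => by
      rw [hB, map_smul, hbT.K1, add_comm 1 k, smul_comm])
  let rB : ℕ → L.V := fun k => ((p.q ^ (2 * (k + 1)))⁻¹ * p.qs ^ k) • bL k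
  have e0 := constr_pairVec_zero p (lam := lam) (b := rhoMinusBasis p lam) (fun _ => 0) rB
  have e1 := constr_pairVec_one p (lam := lam) (b := rhoMinusBasis p lam) (fun _ => 0) rB
  have hqk : ∀ k : ℕ, p.q ^ (2 * (k + 1)) ≠ 0 := fun k => pow_ne_zero _ hq
  refine cls_pair_eq_add p _ _ _ hbL (minusVec_isLadder p lam) (bT := bT) g A B rfl
    (fun _ => 0) rB (fun k => (p.qs ^ k)⁻¹ • pairVec p lam (rhoMinusBasis p lam) 0 k)
    (fun k => ?_) (fun k => ?_) (fun k => ?_) (fun k => ?_)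
  · rw [minusVec, map_smul, map_add, map_smul, map_smul, e0, e1, smul_zero, add_zero, smul_smul,
      smul_smul, mul_assoc, mul_inv_cancel_left₀ (hqk k), inv_pow,
      inv_mul_cancel₀ (pow_ne_zero _ hQ), one_smul]
  · rw [map_smul]
    refine (congrArg _ (constr_pairVec_zero p A B k)).trans ?_
    rw [hA, smul_smul, inv_mul_cancel₀ (pow_ne_zero _ hQ), one_smul]
  · rw [map_zero, zero_add, hA, map_smul, Module.Basis.constr_basis, smul_smul,
      mul_inv_cancel₀ (pow_ne_zero _ hQ), one_smul]
  · have h5 := hqk k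
    rw [hB, map_smul, map_smul, Module.Basis.constr_basis, Module.Basis.constr_basis, minusVec,
      inv_pow]
    match_scalars <;> field_simp
    ring

end Baxter

end

end BorelC22

/-! ### Assembly of the relations -/

open BorelC22 in
theorem mainTheorem3 (p : QParam) (lam : ℂ) (hlam : lam ≠ 0) :
    -- multiplication by the parity element
    (sigma p * sigma p = 1 ∧
      (∀ (s : ℂ) (ε : ℤˣ), sigma p * clsVerma p s ε lam = clsVerma p s (-ε) lam) ∧
      (∀ (r : ℂ) (ε : ℤˣ), sigma p * clsU p r ε = clsU p r (-ε))) ∧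
    -- `f_s = [U_{-s}] / (1 - σ [U_{-2}])`, which is invertible
    (IsUnit (1 - sigma p * clsU p (-2) 1) ∧
      ∀ s : ℂ, IsUnit (fSum p s) ∧
        fSum p s = clsU p (-s) 1 * Ring.inverse (1 - sigma p * clsU p (-2) 1)) ∧
    -- decomposition of `ρ₊(q_*^{s/2+1/2} λ) ⊗ ρ₋(q_*^{-s/2-1/2} λ)`
    (∀ s : ℂ,
      (∃ h : (Rep.directSum fun m : ℕ =>
            (charU p (-s - 2 * m) 1).tensor (verma p s ((-1) ^ m) lam)).InO,
          cls ((rhoPlus p (p.qsPow (s / 2 + 1 / 2) * lam)).tensor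
              (rhoMinus p (p.qsPow (-s / 2 - 1 / 2) * lam)))
              ((rhoPlus_inO p _).tensor (rhoMinus_inO p _)) = cls _ h) ∧
        clsRhoPlus p (p.qsPow (s / 2 + 1 / 2) * lam) *
            clsRhoMinus p (p.qsPow (-s / 2 - 1 / 2) * lam) =
          clsVerma p s 1 lam * fSum p s) ∧
    -- the evaluation modules of highest weight `s = 0, 1, 2, …`
    (∀ s : ℕ,
      (∀ ε : ℤˣ, clsVerma p s ε lam =
        clsW p s ε lam + clsVerma p (-s - 2) (ε * (-1) ^ (s + 1)) lam) ∧
      clsVerma p s 1 lam = clsW p s 1 lam + sigma p ^ (s + 1) * clsVerma p (-s - 2) 1 lam ∧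
      clsW p s 1 lam =
        Ring.inverse (fSum p s) * clsRhoPlus p (p.qsPow (s / 2 + 1 / 2) * lam) *
            clsRhoMinus p (p.qsPow (-s / 2 - 1 / 2) * lam) -
          Ring.inverse (fSum p (-s - 2)) * sigma p ^ (s + 1) *
            clsRhoPlus p (p.qsPow (-s / 2 - 1 / 2) * lam) *
            clsRhoMinus p (p.qsPow (s / 2 + 1 / 2) * lam)) ∧
    -- the `q`-Wronskian identity
    (clsW p 0 1 lam = 1 ∧
      1 = Ring.inverse (fSum p 0) * clsRhoPlus p (p.qsPow (1 / 2) * lam) *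
            clsRhoMinus p (p.qsPow (-1 / 2) * lam) -
          Ring.inverse (fSum p (-2)) * sigma p * clsRhoPlus p (p.qsPow (-1 / 2) * lam) *
            clsRhoMinus p (p.qsPow (1 / 2) * lam)) ∧
    -- the Baxter relations
    (clsW p 1 1 lam * clsRhoPlus p lam =
        clsU p 1 1 * clsRhoPlus p (p.qs * lam) +
          sigma p * clsU p (-1) 1 * clsRhoPlus p (p.qs⁻¹ * lam) ∧
      clsW p 1 1 lam * clsRhoMinus p lam =
        clsU p 1 1 * clsRhoMinus p (p.qs⁻¹ * lam) +
          sigma p * clsU p (-1) 1 * clsRhoMinus p (p.qs * lam)) := by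
  -- The factorisation of $[\rho_+][\rho_-]$ solved for $[\mathcal W_s^+]$, after moving $f_s$ to
  -- the left.
  have hW : ∀ s : ℂ, clsVerma p s 1 lam = Ring.inverse (fSum p s) *
      clsRhoPlus p (p.qsPow (s / 2 + 1 / 2) * lam) *
      clsRhoMinus p (p.qsPow (-s / 2 - 1 / 2) * lam) := fun s => by
    rw [mul_assoc, clsRhoPlus_mul_clsRhoMinus p s hlam, (clsVerma_commute_fSum p s s 1 lam).eq,
      Ring.inverse_mul_cancel_left _ _ (isUnit_fSum p s)]
  have hσ : ∀ (n : ℕ) (s : ℂ),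
      sigma p ^ n * clsVerma p s 1 lam = clsVerma p s ((-1) ^ n) lam := fun n s => by
    induction n with
    | zero => simp
    | succ n ih => rw [pow_succ', mul_assoc, ih, sigma_mul_clsVerma, pow_succ', neg_one_mul]
  have hV : ∀ s : ℕ, clsVerma p s 1 lam =
      clsW p s 1 lam + sigma p ^ (s + 1) * clsVerma p (-s - 2) 1 lam := fun s => by
    rw [hσ, clsVerma_eq_add, one_mul]
  have hF : ∀ s : ℕ, clsW p s 1 lam =
      Ring.inverse (fSum p s) * clsRhoPlus p (p.qsPow (s / 2 + 1 / 2) * lam) *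
          clsRhoMinus p (p.qsPow (-s / 2 - 1 / 2) * lam) -
        Ring.inverse (fSum p (-s - 2)) * sigma p ^ (s + 1) *
          clsRhoPlus p (p.qsPow (-s / 2 - 1 / 2) * lam) *
          clsRhoMinus p (p.qsPow (s / 2 + 1 / 2) * lam) := fun s => by
    -- Replacing $s$ by $-s-2$ interchanges the two shifts of the spectral parameter.
    have h1 : (-(s : ℂ) - 2) / 2 + 1 / 2 = -s / 2 - 1 / 2 := by ring
    have h2 : -(-(s : ℂ) - 2) / 2 - 1 / 2 = s / 2 + 1 / 2 := by ring
    have h := hV s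
    rw [hW s, hW (-s - 2), h1, h2] at h
    have hc : Commute (sigma p ^ (s + 1)) (Ring.inverse (fSum p (-s - 2))) :=
      (commute_ringInverse (clsU_commute_fSum p 0 (-s - 2) (-1)) (isUnit_fSum p _)).pow_left _
    rw [← hc.eq, h]
    simp only [mul_assoc, add_sub_cancel_right]
  refine ⟨⟨sigma_mul_sigma p, fun s ε => sigma_mul_clsVerma p s ε lam, sigma_mul_clsU p⟩,
    ⟨isUnit_one_sub p, fun s => ⟨isUnit_fSum p s, fSum_eq p s⟩⟩, fun s => ⟨?_, ?_⟩,
    fun s => ⟨fun ε => clsVerma_eq_add p s ε lam, hV s, hF s⟩, ⟨clsW_zero p lam, ?_⟩,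
    baxter_plus p lam, baxter_minus p lam⟩
  · obtain ⟨h, e⟩ := exists_cls_directSum_charU_tensor_verma p s lam
    refine ⟨h, ?_⟩
    rw [e, cls_tensor]
    exact clsRhoPlus_mul_clsRhoMinus p s hlam
  · exact clsRhoPlus_mul_clsRhoMinus p s hlam
  · have h := hF 0
    rw [clsW_zero] at h
    -- Brings the exponent $-1/2$ to a single normal form, so that the case $s=0$ matches the stated
    -- identity after simplification.
    have e1 : (-1 / 2 : ℂ) = -(1 / 2) := by ring
    simpa [e1] using h
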